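/- Let $\mathbf H=\mathbb R^n$ be a homogeneous group: a (nilpotent) Lie group whose multiplication and inversion are polynomial maps, whose identity is $0$, and for which the dilations $t\circ(x_1,\dots,x_n)=(t^{\alpha_1}x_1,\dots,t^{\alpha_n}x_n)$, $t>0$, are group automorphisms, for some fixed $0<\alpha_1\le\dots\le\alpha_n$. Let $N=\alpha_1+\dots+\alpha_n$, and let $\rho$ be the function on $\mathbf H$ that equals $1$ on the Euclidean unit sphere and satisfies $\rho(t\circ x)=t\rho(x)$ for $t>0$. Let $K$ be a real-valued function on $\mathbf H$ with $K(t\circ x)=t^{-N}K(x)$ for all $t>0$ and $x\ne0$, and let $K_0$ be its restriction to the unit annulus $A_0=\{x:1\le\rho(x)\le2\}$. Suppose that $K_0\in L\log L(A_0)$, that is, $K_0$ is measurable and $\int_{A_0}|K_0|\log(2+|K_0|)\,dx<\infty$, and that $K_0$ has mean zero, $\int_{A_0}K_0\,dx=0$. Then the operator $T:f\mapsto f*K$, defined on smooth compactly supported real-valued functions $f$ by the principal value $$ f*K(x)=\lim_{\varepsilon\to0^+}\int_{\rho(y^{-1}x)>\varepsilon}f(y)\,K(y^{-1}x)\,dy,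 $$ is bounded on $L^2$: for every such $f$ the truncated integrals converge absolutely and the limit exists for almost every $x$, and $T$ extends to a bounded linear operator on $L^2(\mathbf H)$ (real-valued functions, Lebesgue measure). -/

import Mathlib

open MeasureTheory Filter Topology
open scoped ContDiff

/-- A homogeneous group: the space `ℝⁿ` with polynomial multiplication and inversion forming a
group with identity `0`, together with exponents `0 < α₁ ≤ … ≤ αₙ` such that every dilation
`(x₁, …, xₙ) ↦ (t ^ α₁ x₁, …, t ^ αₙ xₙ)`, `t > 0`, is multiplicative.
(The existence of these dilations forces the group to be a nilpotent Lie group.) -/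
structure HomogeneousGroup (n : ℕ) where
  mul : EuclideanSpace ℝ (Fin n) → EuclideanSpace ℝ (Fin n) → EuclideanSpace ℝ (Fin n)
  inv : EuclideanSpace ℝ (Fin n) → EuclideanSpace ℝ (Fin n)
  exponent : Fin n → ℝ
  mul_assoc : ∀ x y z, mul (mul x y) z = mul x (mul y z)
  zero_mul : ∀ x, mul 0 x = x
  mul_zero : ∀ x, mul x 0 = x
  inv_mul : ∀ x, mul (inv x) x = 0
  mul_inv : ∀ x, mul x (inv x) = 0
  mul_polynomial : ∀ i, ∃ P : MvPolynomial (Fin n ⊕ Fin n) ℝ,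
    ∀ x y, mul x y i = MvPolynomial.eval (Sum.elim (fun j => x j) (fun j => y j)) P
  inv_polynomial : ∀ i, ∃ P : MvPolynomial (Fin n) ℝ,
    ∀ x, inv x i = MvPolynomial.eval (fun j => x j) P
  exponent_pos : ∀ i, 0 < exponent i
  exponent_mono : Monotone exponent
  dilate_mul : ∀ t : ℝ, 0 < t → ∀ x y,
    (WithLp.toLp 2 (fun i => t ^ exponent i * mul x y i) : EuclideanSpace ℝ (Fin n)) =
      mul (WithLp.toLp 2 (fun i => t ^ exponent i * x i))
        (WithLp.toLp 2 (fun i => t ^ exponent i * y i))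

/-- Membership in the Zygmund class `L log L`, for a finite measure `μ`. -/
def MemLLogL {X : Type*} [MeasurableSpace X] (f : X → ℝ) (μ : Measure X) : Prop :=
  AEStronglyMeasurable f μ ∧ Integrable (fun x => |f x| * Real.log (2 + |f x|)) μ

namespace HomogeneousGroup

variable {n : ℕ} (G : HomogeneousGroup n)

/-- The dilation `t ∘ x`. -/
noncomputable def dilate (t : ℝ) (x : EuclideanSpace ℝ (Fin n)) : EuclideanSpace ℝ (Fin n) :=
  WithLp.toLp 2 (fun i => t ^ G.exponent i * x i)

/-- The homogeneous dimension `N = α₁ + ⋯ + αₙ`. -/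
noncomputable def homDim : ℝ := ∑ i, G.exponent i

/-- The homogeneous norm `ρ`: for `x ≠ 0`, `ρ x` is the `t > 0` for which `t⁻¹ ∘ x` lies on the
Euclidean unit sphere, and `ρ 0 = 0`. -/
noncomputable def rho (x : EuclideanSpace ℝ (Fin n)) : ℝ :=
  sInf {t : ℝ | 0 < t ∧ ‖G.dilate t⁻¹ x‖ ≤ 1}

theorem dilate_dilate {s t : ℝ} (hs : 0 ≤ s) (ht : 0 ≤ t) (x : EuclideanSpace ℝ (Fin n)) :
    G.dilate s (G.dilate t x) = G.dilate (s * t) x := by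
  ext i
  simp only [dilate]
  rw [Real.mul_rpow hs ht]
  ring

open scoped Pointwise in
/-- `ρ (t ∘ x) = t ρ x`; with the next fact, this characterizes `ρ`. -/
theorem rho_dilate {s : ℝ} (hs : 0 < s) (x : EuclideanSpace ℝ (Fin n)) :
    G.rho (G.dilate s x) = s * G.rho x := by
  have h : {t : ℝ | 0 < t ∧ ‖G.dilate t⁻¹ (G.dilate s x)‖ ≤ 1} =
      s • {t : ℝ | 0 < t ∧ ‖G.dilate t⁻¹ x‖ ≤ 1} := by
    ext t
    rw [Set.mem_smul_set_iff_inv_smul_mem₀ hs.ne']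
    simp only [Set.mem_ofPred_eq, smul_eq_mul]
    have hp : 0 < s⁻¹ * t ↔ 0 < t := by
      constructor
      · intro h
        exact pos_of_mul_pos_right h (inv_pos.2 hs).le
      · intro h
        positivity
    rw [hp]
    refine and_congr_right fun ht => ?_
    rw [G.dilate_dilate (inv_pos.2 ht).le hs.le, mul_inv_rev, inv_inv]
  rw [rho, h, Real.sInf_smul_of_nonneg hs.le, smul_eq_mul, rho]

/-- `ρ` equals one on the Euclidean unit sphere. -/
theorem rho_of_norm_eq_one {x : EuclideanSpace ℝ (Fin n)} (hx : ‖x‖ = 1) : G.rho x = 1 := by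
  have h1 : G.dilate 1 x = x := by
    ext i
    simp [dilate]
  refine IsLeast.csInf_eq ⟨⟨one_pos, ?_⟩, ?_⟩
  · rw [inv_one, h1, hx]
  · rintro t ⟨ht, htx⟩
    by_contra! hlt
    have hr : 1 < t⁻¹ := (one_lt_inv₀ ht).2 hlt
    obtain ⟨j, hj⟩ : ∃ j, x j ≠ 0 := by
      by_contra! h
      have : x = 0 := by
        ext i
        simpa using h i
      simp [this] at hx
    have hgt : ∀ i, 1 < t⁻¹ ^ G.exponent i := fun i =>
      Real.one_lt_rpow hr (G.exponent_pos i)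
    have hlt2 : ‖x‖ ^ 2 < ‖G.dilate t⁻¹ x‖ ^ 2 := by
      rw [EuclideanSpace.real_norm_sq_eq, EuclideanSpace.real_norm_sq_eq]
      refine Finset.sum_lt_sum (fun i _ => ?_) ⟨j, Finset.mem_univ j, ?_⟩
      · simp only [dilate, mul_pow]
        nlinarith [hgt i, sq_nonneg (x i), one_le_pow₀ (n := 2) (hgt i).le]
      · simp only [dilate, mul_pow]
        have : 0 < x j ^ 2 := by positivity
        nlinarith [hgt j, one_lt_pow₀ (hgt j) two_ne_zero]
    rw [hx] at hlt2
    nlinarith [norm_nonneg (G.dilate t⁻¹ x)]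

/-- The unit annulus `A₀ = {x : 1 ≤ ρ x ≤ 2}`. -/
def unitAnnulus : Set (EuclideanSpace ℝ (Fin n)) := {x | 1 ≤ G.rho x ∧ G.rho x ≤ 2}

/-- `K (t ∘ x) = t ^ (-N) K x`. The value of `K` at the single point `0` is irrelevant. -/
def IsHomogeneousKernel (K : EuclideanSpace ℝ (Fin n) → ℝ) : Prop :=
  ∀ t : ℝ, 0 < t → ∀ x, x ≠ 0 → K (G.dilate t x) = t ^ (-G.homDim) * K x

/-- The convolution `(f * K) x = ∫ f y K (y⁻¹ x) dy` exists as a principal value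
`lim_{ε → 0} ∫_{ρ (y⁻¹ x) > ε} f y K (y⁻¹ x) dy` at the point `x`, and is equal to `v`;
each truncated integral is required to converge absolutely. -/
def HasConvolutionAt (f K : EuclideanSpace ℝ (Fin n) → ℝ) (x : EuclideanSpace ℝ (Fin n))
    (v : ℝ) : Prop :=
  (∀ ε : ℝ, 0 < ε →
    IntegrableOn (fun y => f y * K (G.mul (G.inv y) x)) {y | ε < G.rho (G.mul (G.inv y) x)}) ∧
  Tendsto (fun ε : ℝ => ∫ y in {y | ε < G.rho (G.mul (G.inv y) x)},
    f y * K (G.mul (G.inv y) x)) (𝓝[>] 0) (𝓝 v)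

/-- The operator `f ↦ f * K` is bounded on `L²`: some bounded linear operator on `L²` is given
on the (dense) class of smooth compactly supported functions by the principal value
convolution with `K`, which exists almost everywhere. -/
def ConvolutionBoundedOnL2 (K : EuclideanSpace ℝ (Fin n) → ℝ) : Prop :=
  ∃ T : Lp ℝ 2 (volume : Measure (EuclideanSpace ℝ (Fin n))) →L[ℝ]
      Lp ℝ 2 (volume : Measure (EuclideanSpace ℝ (Fin n))),
    ∀ (f : EuclideanSpace ℝ (Fin n) → ℝ) (hf : ContDiff ℝ ∞ f) (hc : HasCompactSupport f),
      ∀ᵐ x, G.HasConvolutionAt f K x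
        (T ((hf.continuous.memLp_of_hasCompactSupport hc).toLp f) x)

end HomogeneousGroup

/-! The operator is cut into dyadic pieces along the dilations, and the pieces are shown to be
almost orthogonal. Everything is done for a unitary representation `π` of the group, applied in the
end to the right regular representation. The average of `π (e ^ (t + s) ∘ x)`
against `κ x η s dx ds`, for
a kernel `κ` on the unit annulus and a smooth cutoff `η` on the line, is `UnitaryRep.op π η κ t`.
When `κ` is the kernel `K` restricted to the annulus and the integer translates of `η` sum to one,
the sum of the adjoints of these averages over `t = -J, …, J` is, by homogeneity, convolution with
`K` times a radial weight that tends to `log 2` (`IsHomogeneousKernel.coeFn_adjoint_sum_op`). So it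
suffices to bound these sums in operator norm, independently of `J`.

The smoothness that the kernel lacks is supplied by the dilations. For fixed points `x₁, …, xₙ` the
product `(e ^ s₁ ∘ x₁) ⋯ (e ^ sₙ ∘ xₙ)` is a smooth map of the `n` parameters `s`. Its Jacobian is a
polynomial in the dilated points which is not identically zero
(`HomogeneousGroup.exists_jac_zero_ne`), because near the identity the group law is addition to
first order. Hence the Jacobian is small only on a small set of points
(`exists_volume_jac_sublevel_le`). Elsewhere a left translation of the product can be realized by a
vector field on the parameter space, by Cramer's rule, and integrated by parts onto the cutoffs.
Consequently a product of `n` averages at scale one, multiplied by `π y - 1`, has norm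
`O(‖y‖ ^ ε)` (`UnitaryRep.exists_norm_sub_one_mul_prod_le`), with a constant that depends on the
kernels only through their supports and suprema.

If one kernel has mean zero, its average at a small scale `e ^ t` is an average of `π y - 1` over
small `y`, so its product with such an `n`-fold product is `O(exp (c t))`. The `TT⋆` identity
`‖A‖ ^ 2 = ‖A A⋆‖`, iterated, turns this into the same statement for the product of just two
averages (`exists_norm_op_mul_op_le`). The Cotlar–Stein lemma then bounds the sum over all scales
(`exists_norm_sum_op_le`). Using the trivial `L¹` bound for scales at distance at most `L` and the
decay for the others, the result is `C ((L + 1) ‖κ‖₁ + ‖κ‖_∞ exp (-c L))`.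

The logarithm enters through the choice of `L`. The part of `K` where `|K|` is about `2 ^ k`,
corrected to have mean zero, is estimated with `L` proportional to `k + 1`, so that the second term
is summable in `k`, while the first terms add up to the `L log L` integral
(`exists_norm_sum_op_le_of_memLLogL`).

Finally, integration against a homogeneous kernel with mean zero annihilates radial functions
supported in annuli (`IsHomogeneousKernel.integral_mul_radial_eq_zero`). Therefore the principal
value exists at every point and coincides with the limit of the smoothly truncated convolutions
(`IsHomogeneousKernel.exists_hasConvolutionAt`), the `L²` bound passes to the limit by Fatou's
lemma (`IsHomogeneousKernel.exists_eLpNorm_le`), and the operator extends by density. -/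

/-- The Euclidean space underlying a homogeneous group. -/
local notation "𝔼" n:max => EuclideanSpace ℝ (Fin n)

namespace HomogeneousGroup

variable {n : ℕ} (G : HomogeneousGroup n)

/-! ### The group law, the dilations and the homogeneous norm -/

theorem inv_unique {x y : 𝔼 n} (h : G.mul x y = 0) : y = G.inv x := by
  have := congrArg (G.mul (G.inv x)) h
  rwa [← G.mul_assoc, G.inv_mul, G.zero_mul, G.mul_zero] at this

theorem inv_inv (x : 𝔼 n) : G.inv (G.inv x) = x :=
  (G.inv_unique (G.inv_mul x)).symm

theorem inv_zero : G.inv 0 = 0 := (G.inv_unique (G.zero_mul 0)).symm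

theorem inv_mul_cancel_left (x y : 𝔼 n) : G.mul (G.inv x) (G.mul x y) = y := by
  rw [← G.mul_assoc, G.inv_mul, G.zero_mul]

theorem mul_inv_cancel_left (x y : 𝔼 n) : G.mul x (G.mul (G.inv x) y) = y := by
  rw [← G.mul_assoc, G.mul_inv, G.zero_mul]

theorem mul_inv_rev (x y : 𝔼 n) : G.inv (G.mul x y) = G.mul (G.inv y) (G.inv x) := by
  symm
  apply G.inv_unique
  rw [G.mul_assoc, G.mul_inv_cancel_left, G.mul_inv]

/-- The dilations as a one-parameter group, `dil s = e ^ s ∘ ·`. -/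
noncomputable def dil (s : ℝ) (x : 𝔼 n) : 𝔼 n := G.dilate (Real.exp s) x

theorem dil_apply (s : ℝ) (x : 𝔼 n) (i : Fin n) :
    G.dil s x i = Real.exp (s * G.exponent i) * x i := by
  simp [dil, dilate, Real.exp_mul]

theorem dil_zero_left (x : 𝔼 n) : G.dil 0 x = x := by
  ext i; simp [dil_apply]

theorem dil_zero (s : ℝ) : G.dil s (0 : 𝔼 n) = 0 := by
  ext i; simp [dil_apply]

theorem dil_dil (s t : ℝ) (x : 𝔼 n) : G.dil s (G.dil t x) = G.dil (s + t) x := by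
  ext i; simp only [dil_apply, add_mul, Real.exp_add]; ring

theorem dil_add (s : ℝ) (x y : 𝔼 n) : G.dil s (x + y) = G.dil s x + G.dil s y := by
  ext i; simp only [dil_apply, PiLp.add_apply]; ring

theorem dil_smul (s c : ℝ) (x : 𝔼 n) : G.dil s (c • x) = c • G.dil s x := by
  ext i; simp only [dil_apply, PiLp.smul_apply, smul_eq_mul]; ring

theorem dil_mul (s : ℝ) (x y : 𝔼 n) :
    G.dil s (G.mul x y) = G.mul (G.dil s x) (G.dil s y) :=
  G.dilate_mul (Real.exp s) (Real.exp_pos s) x y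

theorem dil_inv (s : ℝ) (x : 𝔼 n) : G.dil s (G.inv x) = G.inv (G.dil s x) := by
  apply G.inv_unique
  rw [← G.dil_mul, G.mul_inv, G.dil_zero]

/-- A dilation as a continuous linear map. -/
noncomputable def dilL (s : ℝ) : 𝔼 n →L[ℝ] 𝔼 n :=
  LinearMap.toContinuousLinearMap
    { toFun := G.dil s
      map_add' := G.dil_add s
      map_smul' := G.dil_smul s }

@[simp] theorem dilL_apply (s : ℝ) (x : 𝔼 n) : G.dilL s x = G.dil s x := rfl

theorem det_dilL (s : ℝ) : (G.dilL s).det = Real.exp (s * G.homDim) := by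
  have h : ((G.dilL s : 𝔼 n →L[ℝ] 𝔼 n) : 𝔼 n →ₗ[ℝ] 𝔼 n) =
      Matrix.toLin (EuclideanSpace.basisFun (Fin n) ℝ).toBasis
        (EuclideanSpace.basisFun (Fin n) ℝ).toBasis
        (Matrix.diagonal fun i => Real.exp (s * G.exponent i)) := by
    apply (EuclideanSpace.basisFun (Fin n) ℝ).toBasis.ext
    intro i
    rw [Matrix.toLin_self]
    ext j
    simp [dil_apply, Matrix.diagonal_apply]
    aesop
  rw [ContinuousLinearMap.det, h, LinearMap.det_toLin, Matrix.det_diagonal, ← Real.exp_sum,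
    homDim, Finset.mul_sum]

theorem contDiff_mul : ContDiff ℝ ∞ (fun p : 𝔼 n × 𝔼 n => G.mul p.1 p.2) := by
  rw [contDiff_euclidean]
  intro i
  obtain ⟨P, hP⟩ := G.mul_polynomial i
  simp_rw [hP]
  have h : AnalyticOnNhd ℝ (fun p : 𝔼 n × 𝔼 n =>
      MvPolynomial.aeval (Sum.elim (fun j => p.1 j) (fun j => p.2 j)) P) Set.univ := by
    intro p _
    apply AnalyticAt.aeval_mvPolynomial
    rintro (j | j)
    · exact ((EuclideanSpace.proj j).comp (ContinuousLinearMap.fst ℝ (𝔼 n) (𝔼 n))).analyticAt p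
    · exact ((EuclideanSpace.proj j).comp (ContinuousLinearMap.snd ℝ (𝔼 n) (𝔼 n))).analyticAt p
  exact h.contDiff

theorem contDiff_inv : ContDiff ℝ ∞ G.inv := by
  rw [contDiff_euclidean]
  intro i
  obtain ⟨P, hP⟩ := G.inv_polynomial i
  simp_rw [hP]
  have h : AnalyticOnNhd ℝ (fun p : 𝔼 n => MvPolynomial.aeval (fun j => p j) P) Set.univ := by
    intro p _
    apply AnalyticAt.aeval_mvPolynomial
    intro j
    exact (EuclideanSpace.proj j : 𝔼 n →L[ℝ] ℝ).analyticAt p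
  exact h.contDiff

theorem contDiff_dil : ContDiff ℝ ∞ (fun p : ℝ × 𝔼 n => G.dil p.1 p.2) := by
  rw [contDiff_euclidean]
  intro i
  simp only [dil_apply]
  have : ContDiff ℝ ∞ fun p : ℝ × 𝔼 n => p.2 i :=
    (EuclideanSpace.proj i : 𝔼 n →L[ℝ] ℝ).contDiff.comp contDiff_snd
  fun_prop

theorem _root_.ContDiff.group_mul {F : Type*} [NormedAddCommGroup F] [NormedSpace ℝ F]
    {f g : F → 𝔼 n} (hf : ContDiff ℝ ∞ f) (hg : ContDiff ℝ ∞ g) :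
    ContDiff ℝ ∞ (fun p => G.mul (f p) (g p)) :=
  G.contDiff_mul.comp (hf.prodMk hg)

theorem _root_.Continuous.group_mul {F : Type*} [TopologicalSpace F]
    {f g : F → 𝔼 n} (hf : Continuous f) (hg : Continuous g) :
    Continuous (fun p => G.mul (f p) (g p)) :=
  G.contDiff_mul.continuous.comp (hf.prodMk hg)

theorem _root_.Continuous.group_dil {F : Type*} [TopologicalSpace F]
    {f : F → ℝ} {g : F → 𝔼 n} (hf : Continuous f) (hg : Continuous g) :
    Continuous (fun p => G.dil (f p) (g p)) :=
  G.contDiff_dil.continuous.comp (hf.prodMk hg)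

/-- A positive number below all exponents. -/
theorem exists_exponent_lower : ∃ a : ℝ, 0 < a ∧ ∀ i, a ≤ G.exponent i := by
  obtain rfl | hn := Nat.eq_zero_or_pos n
  · exact ⟨1, one_pos, fun i => i.elim0⟩
  · exact ⟨G.exponent ⟨0, hn⟩, G.exponent_pos _, fun i => G.exponent_mono (Nat.zero_le _)⟩

theorem norm_dil_le_of_forall {s c : ℝ} (h : ∀ i, Real.exp (s * G.exponent i) ≤ c) (hc : 0 ≤ c)
    (x : 𝔼 n) : ‖G.dil s x‖ ≤ c * ‖x‖ := by
  rw [← abs_of_nonneg (norm_nonneg (G.dil s x)), ← abs_of_nonneg (mul_nonneg hc (norm_nonneg x)),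
    ← sq_le_sq, mul_pow, EuclideanSpace.real_norm_sq_eq, EuclideanSpace.real_norm_sq_eq,
    Finset.mul_sum]
  refine Finset.sum_le_sum fun i _ => ?_
  rw [dil_apply, mul_pow]
  gcongr
  exact h i

/-- Contracting dilations contract at an exponential rate in the Euclidean norm. -/
theorem exists_norm_dil_le : ∃ a : ℝ, 0 < a ∧
    ∀ s : ℝ, s ≤ 0 → ∀ x : 𝔼 n, ‖G.dil s x‖ ≤ Real.exp (a * s) * ‖x‖ := by
  obtain ⟨a, ha, h⟩ := G.exists_exponent_lower
  refine ⟨a, ha, fun s hs x => G.norm_dil_le_of_forall (fun i => ?_) (Real.exp_pos _).le x⟩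
  rw [Real.exp_le_exp]
  nlinarith [h i]

theorem norm_dil_le {s : ℝ} (hs : s ≤ 0) (x : 𝔼 n) : ‖G.dil s x‖ ≤ ‖x‖ := by
  have := G.norm_dil_le_of_forall (s := s) (c := 1) (fun i => ?_) zero_le_one x
  · simpa using this
  · rw [Real.exp_le_one_iff]
    exact mul_nonpos_of_nonpos_of_nonneg hs (G.exponent_pos i).le

theorem tendsto_dil_atBot (x : 𝔼 n) : Tendsto (fun s => G.dil s x) atBot (𝓝 0) := by
  obtain ⟨a, ha, h⟩ := G.exists_norm_dil_le
  apply squeeze_zero_norm' (a := fun s => Real.exp (a * s) * ‖x‖)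
  · filter_upwards [eventually_le_atBot 0] with s hs using h s hs x
  · have : Tendsto (fun s => Real.exp (a * s)) atBot (𝓝 0) :=
      Real.tendsto_exp_atBot.comp (tendsto_id.const_mul_atBot ha)
    simpa using this.mul_const ‖x‖

/-- Dilations with parameters in a bounded set map balls into a common ball. -/
theorem exists_norm_dil_le_of_le (M R : ℝ) : ∃ R' : ℝ, 0 < R' ∧
    ∀ s : ℝ, s ≤ M → ∀ x : 𝔼 n, ‖x‖ ≤ R → ‖G.dil s x‖ ≤ R' := by
  obtain ⟨C, hC⟩ := ((isCompact_closedBall (0 : 𝔼 n) R).image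
    (Continuous.group_dil G (continuous_const (y := M)) continuous_id)).isBounded.exists_norm_le
  refine ⟨max C 1, by positivity, fun s hs x hx => ?_⟩
  have h : G.dil s x = G.dil (s - M) (G.dil M x) := by rw [dil_dil]; ring_nf
  rw [h]
  refine (G.norm_dil_le (by linarith) _).trans ((hC _ ⟨x, by simpa using hx, rfl⟩).trans
    (le_max_left _ _))

/-- Volume is preserved by a bijection whose Jacobian is `±1`. -/
theorem measurePreserving_of_abs_det_eq_one {F : 𝔼 n → 𝔼 n} (hF : ContDiff ℝ ∞ F)
    (hb : Function.Bijective F) (hd : ∀ x, |(fderiv ℝ F x).det| = 1) :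
    MeasurePreserving F volume volume := by
  refine ⟨hF.continuous.measurable, ?_⟩
  ext s hs
  rw [Measure.map_apply hF.continuous.measurable hs]
  have h := lintegral_image_eq_lintegral_abs_det_fderiv_mul (volume : Measure (𝔼 n))
    (hF.continuous.measurable hs) (f := F) (f' := fderiv ℝ F)
    (fun x _ => ((hF.differentiable (by simp)) x).hasFDerivAt.hasFDerivWithinAt)
    hb.injective.injOn (fun _ => 1)
  rw [Set.image_preimage_eq _ hb.surjective] at h
  simp only [lintegral_const, hd] at h
  simpa using h.symm

/-- If `F'` is the conjugate of `F` by a dilation, the Jacobians agree at corresponding points: the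
determinant of the dilation cancels. -/
theorem dil_eq_comp_det {F F' : 𝔼 n → 𝔼 n} (s : ℝ) (y : 𝔼 n)
    (hF : Differentiable ℝ F) (hF' : Differentiable ℝ F')
    (h : ∀ y, F' (G.dil s y) = G.dil s (F y)) :
    (fderiv ℝ F' (G.dil s y)).det = (fderiv ℝ F y).det := by
  have h1 : HasFDerivAt (fun y => F' (G.dilL s y))
      ((fderiv ℝ F' (G.dil s y)).comp (G.dilL s)) y :=
    HasFDerivAt.comp y (hF' _).hasFDerivAt (G.dilL s).hasFDerivAt
  have h2 : HasFDerivAt (fun y => G.dilL s (F y)) ((G.dilL s).comp (fderiv ℝ F y)) y :=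
    (G.dilL s).hasFDerivAt.comp y (hF y).hasFDerivAt
  have h3 : (fun y => F' (G.dilL s y)) = fun y => G.dilL s (F y) := by
    ext1 y; exact h y
  rw [h3] at h1
  have h4 := congrArg ContinuousLinearMap.det (h1.unique h2)
  simp only [ContinuousLinearMap.det, ContinuousLinearMap.toLinearMap_comp, LinearMap.det_comp]
    at h4
  have h5 : LinearMap.det (G.dilL s : 𝔼 n →ₗ[ℝ] 𝔼 n) ≠ 0 := by
    have := G.det_dilL s
    rw [ContinuousLinearMap.det] at this
    rw [this]
    exact (Real.exp_pos _).ne'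
  rw [mul_comm] at h4
  exact mul_left_cancel₀ h5 h4

/-- Right translations preserve Lebesgue measure: by homogeneity their Jacobian at a point
equals the one at arbitrarily contracted data, hence the one at the identity. -/
theorem measurePreserving_mul_right (z : 𝔼 n) :
    MeasurePreserving (fun x => G.mul x z) volume volume := by
  have hsm : ∀ z, ContDiff ℝ ∞ (fun x => G.mul x z) := fun z =>
    contDiff_id.group_mul G contDiff_const
  refine measurePreserving_of_abs_det_eq_one (hsm z) ?_ fun y => ?_
  · refine Function.bijective_iff_has_inverse.2 ⟨fun x => G.mul x (G.inv z), fun x => ?_,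
      fun x => ?_⟩
    · simp [G.mul_assoc, G.mul_inv, G.mul_zero]
    · simp [G.mul_assoc, G.inv_mul, G.mul_zero]
  · let D : 𝔼 n × 𝔼 n → ℝ := fun p => (fderiv ℝ (fun x => G.mul x p.2) p.1).det
    have hD : Continuous D := by
      have h1 : D = fun p => ((fderiv ℝ (fun p : 𝔼 n × 𝔼 n => G.mul p.1 p.2) p).comp
          (ContinuousLinearMap.inl ℝ (𝔼 n) (𝔼 n))).det := by
        ext p
        have h2 : HasFDerivAt (fun x => G.mul x p.2)
            ((fderiv ℝ (fun p : 𝔼 n × 𝔼 n => G.mul p.1 p.2) p).comp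
            (ContinuousLinearMap.inl ℝ (𝔼 n) (𝔼 n))) p.1 := by
          have h3 := (G.contDiff_mul.differentiable (by simp) (p.1, p.2)).hasFDerivAt
          exact HasFDerivAt.comp (f := fun e => (e, p.2)) p.1 h3 (hasFDerivAt_prodMk_left p.1 p.2)
        simp only [D]
        rw [h2.fderiv]
      rw [h1]
      refine ContinuousLinearMap.continuous_det.comp ?_
      exact (G.contDiff_mul.continuous_fderiv (by simp)).clm_comp continuous_const
    have hinv : ∀ s, D (G.dil s y, G.dil s z) = D (y, z) := fun s =>
      G.dil_eq_comp_det s y ((hsm _).differentiable (by simp)) ((hsm _).differentiable (by simp))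
        fun y => (G.dil_mul s y z).symm
    have hlim : Tendsto (fun s => D (G.dil s y, G.dil s z)) atBot (𝓝 (D (0, 0))) :=
      (hD.tendsto (0, 0)).comp ((G.tendsto_dil_atBot y).prodMk_nhds (G.tendsto_dil_atBot z))
    simp_rw [hinv] at hlim
    have h0 : D (y, z) = D (0, 0) := tendsto_nhds_unique tendsto_const_nhds hlim
    have h00 : D (0, 0) = 1 := by
      have : (fun x : 𝔼 n => G.mul x 0) = id := by ext1 x; simp [G.mul_zero]
      simp only [D]
      rw [this, fderiv_id]
      simp [ContinuousLinearMap.det]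
    change |D (y, z)| = 1
    rw [h0, h00, abs_one]

/-- Inversion preserves Lebesgue measure; its differential at `0` is an involution. -/
theorem measurePreserving_inv : MeasurePreserving G.inv volume volume := by
  have hd := G.contDiff_inv.differentiable (by simp)
  refine measurePreserving_of_abs_det_eq_one G.contDiff_inv
    (Function.Involutive.bijective G.inv_inv) fun y => ?_
  let D : 𝔼 n → ℝ := fun p => (fderiv ℝ G.inv p).det
  have hD : Continuous D :=
    ContinuousLinearMap.continuous_det.comp (G.contDiff_inv.continuous_fderiv (by simp))
  have hinv : ∀ s, D (G.dil s y) = D y := fun s =>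
    G.dil_eq_comp_det s y hd hd fun y => (G.dil_inv s y).symm
  have hlim : Tendsto (fun s => D (G.dil s y)) atBot (𝓝 (D 0)) :=
    (hD.tendsto 0).comp (G.tendsto_dil_atBot y)
  simp_rw [hinv] at hlim
  have h0 : D y = D 0 := tendsto_nhds_unique tendsto_const_nhds hlim
  have h00 : D 0 * D 0 = 1 := by
    have h1 : HasFDerivAt (fun x => G.inv (G.inv x))
        ((fderiv ℝ G.inv 0).comp (fderiv ℝ G.inv 0)) 0 := by
      have h2 := (hd (G.inv 0)).hasFDerivAt.comp 0 (hd 0).hasFDerivAt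
      rwa [G.inv_zero] at h2
    have h3 : (fun x => G.inv (G.inv x)) = id := by ext1 x; simp [G.inv_inv]
    rw [h3] at h1
    have h4 := congrArg ContinuousLinearMap.det (h1.unique (hasFDerivAt_id 0))
    simpa [ContinuousLinearMap.det, LinearMap.det_comp] using h4
  change |D y| = 1
  rw [h0]
  rcases mul_self_eq_one_iff.1 h00 with h | h <;> simp [h]

theorem measurePreserving_inv_mul (x : 𝔼 n) :
    MeasurePreserving (fun y => G.mul (G.inv y) x) volume volume :=
  (G.measurePreserving_mul_right x).comp G.measurePreserving_inv

theorem map_dil (s : ℝ) : Measure.map (G.dil s) (volume : Measure (𝔼 n)) =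
    ENNReal.ofReal (Real.exp (-(s * G.homDim))) • volume := by
  have hdet := G.det_dilL s
  rw [ContinuousLinearMap.det] at hdet
  have := Measure.map_linearMap_addHaar_eq_smul_addHaar (volume : Measure (𝔼 n))
    (f := (G.dilL s : 𝔼 n →ₗ[ℝ] 𝔼 n)) (by rw [hdet]; exact (Real.exp_pos _).ne')
  rw [hdet, ← Real.exp_neg, abs_of_pos (Real.exp_pos _)] at this
  exact this

theorem measurable_dil (s : ℝ) : Measurable (G.dil s) := (G.dilL s).continuous.measurable

theorem integral_comp_dil (s : ℝ) (f : 𝔼 n → ℝ) :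
    ∫ x, f (G.dil s x) = Real.exp (-(s * G.homDim)) * ∫ x, f x := by
  have he : MeasurableEmbedding (G.dil s) := by
    refine MeasurableEmbedding.of_measurable_inverse (g := G.dil (-s)) (G.measurable_dil s) ?_
      (G.measurable_dil _) ?_
    · have : Set.range (G.dil s) = Set.univ := by
        refine Set.eq_univ_of_forall fun x => ⟨G.dil (-s) x, ?_⟩
        rw [dil_dil, add_neg_cancel, dil_zero_left]
      rw [this]
      exact MeasurableSet.univ
    · intro x
      rw [dil_dil, neg_add_cancel, dil_zero_left]
  rw [← he.integral_map, G.map_dil, integral_smul_measure,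
    ENNReal.toReal_ofReal (Real.exp_pos _).le, smul_eq_mul]

theorem lintegral_comp_dil (s : ℝ) {f : 𝔼 n → ENNReal} (hf : AEMeasurable f) :
    ∫⁻ x, f (G.dil s x) = ENNReal.ofReal (Real.exp (-(s * G.homDim))) * ∫⁻ x, f x := by
  rw [← lintegral_map' (μ := volume) (f := f) (g := G.dil s) _ (G.measurable_dil s).aemeasurable,
    G.map_dil, lintegral_smul_measure, smul_eq_mul]
  rw [G.map_dil]
  exact hf.smul_measure _

theorem rho_dil (s : ℝ) (x : 𝔼 n) : G.rho (G.dil s x) = Real.exp s * G.rho x :=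
  G.rho_dilate (Real.exp_pos s) x

theorem dilate_inv_eq {t : ℝ} (ht : 0 < t) (x : 𝔼 n) :
    G.dilate t⁻¹ x = G.dil (-Real.log t) x := by
  rw [dil, Real.exp_neg, Real.exp_log ht]

theorem rho_nonneg (x : 𝔼 n) : 0 ≤ G.rho x :=
  Real.sInf_nonneg fun _ ht => ht.1.le

/-- Quasi-balls are dilated closed Euclidean balls: the infimum defining `ρ` is attained. -/
theorem rho_le_exp_iff (s : ℝ) (x : 𝔼 n) : G.rho x ≤ Real.exp s ↔ ‖G.dil (-s) x‖ ≤ 1 := by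
  have hset : ∀ t : ℝ, 0 < t → (t ∈ {t : ℝ | 0 < t ∧ ‖G.dilate t⁻¹ x‖ ≤ 1} ↔
      ‖G.dil (-Real.log t) x‖ ≤ 1) := fun t ht => by
    simp [ht, G.dilate_inv_eq ht]
  constructor
  · intro h
    -- the norm of `dil (-u) x` is at most one for every `u > s`, and hence for `u = s`
    have hu : ∀ u, s < u → ‖G.dil (-u) x‖ ≤ 1 := by
      intro u hu
      have hlt : G.rho x < Real.exp u := h.trans_lt (Real.exp_lt_exp.2 hu)
      have hne : {t : ℝ | 0 < t ∧ ‖G.dilate t⁻¹ x‖ ≤ 1}.Nonempty := by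
        have := (G.tendsto_dil_atBot x).norm.eventually (eventually_le_nhds
          (show ‖(0 : 𝔼 n)‖ < 1 by simp))
        obtain ⟨v, hv⟩ := this.exists
        refine ⟨Real.exp (-v), (hset _ (Real.exp_pos _)).2 ?_⟩
        simpa using hv
      obtain ⟨t, ht, htu⟩ := exists_lt_of_csInf_lt hne hlt
      have h1 := (hset t ht.1).1 ht
      have h2 : G.dil (-u) x = G.dil (Real.log t - u) (G.dil (-Real.log t) x) := by
        rw [dil_dil]; ring_nf
      rw [h2]
      refine (G.norm_dil_le ?_ _).trans h1
      have := Real.log_lt_log ht.1 htu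
      rw [Real.log_exp] at this
      linarith
    have hc : Continuous fun u => ‖G.dil (-u) x‖ :=
      (Continuous.group_dil G continuous_neg continuous_const).norm
    have hc' : Tendsto (fun u => ‖G.dil (-u) x‖) (𝓝[>] s) (𝓝 ‖G.dil (-s) x‖) :=
      (hc.tendsto s).mono_left nhdsWithin_le_nhds
    exact le_of_tendsto hc' (by filter_upwards [self_mem_nhdsWithin] with u hs using hu u hs)
  · intro h
    refine csInf_le ⟨0, fun t ht => ht.1.le⟩ ?_
    rw [hset _ (Real.exp_pos _), Real.log_exp]
    exact h

theorem rho_le_iff {t : ℝ} (ht : 0 < t) (x : 𝔼 n) :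
    G.rho x ≤ t ↔ ‖G.dil (-Real.log t) x‖ ≤ 1 := by
  rw [← G.rho_le_exp_iff, Real.exp_log ht]

theorem rho_pos {x : 𝔼 n} (hx : x ≠ 0) : 0 < G.rho x := by
  refine (G.rho_nonneg x).lt_of_ne' fun h => hx ?_
  have h1 : ∀ s, ‖G.dil s x‖ ≤ 1 := fun s => by
    have := (G.rho_le_exp_iff (-s) x).1 (by rw [h]; exact (Real.exp_pos _).le)
    simpa using this
  obtain ⟨a, ha, h2⟩ := G.exists_norm_dil_le
  have h3 : ∀ s, s ≤ 0 → ‖x‖ ≤ Real.exp (a * s) := fun s hs => by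
    have h4 := h2 s hs (G.dil (-s) x)
    rw [dil_dil, add_neg_cancel, dil_zero_left] at h4
    exact h4.trans (mul_le_of_le_one_right (Real.exp_pos _).le (h1 _))
  have h5 : Tendsto (fun s => Real.exp (a * s)) atBot (𝓝 0) :=
    Real.tendsto_exp_atBot.comp (tendsto_id.const_mul_atBot ha)
  have h6 : ‖x‖ ≤ 0 := ge_of_tendsto h5 (by
    filter_upwards [eventually_le_atBot 0] with s hs using h3 s hs)
  simpa using h6

theorem rho_zero : G.rho (0 : 𝔼 n) = 0 := by
  have h := G.rho_dil 1 0
  rw [G.dil_zero] at h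
  nlinarith [Real.add_one_lt_exp (one_ne_zero), G.rho_nonneg 0]

theorem measurable_rho : Measurable G.rho := by
  refine measurable_of_Iic fun t => ?_
  rcases lt_trichotomy t 0 with ht | rfl | ht
  · have : G.rho ⁻¹' Set.Iic t = ∅ := by
      ext x; simpa using ht.trans_le (G.rho_nonneg x)
    rw [this]; exact MeasurableSet.empty
  · have : G.rho ⁻¹' Set.Iic 0 = {0} := by
      ext x
      simp only [Set.mem_preimage, Set.mem_Iic, Set.mem_singleton_iff]
      constructor
      · intro h; by_contra hx; exact absurd (G.rho_pos hx) (not_lt.2 h)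
      · rintro rfl; exact G.rho_zero.le
    rw [this]; exact measurableSet_singleton 0
  · have : G.rho ⁻¹' Set.Iic t = {x | ‖G.dil (-Real.log t) x‖ ≤ 1} := by
      ext x; simpa using G.rho_le_iff ht x
    rw [this]
    exact measurableSet_le (G.measurable_dil _).norm measurable_const

theorem measurableSet_unitAnnulus : MeasurableSet G.unitAnnulus :=
  (measurableSet_le measurable_const G.measurable_rho).inter
    (measurableSet_le G.measurable_rho measurable_const)

/-- A quasi-ball is bounded in the Euclidean norm. -/
theorem exists_norm_le_of_rho_le (M : ℝ) :
    ∃ R : ℝ, 0 < R ∧ ∀ x : 𝔼 n, G.rho x ≤ M → ‖x‖ ≤ R := by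
  obtain ⟨R, hR, h⟩ := G.exists_norm_dil_le_of_le (Real.log (max M 1)) 1
  refine ⟨R, hR, fun x hx => ?_⟩
  have h1 := (G.rho_le_iff (show (0:ℝ) < max M 1 by positivity) x).1 (hx.trans (le_max_left _ _))
  have h2 := h _ le_rfl _ h1
  rwa [dil_dil, add_neg_cancel, dil_zero_left] at h2

/-- Conversely a Euclidean ball is contained in a quasi-ball. -/
theorem exists_rho_le_of_norm_le (R : ℝ) :
    ∃ M : ℝ, 0 < M ∧ ∀ x : 𝔼 n, ‖x‖ ≤ R → G.rho x ≤ M := by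
  obtain ⟨a, ha, h⟩ := G.exists_norm_dil_le
  have h5 : Tendsto (fun s => Real.exp (a * s) * R) atBot (𝓝 (0 * R)) :=
    (Real.tendsto_exp_atBot.comp (tendsto_id.const_mul_atBot ha)).mul_const R
  rw [MulZeroClass.zero_mul] at h5
  obtain ⟨s, hs, hs0⟩ := ((h5.eventually (eventually_le_nhds one_pos)).and
    (eventually_le_atBot 0)).exists
  refine ⟨Real.exp (-s), Real.exp_pos _, fun x hx => ?_⟩
  rw [G.rho_le_exp_iff, neg_neg]
  exact (h s hs0 x).trans ((mul_le_mul_of_nonneg_left hx (Real.exp_pos _).le).trans hs)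

end HomogeneousGroup

/-! ### Sublevel sets of polynomials -/

/-- If a real polynomial of degree at most `d` has `d`-th coefficient `c ≠ 0`, then `|p t| < l`
only on a subset of `[0, 1]` of measure `O((l / |c|) ^ (1 / (d + 1)))`: away from the real parts
of its complex roots, `p` is bounded below by the product of the distances. -/
theorem Polynomial.volume_sublevel_le (p : Polynomial ℝ) {d : ℕ} {c : ℝ} (hd : p.natDegree ≤ d)
    (hc : p.coeff d = c) (hc0 : c ≠ 0) {l : ℝ} (hl : 0 < l) :
    volume {t : ℝ | t ∈ Set.Icc (0 : ℝ) 1 ∧ |p.eval t| < l} ≤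
      ENNReal.ofReal ((2 * d + 1) * (l / |c|) ^ ((1 : ℝ) / (d + 1))) := by
  set m : ℝ := (l / |c|) ^ ((1 : ℝ) / (d + 1)) with hm
  have hlc : 0 < l / |c| := div_pos hl (abs_pos.2 hc0)
  have hm0 : 0 < m := Real.rpow_pos_of_pos hlc _
  have hmpow : m ^ (d + 1) = l / |c| := by
    rw [hm, ← Real.rpow_natCast, ← Real.rpow_mul hlc.le]
    push_cast
    rw [one_div_mul_cancel (by positivity), Real.rpow_one]
  by_cases h1 : 1 ≤ m
  · calc volume {t : ℝ | t ∈ Set.Icc (0 : ℝ) 1 ∧ |p.eval t| < l}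
        ≤ volume (Set.Icc (0 : ℝ) 1) := measure_mono fun t ht => ht.1
      _ = ENNReal.ofReal 1 := by simp
      _ ≤ _ := ENNReal.ofReal_le_ofReal (by nlinarith [Nat.cast_nonneg (α := ℝ) d])
  · push Not at h1
    have hdeg : p.natDegree = d :=
      le_antisymm hd (Polynomial.le_natDegree_of_ne_zero (by rw [hc]; exact hc0))
    set q : Polynomial ℂ := p.map (algebraMap ℝ ℂ) with hq
    have hqs : q.Splits := IsAlgClosed.splits q
    have hqd : q.natDegree = d := by rw [hq, Polynomial.natDegree_map, hdeg]
    have hlead : q.leadingCoeff = (c : ℂ) := by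
      rw [Polynomial.leadingCoeff, hqd, hq, Polynomial.coeff_map, hc]; rfl
    have hcard : q.roots.card = d := by rw [← hqs.natDegree_eq_card_roots, hqd]
    have hsub : {t : ℝ | t ∈ Set.Icc (0 : ℝ) 1 ∧ |p.eval t| < l} ⊆
        ⋃ z ∈ q.roots.toFinset, Set.Ioo (z.re - m) (z.re + m) := by
      rintro t ⟨-, ht⟩
      by_contra hnot
      simp only [Set.mem_iUnion, Multiset.mem_toFinset, not_exists] at hnot
      have hdist : ∀ z ∈ q.roots, m ≤ ‖(t : ℂ) - z‖ := by
        intro z hz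
        have h2 := hnot z hz
        rw [Set.mem_Ioo, not_and_or, not_lt, not_lt] at h2
        have h3 : m ≤ |((t : ℂ) - z).re| := by
          simp only [Complex.sub_re, Complex.ofReal_re]
          rcases h2 with h2 | h2
          · rw [abs_of_nonpos (by linarith)]; linarith
          · rw [abs_of_nonneg (by linarith)]; linarith
        exact h3.trans (Complex.abs_re_le_norm _)
      have hprod : ∀ S : Multiset ℂ, (∀ z ∈ S, m ≤ ‖(t : ℂ) - z‖) →
          m ^ S.card ≤ ‖(S.map fun z => (t : ℂ) - z).prod‖ := by
        intro S
        induction S using Multiset.induction with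
        | empty => simp
        | cons z S ih =>
          intro h
          rw [Multiset.card_cons, Multiset.map_cons, Multiset.prod_cons, norm_mul, pow_succ,
            mul_comm]
          exact mul_le_mul (h z (Multiset.mem_cons_self z S))
            (ih fun w hw => h w (Multiset.mem_cons_of_mem hw)) (by positivity) (norm_nonneg _)
      have heval : |p.eval t| = |c| * ‖(q.roots.map fun z => (t : ℂ) - z).prod‖ := by
        have h2 := hqs.eval_eq_prod_roots (t : ℂ)
        have h3 : q.eval (t : ℂ) = ((p.eval t : ℝ) : ℂ) := by
          rw [hq, Polynomial.eval_map]
          exact Polynomial.eval₂_at_apply (algebraMap ℝ ℂ) t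
        rw [h3, hlead] at h2
        have h4 := congrArg norm h2
        rwa [norm_mul, Complex.norm_real, Complex.norm_real, Real.norm_eq_abs,
          Real.norm_eq_abs] at h4
      have h5 : l ≤ |p.eval t| := by
        rw [heval]
        calc l = |c| * m ^ (d + 1) := by
              rw [hmpow, mul_div_cancel₀ _ (abs_pos.2 hc0).ne']
          _ ≤ |c| * m ^ d := by
              gcongr ?_ * ?_
              exact pow_le_pow_of_le_one hm0.le h1.le (Nat.le_succ d)
          _ ≤ _ := by
              gcongr ?_ * ?_
              rw [← hcard]
              exact hprod _ hdist
      exact absurd ht (not_lt.2 h5)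
    calc volume {t : ℝ | t ∈ Set.Icc (0 : ℝ) 1 ∧ |p.eval t| < l}
        ≤ ∑ z ∈ q.roots.toFinset, volume (Set.Ioo (z.re - m) (z.re + m)) :=
          (measure_mono hsub).trans (measure_biUnion_finset_le _ _)
      _ = q.roots.toFinset.card * ENNReal.ofReal (2 * m) := by
          simp only [Real.volume_Ioo]
          rw [Finset.sum_congr rfl (g := fun _ => ENNReal.ofReal (2 * m))
            (fun z _ => by ring_nf), Finset.sum_const, nsmul_eq_mul]
      _ ≤ d * ENNReal.ofReal (2 * m) := by
          gcongr
          exact (Multiset.toFinset_card_le _).trans hcard.le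
      _ = ENNReal.ofReal (d * (2 * m)) := by
          rw [ENNReal.ofReal_mul (Nat.cast_nonneg d), ENNReal.ofReal_natCast]
      _ ≤ _ := ENNReal.ofReal_le_ofReal (by nlinarith)

/-- The degree and the top coefficient of a monomial restricted to the line `z + t e`. -/
theorem Polynomial.natDegree_coeff_prod_linear {σ : Type*} (z e : σ → ℝ) (m : σ → ℕ)
    (s : Finset σ) :
    (∏ i ∈ s, (Polynomial.C (z i) + Polynomial.C (e i) * Polynomial.X) ^ m i).natDegree ≤
        ∑ i ∈ s, m i ∧
      (∏ i ∈ s, (Polynomial.C (z i) + Polynomial.C (e i) * Polynomial.X) ^ m i).coeff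
        (∑ i ∈ s, m i) = ∏ i ∈ s, e i ^ m i := by
  classical
  have hlin : ∀ i, (Polynomial.C (z i) + Polynomial.C (e i) * Polynomial.X).natDegree ≤ 1 := by
    intro i; rw [add_comm]; exact Polynomial.natDegree_linear_le
  have hpow : ∀ i,
      ((Polynomial.C (z i) + Polynomial.C (e i) * Polynomial.X) ^ m i).natDegree ≤ m i := by
    intro i
    simpa using Polynomial.natDegree_pow_le_of_le (m i) (hlin i)
  induction s using Finset.induction with
  | empty => simp
  | insert i s hi ih =>
    rw [Finset.prod_insert hi, Finset.sum_insert hi, Finset.prod_insert hi]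
    refine ⟨Polynomial.natDegree_mul_le_of_le (hpow i) ih.1, ?_⟩
    rw [Polynomial.coeff_mul_add_eq_of_natDegree_le (hpow i) ih.1, ih.2]
    congr 1
    have := Polynomial.coeff_pow_of_natDegree_le (m := m i) (hlin i)
    simpa using this

/-- A nonzero polynomial in several variables has, for a suitable direction `e`, the same nonzero
leading coefficient on all lines parallel to `e`: any `e` at which the top homogeneous component
does not vanish will do. -/
theorem MvPolynomial.exists_direction {σ : Type*} [Finite σ] (P : MvPolynomial σ ℝ) (hP : P ≠ 0) :
    ∃ (e : σ → ℝ) (d : ℕ) (c : ℝ), c ≠ 0 ∧ ∀ z : σ → ℝ, ∃ p : Polynomial ℝ,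
      p.natDegree ≤ d ∧ p.coeff d = c ∧
      ∀ t, p.eval t = MvPolynomial.eval (fun i => z i + t * e i) P := by
  classical
  set d := P.totalDegree with hd
  have hcomp : MvPolynomial.homogeneousComponent d P ≠ 0 := by
    obtain ⟨m, hm, hmd⟩ := Finset.exists_mem_eq_sup P.support
      (MvPolynomial.support_nonempty.2 hP) (fun m => m.sum fun _ e => e)
    intro h0
    have h1 := congrArg (MvPolynomial.coeff m) h0
    rw [MvPolynomial.coeff_homogeneousComponent, MvPolynomial.coeff_zero] at h1
    have h2 : m.degree = d := by
      rw [hd, MvPolynomial.totalDegree, hmd]; rfl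
    rw [if_pos h2] at h1
    exact (MvPolynomial.mem_support_iff.1 hm) h1
  obtain ⟨e, he⟩ : ∃ e, MvPolynomial.eval e (MvPolynomial.homogeneousComponent d P) ≠ 0 := by
    by_contra! h
    exact hcomp (MvPolynomial.funext fun x => by simpa using h x)
  refine ⟨e, d, _, he, fun z => ?_⟩
  set f : σ → Polynomial ℝ := fun i => Polynomial.C (z i) + Polynomial.C (e i) * Polynomial.X
    with hf
  have hflin : ∀ i, (f i).natDegree ≤ 1 := by
    intro i; simp only [hf]; rw [add_comm]; exact Polynomial.natDegree_linear_le
  refine ⟨MvPolynomial.aeval f P, ?_, ?_, fun t => ?_⟩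
  · simpa using MvPolynomial.aeval_natDegree_le P le_rfl f hflin
  · have h1 : MvPolynomial.aeval f P =
        ∑ m ∈ P.support, Polynomial.C (P.coeff m) * ∏ i ∈ m.support, f i ^ m i := by
      rw [MvPolynomial.aeval_def, MvPolynomial.eval₂_eq]; rfl
    have h2 : MvPolynomial.eval e (MvPolynomial.homogeneousComponent d P) =
        ∑ m ∈ P.support, if m.degree = d then P.coeff m * ∏ i ∈ m.support, e i ^ m i else 0 := by
      rw [MvPolynomial.homogeneousComponent_apply, map_sum, Finset.sum_filter]
      refine Finset.sum_congr rfl fun m _ => ?_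
      split_ifs
      · rw [MvPolynomial.eval_monomial]; rfl
      · rfl
    rw [h1, h2, Polynomial.finsetSum_coeff]
    refine Finset.sum_congr rfl fun m hm => ?_
    rw [Polynomial.coeff_C_mul]
    obtain ⟨hle, hco⟩ := Polynomial.natDegree_coeff_prod_linear z e m m.support
    have hmd : m.degree ≤ d := MvPolynomial.le_totalDegree hm
    split_ifs with h
    · rw [← h]
      exact congrArg _ hco
    · rw [Polynomial.coeff_eq_zero_of_natDegree_lt (lt_of_le_of_lt hle (lt_of_le_of_ne hmd h)),
        mul_zero]
  · rw [MvPolynomial.aeval_def, MvPolynomial.eval₂_eq, MvPolynomial.eval_eq,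
      Polynomial.eval_finsetSum]
    refine Finset.sum_congr rfl fun m _ => ?_
    rw [Polynomial.eval_mul, Polynomial.eval_prod]
    congr 1
    · simp
    · refine Finset.prod_congr rfl fun i _ => ?_
      simp [hf]; ring

/-- A sublevel set that is small along all segments in one direction is small. -/
theorem MeasureTheory.measure_sublevel_le_of_segment {V : Type*} [NormedAddCommGroup V]
    [NormedSpace ℝ V] [FiniteDimensional ℝ V] [MeasurableSpace V] [BorelSpace V]
    (μ : Measure V) [μ.IsAddHaarMeasure] {f : V → ℝ} (hf : Continuous f) (e : V) {r R l : ℝ}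
    (he : ‖e‖ ≤ r) {M : ENNReal}
    (hM : ∀ x, volume {t : ℝ | t ∈ Set.Icc (0 : ℝ) 1 ∧ |f (x + t • e)| < l} ≤ M) :
    μ {x | ‖x‖ ≤ R ∧ |f x| < l} ≤ M * μ (Metric.closedBall 0 (R + r)) := by
  set S : Set (ℝ × V) := {p | p.1 ∈ Set.Icc (0 : ℝ) 1 ∧ p.2 ∈ Metric.closedBall (0 : V) (R + r) ∧
    |f (p.2 + p.1 • e)| < l} with hS
  have hSm : MeasurableSet S := by
    refine (measurableSet_Icc.preimage measurable_fst).inter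
      ((Metric.isClosed_closedBall.measurableSet.preimage measurable_snd).inter ?_)
    have hc : Continuous fun p : ℝ × V => |f (p.2 + p.1 • e)| := by fun_prop
    exact (isOpen_lt hc continuous_const).measurableSet
  have h1 : (volume.prod μ) S ≤ M * μ (Metric.closedBall 0 (R + r)) := by
    rw [Measure.prod_apply_symm hSm, ← setLIntegral_const,
      ← lintegral_indicator Metric.isClosed_closedBall.measurableSet]
    refine lintegral_mono fun x => ?_
    by_cases hx : x ∈ Metric.closedBall (0 : V) (R + r)
    · rw [Set.indicator_of_mem hx]
      refine le_trans (measure_mono ?_) (hM x)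
      exact fun t ht => ⟨ht.1, ht.2.2⟩
    · rw [Set.indicator_of_notMem hx]
      have : (fun t : ℝ => (t, x)) ⁻¹' S = ∅ := by
        ext t
        simp only [hS, Set.mem_preimage, Set.mem_ofPred_eq, Set.mem_empty_iff_false, iff_false]
        exact fun h => hx h.2.1
      simp [this]
  refine le_trans ?_ h1
  rw [Measure.prod_apply hSm]
  calc μ {x | ‖x‖ ≤ R ∧ |f x| < l}
      = ∫⁻ t in Set.Icc (0 : ℝ) 1, μ {x | ‖x‖ ≤ R ∧ |f x| < l} := by simp
    _ = ∫⁻ t : ℝ, (Set.Icc (0 : ℝ) 1).indicator (fun _ => μ {x | ‖x‖ ≤ R ∧ |f x| < l}) t :=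
        (lintegral_indicator measurableSet_Icc _).symm
    _ ≤ _ := by
        refine lintegral_mono fun t => ?_
        by_cases ht : t ∈ Set.Icc (0 : ℝ) 1
        · rw [Set.indicator_of_mem ht]
          have h2 : μ {x | ‖x‖ ≤ R ∧ |f x| < l} =
              μ ((fun x => x + t • e) ⁻¹' {x | ‖x‖ ≤ R ∧ |f x| < l}) :=
            (measure_preimage_add_right μ (t • e) _).symm
          rw [h2]
          refine measure_mono fun x hx => ⟨ht, ?_, hx.2⟩
          have h3 : ‖x + t • e‖ ≤ R := hx.1
          have h4 : ‖t • e‖ ≤ r := by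
            rw [norm_smul, Real.norm_eq_abs, abs_of_nonneg ht.1]
            exact (mul_le_of_le_one_left (norm_nonneg e) ht.2).trans he
          rw [mem_closedBall_zero_iff]
          calc ‖x‖ = ‖(x + t • e) - t • e‖ := by simp
            _ ≤ R + r := (norm_sub_le _ _).trans (add_le_add h3 h4)
        · rw [Set.indicator_of_notMem ht]; exact zero_le

/-! ### Products of dilated points and their Jacobian in the dilation parameters -/

theorem MvPolynomial.hasDerivAt_eval {σ : Type*} [Fintype σ] (Q : MvPolynomial σ ℝ)
    {γ : ℝ → σ → ℝ} {γ' : σ → ℝ} {t : ℝ} (h : ∀ i, HasDerivAt (fun u => γ u i) (γ' i) t) :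
    HasDerivAt (fun u => MvPolynomial.eval (γ u) Q)
      (∑ i, MvPolynomial.eval (γ t) (MvPolynomial.pderiv i Q) * γ' i) t := by
  classical
  induction Q using MvPolynomial.induction_on with
  | C a => simpa using hasDerivAt_const t a
  | add p q hp hq =>
    simp only [map_add, add_mul, Finset.sum_add_distrib]
    exact hp.add hq
  | mul_X p i hp =>
    have h1 := hp.mul (h i)
    simp only [map_mul, MvPolynomial.eval_X]
    refine h1.congr_deriv (Eq.symm ?_)
    have h2 : ∀ j, MvPolynomial.eval (γ t) (MvPolynomial.pderiv j (p * MvPolynomial.X i)) * γ' j =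
        MvPolynomial.eval (γ t) (MvPolynomial.pderiv j p) * γ' j * γ t i +
          (if j = i then MvPolynomial.eval (γ t) p * γ' j else 0) := by
      intro j
      rw [Derivation.leibniz, MvPolynomial.pderiv_X]
      by_cases hji : j = i
      · subst hji; simp; ring
      · rw [if_neg hji, Pi.single_eq_of_ne (Ne.symm hji)]
        simp; ring
    rw [Finset.sum_congr rfl fun j _ => h2 j, Finset.sum_add_distrib,
      Finset.sum_ite_eq' Finset.univ i, if_pos (Finset.mem_univ i), Finset.sum_mul]

namespace HomogeneousGroup

variable {n : ℕ} (G : HomogeneousGroup n)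

/-- The ordered product `x₀ x₁ ⋯ xₘ₋₁`. -/
def gprod : (m : ℕ) → (Fin m → 𝔼 n) → 𝔼 n
  | 0, _ => 0
  | m + 1, x => G.mul (x 0) (gprod m fun i => x i.succ)

theorem contDiff_gprod (m : ℕ) : ContDiff ℝ ∞ (G.gprod m) := by
  induction m with
  | zero => exact contDiff_const
  | succ m ih =>
    refine ContDiff.group_mul G (contDiff_apply ℝ (𝔼 n) 0) (ih.comp ?_)
    exact contDiff_pi.2 fun i => contDiff_apply ℝ (𝔼 n) i.succ

theorem gprod_zero (m : ℕ) : G.gprod m 0 = 0 := by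
  induction m with
  | zero => rfl
  | succ m ih =>
    have : (fun i : Fin m => (0 : Fin (m + 1) → 𝔼 n) i.succ) = 0 := rfl
    rw [gprod, this, ih]
    exact G.zero_mul 0

theorem gprod_single (m : ℕ) (k : Fin m) (w : 𝔼 n) : G.gprod m (Pi.single k w) = w := by
  induction m with
  | zero => exact k.elim0
  | succ m ih =>
    rw [gprod]
    refine Fin.cases ?_ (fun k => ?_) k
    · have : (fun i : Fin m => (Pi.single 0 w : Fin (m + 1) → 𝔼 n) i.succ) = 0 := by
        ext1 i; exact Pi.single_eq_of_ne (Fin.succ_ne_zero i) w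
      rw [this, gprod_zero, Pi.single_eq_same, G.mul_zero]
    · have : (fun i : Fin m => (Pi.single k.succ w : Fin (m + 1) → 𝔼 n) i.succ) =
          Pi.single k w := by
        ext1 i
        by_cases h : i = k
        · subst h; simp
        · rw [Pi.single_eq_of_ne h, Pi.single_eq_of_ne]
          exact fun h' => h (Fin.succ_injective _ h')
      rw [this, ih, Pi.single_eq_of_ne (Fin.succ_ne_zero k).symm, G.zero_mul]

theorem gprod_polynomial (m : ℕ) (i : Fin n) : ∃ Q : MvPolynomial (Fin m × Fin n) ℝ,
    ∀ x : Fin m → 𝔼 n, G.gprod m x i = MvPolynomial.eval (fun p => x p.1 p.2) Q := by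
  induction m generalizing i with
  | zero => exact ⟨0, fun x => by simp [gprod]⟩
  | succ m ih =>
    choose Q hQ using ih
    obtain ⟨P, hP⟩ := G.mul_polynomial i
    refine ⟨MvPolynomial.bind₁ (Sum.elim (fun j => MvPolynomial.X (0, j))
      (fun j => MvPolynomial.rename (fun p : Fin m × Fin n => (p.1.succ, p.2)) (Q j))) P,
      fun x => ?_⟩
    rw [gprod, hP, ← MvPolynomial.coe_aeval_eq_eval, ← MvPolynomial.coe_aeval_eq_eval]
    change _ = MvPolynomial.aeval _ (MvPolynomial.bind₁ _ P)
    rw [MvPolynomial.aeval_bind₁]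
    change MvPolynomial.aeval _ P = _
    congr 2
    ext (j | j)
    · simp
    · simp only [Sum.elim_inr, hQ, MvPolynomial.aeval_rename]
      rw [← MvPolynomial.coe_aeval_eq_eval]
      rfl

/-- The product `(e ^ s₁ ∘ x₁) ⋯ (e ^ sₙ ∘ xₙ)` as a function of the `n` dilation parameters. -/
noncomputable def prodMap (x : Fin n → 𝔼 n) (s : Fin n → ℝ) : 𝔼 n :=
  G.gprod n fun i => G.dil (s i) (x i)

theorem contDiff_prodMap :
    ContDiff ℝ ∞ (fun p : (Fin n → 𝔼 n) × (Fin n → ℝ) => G.prodMap p.1 p.2) := by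
  refine (G.contDiff_gprod n).comp (contDiff_pi.2 fun i => ?_)
  refine G.contDiff_dil.comp (ContDiff.prodMk ?_ ?_)
  · exact (contDiff_apply ℝ ℝ i).comp contDiff_snd
  · exact (contDiff_apply ℝ (𝔼 n) i).comp contDiff_fst

theorem contDiff_prodMap_right (x : Fin n → 𝔼 n) : ContDiff ℝ ∞ (G.prodMap x) :=
  G.contDiff_prodMap.comp (contDiff_const.prodMk contDiff_id)

/-- The Jacobian matrix of `prodMap x` in the dilation parameters. -/
noncomputable def jacMatrix (x : Fin n → 𝔼 n) (s : Fin n → ℝ) : Matrix (Fin n) (Fin n) ℝ :=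
  Matrix.of fun i k => fderiv ℝ (G.prodMap x) s (Pi.single k 1) i

/-- The Jacobian determinant of `prodMap x` in the dilation parameters. -/
noncomputable def jac (x : Fin n → 𝔼 n) (s : Fin n → ℝ) : ℝ := (G.jacMatrix x s).det

theorem contDiff_jacMatrix (i k : Fin n) :
    ContDiff ℝ ∞ (fun p : (Fin n → 𝔼 n) × (Fin n → ℝ) => G.jacMatrix p.1 p.2 i k) := by
  have h1 : ContDiff ℝ ∞ (fun p : (Fin n → 𝔼 n) × (Fin n → ℝ) => fderiv ℝ (G.prodMap p.1) p.2) := by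
    refine ContDiff.fderiv (m := ∞) (n := ∞)
      (f := fun (p : (Fin n → 𝔼 n) × (Fin n → ℝ)) => G.prodMap p.1) ?_ contDiff_snd (by simp)
    exact G.contDiff_prodMap.comp ((contDiff_fst.comp contDiff_fst).prodMk contDiff_snd)
  exact (EuclideanSpace.proj i : 𝔼 n →L[ℝ] ℝ).contDiff.comp (h1.clm_apply contDiff_const)

theorem _root_.ContDiff.matrix_det {F ι : Type*} [NormedAddCommGroup F] [NormedSpace ℝ F]
    [Fintype ι] [DecidableEq ι] {A : F → Matrix ι ι ℝ}
    (h : ∀ i k, ContDiff ℝ ∞ fun p => A p i k) : ContDiff ℝ ∞ fun p => (A p).det := by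
  simp only [Matrix.det_apply]
  refine ContDiff.sum fun σ _ => ?_
  simp only [Units.smul_def, zsmul_eq_mul]
  exact contDiff_const.mul (contDiff_prod fun i _ => h _ _)

theorem contDiff_jac :
    ContDiff ℝ ∞ (fun p : (Fin n → 𝔼 n) × (Fin n → ℝ) => G.jac p.1 p.2) :=
  ContDiff.matrix_det G.contDiff_jacMatrix

/-- The dilations form a one-parameter group, so the parameters can be absorbed into the points. -/
theorem jac_eq_jac_zero (x : Fin n → 𝔼 n) (s : Fin n → ℝ) :
    G.jac x s = G.jac (fun i => G.dil (s i) (x i)) 0 := by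
  have h : G.prodMap (fun i => G.dil (s i) (x i)) = fun u => G.prodMap x (u + s) := by
    ext1 u
    simp [prodMap, dil_dil]
  rw [jac, jac, jacMatrix, jacMatrix, h]
  simp only [fderiv_comp_add_right, _root_.zero_add]

/-- The generator of the dilations. -/
noncomputable def euler (x : 𝔼 n) : 𝔼 n := WithLp.toLp 2 fun i => G.exponent i * x i

theorem _root_.hasDerivAt_euclideanSpace {f : ℝ → 𝔼 n} {f' : 𝔼 n} {t : ℝ} :
    HasDerivAt f f' t ↔ ∀ i, HasDerivAt (fun u => f u i) (f' i) t := by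
  rw [hasDerivAt_iff_hasFDerivAt, ← hasFDerivWithinAt_univ, hasFDerivWithinAt_euclidean]
  refine forall_congr' fun i => ?_
  rw [hasFDerivWithinAt_univ, hasDerivAt_iff_hasFDerivAt]
  exact Iff.of_eq (congrArg (fun L => HasFDerivAt (fun u => f u i) L t) (by ext; simp))

theorem hasDerivAt_dil (x : 𝔼 n) : HasDerivAt (fun t => G.dil t x) (G.euler x) 0 := by
  have h : ∀ i, HasDerivAt (fun t => G.dil t x i) (G.exponent i * x i) 0 := by
    intro i
    simp only [dil_apply]
    have h1 := (((hasDerivAt_id (0 : ℝ)).mul_const (G.exponent i)).exp).mul_const (x i)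
    simpa using h1
  exact hasDerivAt_euclideanSpace.2 h

theorem fderiv_prodMap_zero (x : Fin n → 𝔼 n) (k : Fin n) :
    fderiv ℝ (G.prodMap x) 0 (Pi.single k 1) =
      fderiv ℝ (G.gprod n) x (Pi.single k (G.euler (x k))) := by
  have h1 : HasDerivAt (fun t : ℝ => G.prodMap x (0 + t • Pi.single k 1))
      (fderiv ℝ (G.prodMap x) 0 (Pi.single k 1)) 0 :=
    ((G.contDiff_prodMap_right x).differentiable (by simp) 0).hasFDerivAt.hasLineDerivAt _
  have h2 : HasDerivAt (fun t : ℝ => fun i => G.dil ((0 + t • (Pi.single k 1 : Fin n → ℝ)) i) (x i))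
      (Pi.single k (G.euler (x k))) 0 := by
    rw [hasDerivAt_pi]
    intro i
    by_cases h : i = k
    · subst h
      simpa using G.hasDerivAt_dil (x i)
    · simpa [Pi.single_eq_of_ne h] using hasDerivAt_const (0 : ℝ) (G.dil 0 (x i))
  have h0 : (fun i => G.dil ((0 + (0 : ℝ) • (Pi.single k 1 : Fin n → ℝ)) i) (x i)) = x := by
    ext1 i; simp [dil_zero_left]
  have h3 : HasFDerivAt (G.gprod n) (fderiv ℝ (G.gprod n) x)
      (fun i => G.dil ((0 + (0 : ℝ) • (Pi.single k 1 : Fin n → ℝ)) i) (x i)) := by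
    rw [h0]
    exact ((G.contDiff_gprod n).differentiable (by simp) x).hasFDerivAt
  exact h1.unique (h3.comp_hasDerivAt 0 h2)

/-- Although the exponents need not be integers, the Jacobian at parameter `0` is a polynomial in
the points: the derivative of a dilation is linear, and the product is a polynomial. -/
theorem jac_zero_polynomial : ∃ P : MvPolynomial (Fin n × Fin n) ℝ,
    ∀ x : Fin n → 𝔼 n, G.jac x 0 = MvPolynomial.eval (fun p => x p.1 p.2) P := by
  choose Q hQ using G.gprod_polynomial n
  refine ⟨Matrix.det (Matrix.of fun i k => ∑ p : Fin n × Fin n, MvPolynomial.pderiv p (Q i) *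
    (MvPolynomial.C (if p.1 = k then G.exponent p.2 else 0) * MvPolynomial.X p)), fun x => ?_⟩
  rw [RingHom.map_det, jac]
  congr 1
  ext i k
  have h1 : HasDerivAt
      (fun t : ℝ => G.gprod n (x + t • (Pi.single k (G.euler (x k)) : Fin n → 𝔼 n)))
      (fderiv ℝ (G.gprod n) x (Pi.single k (G.euler (x k)))) 0 :=
    ((G.contDiff_gprod n).differentiable (by simp) x).hasFDerivAt.hasLineDerivAt _
  have h2 : HasDerivAt
      (fun t : ℝ => G.gprod n (x + t • (Pi.single k (G.euler (x k)) : Fin n → 𝔼 n)) i)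
      (fderiv ℝ (G.gprod n) x (Pi.single k (G.euler (x k))) i) 0 := hasDerivAt_euclideanSpace.1 h1 i
  simp_rw [hQ] at h2
  have h3 := MvPolynomial.hasDerivAt_eval (Q i) (t := 0)
    (γ := fun t p => (x + t • (Pi.single k (G.euler (x k)) : Fin n → 𝔼 n)) p.1 p.2)
    (γ' := fun p => (Pi.single k (G.euler (x k)) : Fin n → 𝔼 n) p.1 p.2) (fun p => by
      have := ((hasDerivAt_id (0 : ℝ)).mul_const
        ((Pi.single k (G.euler (x k)) : Fin n → 𝔼 n) p.1 p.2)).const_add (x p.1 p.2)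
      simpa using this)
  simp only [jacMatrix, Matrix.of_apply, fderiv_prodMap_zero, RingHom.mapMatrix_apply,
    Matrix.map_apply]
  rw [h2.unique h3, map_sum]
  refine Finset.sum_congr rfl fun p _ => ?_
  simp only [zero_smul, _root_.add_zero, map_mul, MvPolynomial.eval_C, MvPolynomial.eval_X]
  congr 1
  obtain ⟨a, b⟩ := p
  by_cases h : a = k
  · subst h; simp [euler]
  · simp [h]

/-- The Jacobian does not vanish identically: at the identity, the product map is tangent to the
sum, so along `x k = t e k`, `t → 0`, the Jacobian is asymptotic to `t ^ n ∏ α k`. -/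
theorem exists_jac_zero_ne : ∃ x : Fin n → 𝔼 n, G.jac x 0 ≠ 0 := by
  by_contra! h
  let e : Fin n → 𝔼 n := fun k => EuclideanSpace.single k 1
  let A : ℝ → Matrix (Fin n) (Fin n) ℝ := fun t => Matrix.of fun i k =>
    fderiv ℝ (G.gprod n) (t • e) (Pi.single k (G.euler (e k))) i
  have hA : Continuous fun t => (A t).det := by
    refine Continuous.matrix_det (continuous_matrix fun i k => ?_)
    have h1 : Continuous fun t : ℝ => fderiv ℝ (G.gprod n) (t • e) :=
      ((G.contDiff_gprod n).continuous_fderiv (by simp)).comp (by fun_prop)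
    exact (EuclideanSpace.proj i : 𝔼 n →L[ℝ] ℝ).continuous.comp (h1.clm_apply continuous_const)
  have h0 : ∀ t : ℝ, t ≠ 0 → (A t).det = 0 := by
    intro t ht
    have h1 : G.jacMatrix (t • e) 0 = t • A t := by
      ext i k
      simp only [jacMatrix, A, Matrix.of_apply, fderiv_prodMap_zero, Matrix.smul_apply,
        smul_eq_mul]
      have h2 : (Pi.single k (G.euler ((t • e) k)) : Fin n → 𝔼 n) =
          t • Pi.single k (G.euler (e k)) := by
        rw [← Pi.single_smul]
        congr 1
        ext j
        simp [euler]; ring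
      rw [h2, map_smul]
      rfl
    have h3 := h (t • e)
    rw [jac, h1, Matrix.det_smul] at h3
    exact (mul_eq_zero.1 h3).resolve_left (pow_ne_zero _ ht)
  have hlim : (A 0).det = 0 := by
    have h1 : Tendsto (fun t => (A t).det) (𝓝[≠] 0) (𝓝 (A 0).det) :=
      (hA.tendsto 0).mono_left nhdsWithin_le_nhds
    refine tendsto_nhds_unique h1 (tendsto_const_nhds.congr' ?_)
    filter_upwards [self_mem_nhdsWithin] with t ht using (h0 t ht).symm
  have hd : A 0 = Matrix.diagonal G.exponent := by
    ext i k
    have h1 : HasDerivAt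
        (fun t : ℝ => G.gprod n (0 + t • (Pi.single k (G.euler (e k)) : Fin n → 𝔼 n)))
        (fderiv ℝ (G.gprod n) 0 (Pi.single k (G.euler (e k)))) 0 :=
      ((G.contDiff_gprod n).differentiable (by simp) 0).hasFDerivAt.hasLineDerivAt _
    have h2 : (fun t : ℝ => G.gprod n (0 + t • (Pi.single k (G.euler (e k)) : Fin n → 𝔼 n))) =
        fun t => t • G.euler (e k) := by
      ext1 t
      rw [_root_.zero_add, ← Pi.single_smul, gprod_single]
    rw [h2] at h1
    have h3 : HasDerivAt (fun t : ℝ => t • G.euler (e k)) (G.euler (e k)) 0 := by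
      simpa using (hasDerivAt_id (0 : ℝ)).smul_const (G.euler (e k))
    simp only [A, Matrix.of_apply, zero_smul]
    rw [h1.unique h3, Matrix.diagonal_apply]
    simp [euler, e]
  rw [hd, Matrix.det_diagonal] at hlim
  exact (Finset.prod_pos fun i _ => G.exponent_pos i).ne' hlim

/-- For dilation parameters in the unit cube, the sublevel sets of the Jacobian are uniformly
small, since the Jacobian is a nonzero polynomial in the dilated points. -/
theorem exists_volume_jac_sublevel_le (R : ℝ) : ∃ C ε : ℝ, 0 < C ∧ 0 < ε ∧
    ∀ s : Fin n → ℝ, (∀ i, |s i| ≤ 1) → ∀ l : ℝ, 0 < l →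
      volume {x : Fin n → 𝔼 n | ‖x‖ ≤ R ∧ |G.jac x s| < l} ≤ ENNReal.ofReal (C * l ^ ε) := by
  obtain ⟨P, hP⟩ := G.jac_zero_polynomial
  have hP0 : P ≠ 0 := by
    rintro rfl
    obtain ⟨x, hx⟩ := G.exists_jac_zero_ne
    exact hx (by rw [hP]; simp)
  obtain ⟨e, d, c, hc, hline⟩ := P.exists_direction hP0
  let e' : Fin n → 𝔼 n := fun k => WithLp.toLp 2 fun j => e (k, j)
  obtain ⟨r, hr, hdil⟩ := G.exists_norm_dil_le_of_le 1 ‖e'‖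
  set V := (volume (Metric.closedBall (0 : Fin n → 𝔼 n) (R + r))).toReal with hV
  have hVfin : volume (Metric.closedBall (0 : Fin n → 𝔼 n) (R + r)) ≠ ⊤ :=
    measure_closedBall_lt_top.ne
  have hc' := abs_pos.2 hc
  refine ⟨(2 * d + 1) / |c| ^ ((1 : ℝ) / (d + 1)) * (V + 1), (1 : ℝ) / (d + 1),
    by positivity, by positivity, fun s hs l hl => ?_⟩
  have hcont : Continuous fun x : Fin n → 𝔼 n => G.jac x s :=
    G.contDiff_jac.continuous.comp (continuous_id.prodMk continuous_const)
  -- the lines in the direction `dil (-s) e'` become parallel to `e'` once dilated by `s`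
  have h1 := measure_sublevel_le_of_segment (volume : Measure (Fin n → 𝔼 n)) hcont
    (fun i => G.dil (-s i) (e' i)) (r := r) (R := R) (l := l) ?_
    (M := ENNReal.ofReal ((2 * d + 1) * (l / |c|) ^ ((1 : ℝ) / (d + 1)))) ?_
  · refine h1.trans ?_
    rw [← ENNReal.ofReal_toReal hVfin, ← hV, ← ENNReal.ofReal_mul (by positivity)]
    refine ENNReal.ofReal_le_ofReal ?_
    rw [Real.div_rpow hl.le hc'.le]
    calc (2 * d + 1) * (l ^ ((1 : ℝ) / (d + 1)) / |c| ^ ((1 : ℝ) / (d + 1))) * V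
        = (2 * d + 1) / |c| ^ ((1 : ℝ) / (d + 1)) * V * l ^ ((1 : ℝ) / (d + 1)) := by ring
      _ ≤ _ := by gcongr; linarith
  · refine (pi_norm_le_iff_of_nonneg hr.le).2 fun i => ?_
    exact hdil _ (by linarith [neg_abs_le (s i), hs i]) _ (norm_le_pi_norm e' i)
  · intro x
    obtain ⟨p, hpd, hpc, hp⟩ := hline fun q => G.dil (s q.1) (x q.1) q.2
    refine le_trans (measure_mono ?_) (p.volume_sublevel_le hpd hpc hc hl)
    intro t ht
    refine ⟨ht.1, ?_⟩
    have h2 := ht.2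
    rw [jac_eq_jac_zero, hP] at h2
    rw [hp]
    convert h2 using 4 with q
    simp only [Pi.add_apply, Pi.smul_apply, dil_add, dil_smul, dil_dil, add_neg_cancel,
      dil_zero_left]
    simp [e']

/-- The regularization error `δ² / (J² + δ²)` is small on average: it is at most `1` where
`|J| < √δ`, a set that is small, and at most `δ` elsewhere. -/
theorem exists_integral_jac_error_le (R : ℝ) : ∃ C ε : ℝ, 0 < C ∧ 0 < ε ∧ ε ≤ 1 ∧
    ∀ s : Fin n → ℝ, (∀ i, |s i| ≤ 1) → ∀ δ : ℝ, 0 < δ → δ ≤ 1 →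
      ∫ x in Metric.closedBall (0 : Fin n → 𝔼 n) R, δ ^ 2 / (G.jac x s ^ 2 + δ ^ 2) ≤
        C * δ ^ ε := by
  obtain ⟨C, ε, hC, hε, h⟩ := G.exists_volume_jac_sublevel_le R
  set V := (volume (Metric.closedBall (0 : Fin n → 𝔼 n) R)).toReal with hV
  have hVfin : volume (Metric.closedBall (0 : Fin n → 𝔼 n) R) < ⊤ := measure_closedBall_lt_top
  refine ⟨C + V, min (ε / 2) 1, by positivity, by positivity, min_le_right _ _,
    fun s hs δ hδ hδ1 => ?_⟩
  have hcont : Continuous fun x : Fin n → 𝔼 n => G.jac x s :=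
    G.contDiff_jac.continuous.comp (continuous_id.prodMk continuous_const)
  set S : Set (Fin n → 𝔼 n) := {x | ‖x‖ ≤ R ∧ |G.jac x s| < δ ^ ((1 : ℝ) / 2)} with hS
  have hSm : MeasurableSet S :=
    (measurableSet_le measurable_norm measurable_const).inter
      (isOpen_lt hcont.abs continuous_const).measurableSet
  have hpow : (0 : ℝ) < δ ^ ((1 : ℝ) / 2) := Real.rpow_pos_of_pos hδ _
  have hsq : (δ ^ ((1 : ℝ) / 2)) ^ 2 = δ := by
    rw [← Real.rpow_natCast, ← Real.rpow_mul hδ.le]; norm_num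
  have hSvol := h s hs _ hpow
  have hSfin : volume S < ⊤ := hSvol.trans_lt ENNReal.ofReal_lt_top
  have hpt : ∀ x ∈ Metric.closedBall (0 : Fin n → 𝔼 n) R,
      δ ^ 2 / (G.jac x s ^ 2 + δ ^ 2) ≤ S.indicator (fun _ => (1 : ℝ)) x + δ := by
    intro x hx
    by_cases hxS : x ∈ S
    · rw [Set.indicator_of_mem hxS]
      have : δ ^ 2 / (G.jac x s ^ 2 + δ ^ 2) ≤ 1 := by
        rw [div_le_one (by positivity)]; nlinarith [sq_nonneg (G.jac x s)]
      linarith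
    · rw [Set.indicator_of_notMem hxS, _root_.zero_add, div_le_iff₀ (by positivity)]
      have h1 : δ ^ ((1 : ℝ) / 2) ≤ |G.jac x s| := by
        by_contra! h2
        exact hxS ⟨by simpa using hx, h2⟩
      have h2 : δ ≤ G.jac x s ^ 2 := by
        rw [← sq_abs, ← hsq]; gcongr
      nlinarith [mul_le_mul_of_nonneg_left h2 hδ.le, pow_pos hδ 3]
  have hint1 : IntegrableOn (fun x => δ ^ 2 / (G.jac x s ^ 2 + δ ^ 2))
      (Metric.closedBall (0 : Fin n → 𝔼 n) R) := by
    refine (Continuous.continuousOn ?_).integrableOn_compact (isCompact_closedBall _ _)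
    exact continuous_const.div ((hcont.pow 2).add continuous_const) fun x => by positivity
  have hint2 : IntegrableOn (S.indicator fun _ => (1 : ℝ))
      (Metric.closedBall (0 : Fin n → 𝔼 n) R) :=
    ((integrable_indicator_iff hSm).2 (integrableOn_const hSfin.ne)).integrableOn
  have hint3 : IntegrableOn (fun _ : Fin n → 𝔼 n => δ)
      (Metric.closedBall (0 : Fin n → 𝔼 n) R) := integrableOn_const hVfin.ne
  have hmono : δ ^ (ε / 2) ≤ δ ^ (min (ε / 2) 1) ∧ δ ≤ δ ^ (min (ε / 2) 1) := by
    constructor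
    · exact Real.rpow_le_rpow_of_exponent_ge hδ hδ1 (min_le_left _ _)
    · simpa using Real.rpow_le_rpow_of_exponent_ge hδ hδ1 (min_le_right (ε / 2) 1)
  calc ∫ x in Metric.closedBall (0 : Fin n → 𝔼 n) R, δ ^ 2 / (G.jac x s ^ 2 + δ ^ 2)
      ≤ ∫ x in Metric.closedBall (0 : Fin n → 𝔼 n) R, (S.indicator (fun _ => (1 : ℝ)) x + δ) :=
        setIntegral_mono_on hint1 (hint2.add hint3) Metric.isClosed_closedBall.measurableSet hpt
    _ = (volume.restrict (Metric.closedBall (0 : Fin n → 𝔼 n) R)).real S + V * δ := by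
        rw [integral_add hint2 hint3, setIntegral_const]
        congr 1
        exact integral_indicator_one hSm
    _ ≤ C * δ ^ (ε / 2) + V * δ := by
        gcongr
        refine ENNReal.toReal_le_of_le_ofReal (by positivity)
          ((Measure.restrict_apply_le _ _).trans (hSvol.trans_eq ?_))
        rw [← Real.rpow_mul hδ.le]
        ring_nf
    _ ≤ (C + V) * δ ^ (min (ε / 2) 1) := by
        rw [add_mul]
        exact add_le_add (mul_le_mul_of_nonneg_left hmono.1 hC.le)
          (mul_le_mul_of_nonneg_left hmono.2 ENNReal.toReal_nonneg)

end HomogeneousGroup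

/-! ### Integration by parts in the dilation parameters -/

/-- A smooth cutoff on the line with values in `[0, 1]`, supported in `[-1, 1]`. -/
structure IsCutoff (η : ℝ → ℝ) : Prop where
  contDiff : ContDiff ℝ ∞ η
  nonneg : ∀ t, 0 ≤ η t
  le_one : ∀ t, η t ≤ 1
  eq_zero : ∀ t, 1 < |t| → η t = 0

/-- The product cutoff on the cube. -/
def cubeWeight {m : ℕ} (η : ℝ → ℝ) (s : Fin m → ℝ) : ℝ := ∏ i, η (s i)

namespace IsCutoff

variable {η : ℝ → ℝ} {m : ℕ}

theorem contDiff_cubeWeight (hη : IsCutoff η) : ContDiff ℝ ∞ (cubeWeight η : (Fin m → ℝ) → ℝ) :=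
  contDiff_prod fun i _ => hη.contDiff.comp (contDiff_apply ℝ ℝ i)

theorem cubeWeight_nonneg (hη : IsCutoff η) (s : Fin m → ℝ) : 0 ≤ cubeWeight η s :=
  Finset.prod_nonneg fun _ _ => hη.nonneg _

theorem cubeWeight_le_one (hη : IsCutoff η) (s : Fin m → ℝ) : cubeWeight η s ≤ 1 :=
  Finset.prod_le_one (fun _ _ => hη.nonneg _) fun _ _ => hη.le_one _

theorem cubeWeight_eq_zero (hη : IsCutoff η) {s : Fin m → ℝ} (hs : 1 < ‖s‖) :
    cubeWeight η s = 0 := by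
  by_contra h
  refine absurd hs (not_lt.2 ((pi_norm_le_iff_of_nonneg zero_le_one).2 fun i => ?_))
  by_contra! hi
  exact h (Finset.prod_eq_zero (Finset.mem_univ i) (hη.eq_zero _ hi))

end IsCutoff

theorem hasCompactSupport_of_zero_of_one_lt_norm {m : ℕ} {f : (Fin m → ℝ) → ℝ}
    (hf : ∀ s, 1 < ‖s‖ → f s = 0) : HasCompactSupport f :=
  HasCompactSupport.intro (isCompact_closedBall (0 : Fin m → ℝ) 1) fun s hs =>
    hf s (by simpa using hs)

theorem fderiv_eq_zero_of_one_lt_norm {m : ℕ} {f : (Fin m → ℝ) → ℝ}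
    (hf : ∀ s, 1 < ‖s‖ → f s = 0) {s : Fin m → ℝ} (hs : 1 < ‖s‖) : fderiv ℝ f s = 0 := by
  have : f =ᶠ[𝓝 s] fun _ => 0 := by
    filter_upwards [(isOpen_lt continuous_const continuous_norm).mem_nhds hs] with u hu
      using hf u hu
  rw [this.fderiv_eq]
  simp

/-- A vector field supported in the unit cube pairs with the gradient of a bounded function
with a bound that only involves the divergence. -/
theorem abs_integral_sum_mul_fderiv_le {m : ℕ} {F : Fin m → (Fin m → ℝ) → ℝ}
    {g : (Fin m → ℝ) → ℝ} (hF : ∀ k, ContDiff ℝ ∞ (F k)) (hg : ContDiff ℝ ∞ g)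
    (hF0 : ∀ k s, 1 < ‖s‖ → F k s = 0) {M B : ℝ} (hB : ∀ s, |g s| ≤ B)
    (hM : ∀ k s, ‖s‖ ≤ 1 → |fderiv ℝ (F k) s (Pi.single k 1)| ≤ M) :
    |∫ s, ∑ k, F k s * fderiv ℝ g s (Pi.single k 1)| ≤
      m * (M * B * volume.real (Metric.closedBall (0 : Fin m → ℝ) 1)) := by
  have hFd : ∀ k, Continuous fun s => fderiv ℝ (F k) s (Pi.single k 1) := fun k =>
    ((hF k).continuous_fderiv (by simp)).clm_apply continuous_const
  have hgd : ∀ k, Continuous fun s => fderiv ℝ g s (Pi.single k 1 : Fin m → ℝ) := fun k =>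
    (hg.continuous_fderiv (by simp)).clm_apply continuous_const
  have hi : ∀ k, Integrable fun s => F k s * fderiv ℝ g s (Pi.single k 1) := fun k =>
    ((hF k).continuous.mul (hgd k)).integrable_of_hasCompactSupport
      (hasCompactSupport_of_zero_of_one_lt_norm fun s hs => by simp [hF0 k s hs])
  have hi' : ∀ k, Integrable fun s => fderiv ℝ (F k) s (Pi.single k 1) * g s := fun k =>
    ((hFd k).mul hg.continuous).integrable_of_hasCompactSupport
      (hasCompactSupport_of_zero_of_one_lt_norm fun s hs => by
        simp [fderiv_eq_zero_of_one_lt_norm (hF0 k) hs])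
  rw [integral_finsetSum _ fun k _ => hi k]
  refine (Finset.abs_sum_le_sum_abs _ _).trans ?_
  have hk : ∀ k, |∫ s, F k s * fderiv ℝ g s (Pi.single k 1)| ≤
      M * B * volume.real (Metric.closedBall (0 : Fin m → ℝ) 1) := by
    intro k
    rw [integral_mul_fderiv_eq_neg_fderiv_mul_of_integrable (hi' k) (hi k)
      (((hF k).continuous.mul hg.continuous).integrable_of_hasCompactSupport
        (hasCompactSupport_of_zero_of_one_lt_norm fun s hs => by simp [hF0 k s hs]))
      (fun s _ => (hF k).differentiable (by simp) s) (fun s _ => hg.differentiable (by simp) s),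
      abs_neg]
    have h0 : ∀ s, s ∉ Metric.closedBall (0 : Fin m → ℝ) 1 →
        fderiv ℝ (F k) s (Pi.single k 1) * g s = 0 := fun s hs => by
      simp [fderiv_eq_zero_of_one_lt_norm (hF0 k) (show 1 < ‖s‖ by simpa using hs)]
    rw [← setIntegral_eq_integral_of_forall_compl_eq_zero h0, ← Real.norm_eq_abs]
    have hfin : volume (Metric.closedBall (0 : Fin m → ℝ) 1) < ⊤ := measure_closedBall_lt_top
    refine norm_setIntegral_le_of_norm_le_const hfin fun s hs => ?_
    rw [Real.norm_eq_abs, abs_mul]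
    have hM' := hM k s (by simpa using hs)
    exact mul_le_mul hM' (hB s) (abs_nonneg _) ((abs_nonneg _).trans hM')
  calc ∑ k, |∫ s, F k s * fderiv ℝ g s (Pi.single k 1)|
      ≤ ∑ _k : Fin m, M * B * volume.real (Metric.closedBall (0 : Fin m → ℝ) 1) :=
        Finset.sum_le_sum fun k _ => hk k
    _ = _ := by simp

/-- The regularized reciprocal `J / (J² + δ²)` and its derivative. -/
theorem hasDerivAt_regInv {δ : ℝ} (hδ : 0 < δ) (J : ℝ) :
    HasDerivAt (fun J : ℝ => J / (J ^ 2 + δ ^ 2))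
      ((δ ^ 2 - J ^ 2) / (J ^ 2 + δ ^ 2) ^ 2) J := by
  have h := (hasDerivAt_id J).div (((hasDerivAt_id J).pow 2).add_const (δ ^ 2))
    (show (J ^ 2 + δ ^ 2 : ℝ) ≠ 0 by positivity)
  refine h.congr_deriv ?_
  congr 1
  simp only [Pi.pow_apply, id]
  push_cast
  ring

theorem abs_regInv_le {δ : ℝ} (hδ : 0 < δ) (hδ1 : δ ≤ 1) (J : ℝ) :
    |J / (J ^ 2 + δ ^ 2)| ≤ 1 / δ ^ 2 := by
  have h1 : |J| * δ ≤ J ^ 2 + δ ^ 2 := by nlinarith [sq_abs J, sq_nonneg (|J| - δ)]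
  rw [abs_div, abs_of_pos (show 0 < J ^ 2 + δ ^ 2 by positivity),
    div_le_div_iff₀ (by positivity) (by positivity)]
  nlinarith [abs_nonneg J]

theorem abs_deriv_regInv_le {δ : ℝ} (hδ : 0 < δ) (J : ℝ) :
    |(δ ^ 2 - J ^ 2) / (J ^ 2 + δ ^ 2) ^ 2| ≤ 1 / δ ^ 2 := by
  rw [abs_div, abs_of_pos (show 0 < (J ^ 2 + δ ^ 2) ^ 2 by positivity),
    div_le_div_iff₀ (by positivity) (by positivity)]
  have h1 : |δ ^ 2 - J ^ 2| ≤ J ^ 2 + δ ^ 2 := by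
    rw [abs_le]; constructor <;> nlinarith [sq_nonneg J, sq_nonneg δ]
  nlinarith [sq_nonneg J, sq_nonneg δ, mul_nonneg (sq_nonneg J) (sq_nonneg δ)]

namespace HomogeneousGroup

variable {n : ℕ} (G : HomogeneousGroup n)

/-- The velocity at `g`, for `τ = 0`, of the curve `u⁻¹ (u + τ v) g`, which compares the left
translations by `u + τ v` and by `u`. -/
noncomputable def leftVelocity (u v g : 𝔼 n) : 𝔼 n :=
  fderiv ℝ (fun u' => G.mul (G.inv u) (G.mul u' g)) u v

theorem contDiff_leftVelocity :
    ContDiff ℝ ∞ (fun p : 𝔼 n × 𝔼 n × 𝔼 n => G.leftVelocity p.1 p.2.1 p.2.2) := by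
  have h1 : ContDiff ℝ ∞ (fun p : 𝔼 n × 𝔼 n × 𝔼 n =>
      fderiv ℝ (fun u' => G.mul (G.inv p.1) (G.mul u' p.2.2)) p.1) := by
    refine ContDiff.fderiv (m := ∞) (n := ∞)
      (f := fun (p : 𝔼 n × 𝔼 n × 𝔼 n) u' => G.mul (G.inv p.1) (G.mul u' p.2.2)) ?_
      contDiff_fst (by simp)
    refine ContDiff.group_mul G (G.contDiff_inv.comp (contDiff_fst.comp contDiff_fst)) ?_
    exact ContDiff.group_mul G contDiff_snd
      (contDiff_snd.comp (contDiff_snd.comp contDiff_fst))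
  exact h1.clm_apply (contDiff_fst.comp contDiff_snd)

/-- The parameter-space vector field which `prodMap x` pushes forward to the Jacobian determinant
times `leftVelocity u v` (Cramer's rule). -/
noncomputable def liftedField (u v : 𝔼 n) (x : Fin n → 𝔼 n) (s : Fin n → ℝ) (k : Fin n) : ℝ :=
  ∑ i, (G.jacMatrix x s).adjugate k i * G.leftVelocity u v (G.prodMap x s) i

theorem contDiff_liftedField (k : Fin n) :
    ContDiff ℝ ∞ (fun p : (𝔼 n × 𝔼 n × (Fin n → 𝔼 n)) × (Fin n → ℝ) =>
      G.liftedField p.1.1 p.1.2.1 p.1.2.2 p.2 k) := by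
  have hx : ContDiff ℝ ∞ (fun p : (𝔼 n × 𝔼 n × (Fin n → 𝔼 n)) × (Fin n → ℝ) =>
      (p.1.2.2, p.2)) :=
    (contDiff_snd.comp (contDiff_snd.comp contDiff_fst)).prodMk contDiff_snd
  refine ContDiff.sum fun i _ => ContDiff.mul ?_ ?_
  · simp only [Matrix.adjugate_apply]
    refine ContDiff.matrix_det fun a b => ?_
    by_cases ha : a = i
    · subst ha
      simp only [Matrix.updateRow_self]
      exact contDiff_const
    · simp only [Matrix.updateRow_ne ha]
      exact (G.contDiff_jacMatrix a b).comp hx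
  · refine (EuclideanSpace.proj i : 𝔼 n →L[ℝ] ℝ).contDiff.comp ?_
    refine G.contDiff_leftVelocity.comp (ContDiff.prodMk ?_ (ContDiff.prodMk ?_ ?_))
    · exact contDiff_fst.comp contDiff_fst
    · exact contDiff_fst.comp (contDiff_snd.comp contDiff_fst)
    · exact G.contDiff_prodMap.comp hx

theorem sum_liftedField_smul (u v : 𝔼 n) (x : Fin n → 𝔼 n) (s : Fin n → ℝ) :
    ∑ k, G.liftedField u v x s k • fderiv ℝ (G.prodMap x) s (Pi.single k 1) =
      G.jac x s • G.leftVelocity u v (G.prodMap x s) := by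
  ext i
  have h1 : (∑ k, G.liftedField u v x s k • fderiv ℝ (G.prodMap x) s (Pi.single k 1)) i =
      (G.jacMatrix x s).mulVec (fun k => G.liftedField u v x s k) i := by
    simp only [Matrix.mulVec, dotProduct, jacMatrix, Matrix.of_apply]
    simp [mul_comm]
  have h2 : (fun k => G.liftedField u v x s k) = (G.jacMatrix x s).adjugate.mulVec
      (fun i => G.leftVelocity u v (G.prodMap x s) i) := rfl
  rw [h1, h2, Matrix.mulVec_mulVec, Matrix.mul_adjugate, Matrix.smul_mulVec, Matrix.one_mulVec]
  rfl

/-- Multiplied by the Jacobian, the derivative of `h` along the left velocity becomes a derivative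
in the dilation parameters, which can be integrated by parts. -/
theorem jac_mul_fderiv (u v : 𝔼 n) (x : Fin n → 𝔼 n) (s : Fin n → ℝ) {h : 𝔼 n → ℝ}
    (hh : ContDiff ℝ ∞ h) :
    G.jac x s * fderiv ℝ h (G.prodMap x s) (G.leftVelocity u v (G.prodMap x s)) =
      ∑ k, G.liftedField u v x s k *
        fderiv ℝ (fun s => h (G.prodMap x s)) s (Pi.single k 1) := by
  have h1 : HasFDerivAt (fun s => h (G.prodMap x s))
      ((fderiv ℝ h (G.prodMap x s)).comp (fderiv ℝ (G.prodMap x) s)) s :=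
    HasFDerivAt.comp s (hh.differentiable (by simp) _).hasFDerivAt
      ((G.contDiff_prodMap_right x).differentiable (by simp) s).hasFDerivAt
  rw [h1.fderiv, ← smul_eq_mul, ← map_smul, ← G.sum_liftedField_smul, map_sum]
  simp

/-- Moving the left translation `τ v` amounts to differentiating the translated function in `g`
along the left velocity, so that the derivative falls on the argument rather than on the
translation. -/
theorem hasDerivAt_comp_mul (v g : 𝔼 n) (τ : ℝ) {h : 𝔼 n → ℝ} (hh : ContDiff ℝ ∞ h) :
    HasDerivAt (fun τ : ℝ => h (G.mul (τ • v) g))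
      (fderiv ℝ (fun g => h (G.mul (τ • v) g)) g (G.leftVelocity (τ • v) v g)) τ := by
  have h1 : HasDerivAt (fun τ : ℝ => τ • v) v τ := by
    simpa using (hasDerivAt_id τ).smul_const v
  have hc : ContDiff ℝ ∞ fun u' => G.mul (G.inv (τ • v)) (G.mul u' g) :=
    ContDiff.group_mul G contDiff_const (ContDiff.group_mul G contDiff_id contDiff_const)
  have h2 : HasDerivAt (fun τ' : ℝ => G.mul (G.inv (τ • v)) (G.mul (τ' • v) g))
      (G.leftVelocity (τ • v) v g) τ :=
    HasFDerivAt.comp_hasDerivAt (l := fun u' => G.mul (G.inv (τ • v)) (G.mul u' g)) τ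
      (hc.differentiable (by simp) (τ • v)).hasFDerivAt h1
  have hc' : ContDiff ℝ ∞ fun g => h (G.mul (τ • v) g) :=
    hh.comp (ContDiff.group_mul G contDiff_const contDiff_id)
  have h3 : HasFDerivAt (fun g => h (G.mul (τ • v) g)) (fderiv ℝ (fun g => h (G.mul (τ • v) g)) g)
      (G.mul (G.inv (τ • v)) (G.mul (τ • v) g)) := by
    rw [G.inv_mul_cancel_left]
    exact (hc'.differentiable (by simp) g).hasFDerivAt
  have h4 := h3.comp_hasDerivAt τ h2
  have h5 : ((fun g => h (G.mul (τ • v) g)) ∘ fun τ' : ℝ =>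
      G.mul (G.inv (τ • v)) (G.mul (τ' • v) g)) = fun τ' => h (G.mul (τ' • v) g) := by
    ext1 τ'
    simp only [Function.comp_apply, G.mul_inv_cancel_left]
  rwa [h5] at h4

/-- The weight `η ⊗ ⋯ ⊗ η · J² / (J² + δ²)`, which vanishes where the product map degenerates. One
factor `J` cancels the Jacobian in Cramer's rule, and `J / (J² + δ²)` remains smooth. -/
noncomputable def regWeight (η : ℝ → ℝ) (δ : ℝ) (x : Fin n → 𝔼 n) (s : Fin n → ℝ) : ℝ :=
  cubeWeight η s * (G.jac x s ^ 2 / (G.jac x s ^ 2 + δ ^ 2))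

variable {η : ℝ → ℝ}

theorem continuous_regWeight (hη : IsCutoff η) {δ : ℝ} (hδ : 0 < δ) (x : Fin n → 𝔼 n) :
    Continuous (G.regWeight η δ x) := by
  have hj : Continuous fun s => G.jac x s :=
    G.contDiff_jac.continuous.comp (continuous_const.prodMk continuous_id)
  exact hη.contDiff_cubeWeight.continuous.mul ((hj.pow 2).div ((hj.pow 2).add continuous_const)
    fun s => by positivity)

theorem regWeight_eq_zero (hη : IsCutoff η) (δ : ℝ) (x : Fin n → 𝔼 n) {s : Fin n → ℝ}
    (hs : 1 < ‖s‖) : G.regWeight η δ x s = 0 := by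
  rw [regWeight, hη.cubeWeight_eq_zero hs, MulZeroClass.zero_mul]

theorem regWeight_nonneg (hη : IsCutoff η) (δ : ℝ) (x : Fin n → 𝔼 n) (s : Fin n → ℝ) :
    0 ≤ G.regWeight η δ x s :=
  mul_nonneg (hη.cubeWeight_nonneg s) (by positivity)

theorem integrable_regWeight_mul (hη : IsCutoff η) {δ : ℝ} (hδ : 0 < δ) (x : Fin n → 𝔼 n)
    {f : (Fin n → ℝ) → ℝ} (hf : Continuous f) :
    Integrable fun s => G.regWeight η δ x s * f s :=
  ((G.continuous_regWeight hη hδ x).mul hf).integrable_of_hasCompactSupport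
    (hasCompactSupport_of_zero_of_one_lt_norm fun s hs => by
      rw [Pi.mul_apply, G.regWeight_eq_zero hη δ x hs, MulZeroClass.zero_mul])

/-- Integration by parts: the derivative of `h ∘ prodMap x` along a left velocity, weighted by
`regWeight`, integrates to `O(δ⁻²)`, for `h` merely bounded. -/
theorem exists_integral_regWeight_fderiv_le (hη : IsCutoff η) (R : ℝ) : ∃ C : ℝ, 0 < C ∧
    ∀ (u v : 𝔼 n) (x : Fin n → 𝔼 n) (δ B : ℝ) (h : 𝔼 n → ℝ), ‖u‖ ≤ 1 → ‖v‖ ≤ 1 → ‖x‖ ≤ R →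
      0 < δ → δ ≤ 1 → ContDiff ℝ ∞ h → (∀ g, |h g| ≤ B) →
      |∫ s, G.regWeight η δ x s *
        fderiv ℝ h (G.prodMap x s) (G.leftVelocity u v (G.prodMap x s))| ≤ C * B / δ ^ 2 := by
  let E : Fin n → (𝔼 n × 𝔼 n × (Fin n → 𝔼 n)) → (Fin n → ℝ) → ℝ := fun k p s =>
    cubeWeight η s * G.liftedField p.1 p.2.1 p.2.2 s k
  have hE : ∀ k, ContDiff ℝ ∞ (Function.uncurry (E k)) := fun k =>
    (hη.contDiff_cubeWeight.comp contDiff_snd).mul (G.contDiff_liftedField k)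
  let J : (𝔼 n × 𝔼 n × (Fin n → 𝔼 n)) → (Fin n → ℝ) → ℝ := fun p s => G.jac p.2.2 s
  have hJ : ContDiff ℝ ∞ (Function.uncurry J) :=
    G.contDiff_jac.comp
      ((contDiff_snd.comp (contDiff_snd.comp contDiff_fst)).prodMk contDiff_snd)
  have hpart : ∀ (F : (𝔼 n × 𝔼 n × (Fin n → 𝔼 n)) → (Fin n → ℝ) → ℝ) (k : Fin n),
      ContDiff ℝ ∞ (Function.uncurry F) →
      Continuous fun q : (𝔼 n × 𝔼 n × (Fin n → 𝔼 n)) × (Fin n → ℝ) =>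
        fderiv ℝ (F q.1) q.2 (Pi.single k 1) := by
    intro F k hF
    have h1 : ContDiff ℝ ∞ (fun q : (𝔼 n × 𝔼 n × (Fin n → 𝔼 n)) × (Fin n → ℝ) =>
        fderiv ℝ (F q.1) q.2) := by
      refine ContDiff.fderiv (m := ∞) (n := ∞)
        (f := fun (q : (𝔼 n × 𝔼 n × (Fin n → 𝔼 n)) × (Fin n → ℝ)) => F q.1) ?_
        contDiff_snd (by simp)
      exact hF.comp ((contDiff_fst.comp contDiff_fst).prodMk contDiff_snd)
    exact h1.continuous.clm_apply continuous_const
  let K : Set ((𝔼 n × 𝔼 n × (Fin n → 𝔼 n)) × (Fin n → ℝ)) :=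
    (Metric.closedBall 0 1 ×ˢ Metric.closedBall 0 1 ×ˢ Metric.closedBall 0 R) ×ˢ
      Metric.closedBall 0 1
  have hK : IsCompact K := ((isCompact_closedBall _ _).prod ((isCompact_closedBall _ _).prod
    (isCompact_closedBall _ _))).prod (isCompact_closedBall _ _)
  have hbd : ∀ k, ∃ M, ∀ q ∈ K, |fderiv ℝ (E k q.1) q.2 (Pi.single k 1)| +
      |E k q.1 q.2 * fderiv ℝ (J q.1) q.2 (Pi.single k 1)| ≤ M := by
    intro k
    have hc := (hpart (E k) k (hE k)).abs.add (((hE k).continuous.mul (hpart J k hJ)).abs)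
    obtain ⟨M, hM⟩ := hK.exists_bound_of_continuousOn hc.continuousOn
    exact ⟨M, fun q hq => (le_abs_self _).trans (hM q hq)⟩
  choose M hM using hbd
  set M' : ℝ := ∑ k, |M k| with hM'
  set V := volume.real (Metric.closedBall (0 : Fin n → ℝ) 1) with hV
  have hV0 : 0 ≤ V := measureReal_nonneg
  have hM0 : 0 ≤ M' := Finset.sum_nonneg fun k _ => abs_nonneg _
  refine ⟨n * (M' * V) + 1, by positivity, ?_⟩
  intro u v x δ B h hu hv hx hδ hδ1 hh hB
  have hB0 : 0 ≤ B := (abs_nonneg _).trans (hB 0)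
  let p : 𝔼 n × 𝔼 n × (Fin n → 𝔼 n) := (u, v, x)
  let F : Fin n → (Fin n → ℝ) → ℝ := fun k s =>
    E k p s * (J p s / (J p s ^ 2 + δ ^ 2))
  have hJp : ContDiff ℝ ∞ (J p) := hJ.comp (contDiff_const.prodMk contDiff_id)
  have hEp : ∀ k, ContDiff ℝ ∞ (E k p) := fun k => (hE k).comp (contDiff_const.prodMk contDiff_id)
  have hF : ∀ k, ContDiff ℝ ∞ (F k) := fun k =>
    (hEp k).mul (hJp.div ((hJp.pow 2).add contDiff_const) fun s => by positivity)
  have hg : ContDiff ℝ ∞ fun s => h (G.prodMap x s) := hh.comp (G.contDiff_prodMap_right x)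
  have hF0 : ∀ k s, 1 < ‖s‖ → F k s = 0 := fun k s hs => by
    simp only [F, E, hη.cubeWeight_eq_zero hs, MulZeroClass.zero_mul]
  have key : ∀ s, G.regWeight η δ x s *
      fderiv ℝ h (G.prodMap x s) (G.leftVelocity u v (G.prodMap x s)) =
      ∑ k, F k s * fderiv ℝ (fun s => h (G.prodMap x s)) s (Pi.single k 1) := by
    intro s
    have h1 := G.jac_mul_fderiv u v x s hh
    calc G.regWeight η δ x s *
          fderiv ℝ h (G.prodMap x s) (G.leftVelocity u v (G.prodMap x s))
        = cubeWeight η s * (G.jac x s / (G.jac x s ^ 2 + δ ^ 2)) * (G.jac x s *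
          fderiv ℝ h (G.prodMap x s) (G.leftVelocity u v (G.prodMap x s))) := by
          rw [regWeight]; ring
      _ = _ := by
          rw [h1, Finset.mul_sum]
          refine Finset.sum_congr rfl fun k _ => ?_
          simp only [F, E, J, p]
          ring
  simp_rw [key]
  have hder : ∀ k s, ‖s‖ ≤ 1 → |fderiv ℝ (F k) s (Pi.single k 1)| ≤ M' / δ ^ 2 := by
    intro k s hs
    have hJs : HasFDerivAt (J p) (fderiv ℝ (J p) s) s :=
      (hJp.differentiable (by simp) s).hasFDerivAt
    have hEs : HasFDerivAt (E k p) (fderiv ℝ (E k p) s) s :=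
      ((hEp k).differentiable (by simp) s).hasFDerivAt
    have h1 := hEs.mul ((hasDerivAt_regInv hδ (J p s)).comp_hasFDerivAt s hJs)
    have h2 : fderiv ℝ (F k) s (Pi.single k 1) =
        (E k p s * fderiv ℝ (J p) s (Pi.single k 1)) *
          ((δ ^ 2 - J p s ^ 2) / (J p s ^ 2 + δ ^ 2) ^ 2) +
        fderiv ℝ (E k p) s (Pi.single k 1) * (J p s / (J p s ^ 2 + δ ^ 2)) := by
      have h3 : HasFDerivAt (F k) _ s := h1
      rw [h3.fderiv]
      simp only [add_apply, smul_apply, smul_eq_mul, Function.comp_apply]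
      ring
    have hq : (p, s) ∈ K := by
      simp only [K, p, Set.mem_prod, mem_closedBall_zero_iff]
      exact ⟨⟨hu, hv, hx⟩, hs⟩
    have h4 := hM k (p, s) hq
    have h5 : M k ≤ M' := (le_abs_self _).trans
      (Finset.single_le_sum (f := fun k => |M k|) (fun k _ => abs_nonneg _) (Finset.mem_univ k))
    rw [h2]
    refine (abs_add_le _ _).trans ?_
    rw [abs_mul _ ((δ ^ 2 - J p s ^ 2) / (J p s ^ 2 + δ ^ 2) ^ 2),
      abs_mul _ (J p s / (J p s ^ 2 + δ ^ 2))]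
    have h6 := mul_le_mul_of_nonneg_left (abs_deriv_regInv_le hδ (J p s))
      (abs_nonneg (E k p s * fderiv ℝ (J p) s (Pi.single k 1)))
    have h7 := mul_le_mul_of_nonneg_left (abs_regInv_le hδ hδ1 (J p s))
      (abs_nonneg (fderiv ℝ (E k p) s (Pi.single k 1)))
    refine (add_le_add h6 h7).trans ?_
    rw [← add_mul, mul_one_div]
    gcongr
    simp only at h4
    linarith
  refine (abs_integral_sum_mul_fderiv_le hF hg hF0 (fun s => hB _) hder).trans ?_
  rw [← hV]
  have : (n : ℝ) * (M' / δ ^ 2 * B * V) = (n * (M' * V)) * B / δ ^ 2 := by ring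
  rw [this]
  gcongr
  linarith

theorem integrable_cubeWeight_mul (hη : IsCutoff η) {m : ℕ} {f : (Fin m → ℝ) → ℝ}
    (hf : Continuous f) : Integrable fun s => cubeWeight η s * f s :=
  (hη.contDiff_cubeWeight.continuous.mul hf).integrable_of_hasCompactSupport
    (hasCompactSupport_of_zero_of_one_lt_norm fun s hs => by
      rw [Pi.mul_apply, hη.cubeWeight_eq_zero hs, MulZeroClass.zero_mul])

/-- Regularized oscillation estimate for smooth functions: interpolate between `h (y g)` and `h g`
along the segment from `0` to `y`. -/
theorem exists_regWeight_osc_le_of_contDiff (hη : IsCutoff η) (R : ℝ) : ∃ C : ℝ, 0 < C ∧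
    ∀ (y : 𝔼 n) (x : Fin n → 𝔼 n) (δ B : ℝ) (h : 𝔼 n → ℝ), ‖y‖ ≤ 1 → ‖x‖ ≤ R →
      0 < δ → δ ≤ 1 → ContDiff ℝ ∞ h → (∀ g, |h g| ≤ B) →
      |∫ s, G.regWeight η δ x s * (h (G.mul y (G.prodMap x s)) - h (G.prodMap x s))| ≤
        C * B * ‖y‖ / δ ^ 2 := by
  obtain ⟨C, hC, hIBP⟩ := G.exists_integral_regWeight_fderiv_le hη R
  refine ⟨C, hC, fun y x δ B h hy hx hδ hδ1 hh hB => ?_⟩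
  set v : 𝔼 n := ‖y‖⁻¹ • y with hv
  have hv1 : ‖v‖ ≤ 1 := by
    rw [hv, norm_smul, norm_inv, norm_norm]
    exact inv_mul_le_one
  have hyv : ‖y‖ • v = y := by
    by_cases h0 : y = 0
    · simp [h0]
    · rw [hv, smul_smul, mul_inv_cancel₀ (norm_ne_zero_iff.2 h0), one_smul]
  have hΦ : Continuous (G.prodMap x) := (G.contDiff_prodMap_right x).continuous
  let W := G.regWeight η δ x
  have hW : Continuous W := G.continuous_regWeight hη hδ x
  let D : ℝ → (Fin n → ℝ) → ℝ := fun τ s => fderiv ℝ (fun g => h (G.mul (τ • v) g))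
    (G.prodMap x s) (G.leftVelocity (τ • v) v (G.prodMap x s))
  have hD : Continuous fun p : ℝ × (Fin n → ℝ) => D p.1 p.2 := by
    have h1 : ContDiff ℝ ∞ (fun p : ℝ × (Fin n → ℝ) =>
        fderiv ℝ (fun g => h (G.mul (p.1 • v) g)) (G.prodMap x p.2)) := by
      refine ContDiff.fderiv (m := ∞) (n := ∞)
        (f := fun (p : ℝ × (Fin n → ℝ)) => fun g => h (G.mul (p.1 • v) g)) ?_
        ((G.contDiff_prodMap_right x).comp contDiff_snd) (by simp)
      refine hh.comp (ContDiff.group_mul G ?_ contDiff_snd)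
      exact (contDiff_fst.comp contDiff_fst).smul contDiff_const
    refine h1.continuous.clm_apply ?_
    exact G.contDiff_leftVelocity.continuous.comp
      (f := fun p : ℝ × (Fin n → ℝ) => (p.1 • v, v, G.prodMap x p.2))
      ((continuous_fst.smul continuous_const).prodMk
        (continuous_const.prodMk (hΦ.comp continuous_snd)))
  let H : ℝ → ℝ := fun τ => ∫ s, W s * h (G.mul (τ • v) (G.prodMap x s))
  have hint : ∀ τ : ℝ, Integrable fun s => W s * h (G.mul (τ • v) (G.prodMap x s)) := fun τ =>
    G.integrable_regWeight_mul hη hδ x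
      (hh.continuous.comp (Continuous.group_mul G continuous_const hΦ))
  have hder : ∀ τ, HasDerivAt H (∫ s, W s * D τ s) τ := by
    intro τ
    obtain ⟨M, hM⟩ := ((isCompact_Icc (a := τ - 1) (b := τ + 1)).prod
      (isCompact_closedBall (0 : Fin n → ℝ) 1)).exists_bound_of_continuousOn
      (f := fun p : ℝ × (Fin n → ℝ) => W p.2 * D p.1 p.2)
      ((hW.comp continuous_snd).mul hD).continuousOn
    refine (hasDerivAt_integral_of_dominated_loc_of_deriv_le (μ := volume)
      (F := fun τ s => W s * h (G.mul (τ • v) (G.prodMap x s)))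
      (F' := fun τ s => W s * D τ s) (s := Set.Icc (τ - 1) (τ + 1))
      (bound := (Metric.closedBall (0 : Fin n → ℝ) 1).indicator fun _ => M)
      (Icc_mem_nhds (by linarith) (by linarith)) ?_ (hint τ) ?_ ?_ ?_ ?_).2
    · exact Eventually.of_forall fun τ => (hint τ).aestronglyMeasurable
    · exact (hW.mul (hD.comp (continuous_const.prodMk continuous_id))).aestronglyMeasurable
    · refine Eventually.of_forall fun s t ht => ?_
      by_cases hs : s ∈ Metric.closedBall (0 : Fin n → ℝ) 1
      · rw [Set.indicator_of_mem hs]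
        exact hM (t, s) ⟨ht, hs⟩
      · rw [Set.indicator_of_notMem hs]
        simp only [W]
        rw [G.regWeight_eq_zero hη δ x (by simpa using hs)]
        simp
    · refine (integrable_indicator_iff Metric.isClosed_closedBall.measurableSet).2 ?_
      exact integrableOn_const (measure_closedBall_lt_top (μ := volume)).ne
    · refine Eventually.of_forall fun s t _ => ?_
      exact (G.hasDerivAt_comp_mul v (G.prodMap x s) t hh).const_mul (W s)
  have hbound : ∀ τ ∈ Set.Ico (0 : ℝ) ‖y‖, ‖∫ s, W s * D τ s‖ ≤ C * B / δ ^ 2 := by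
    intro τ hτ
    refine hIBP (τ • v) v x δ B (fun g => h (G.mul (τ • v) g)) ?_ hv1 hx hδ hδ1
      (hh.comp (ContDiff.group_mul G contDiff_const contDiff_id)) fun g => hB _
    rw [norm_smul, Real.norm_eq_abs, abs_of_nonneg hτ.1]
    exact mul_le_one₀ (hτ.2.le.trans hy) (norm_nonneg v) hv1
  have hmv := norm_image_sub_le_of_norm_deriv_le_segment' (f := H) (a := 0) (b := ‖y‖)
    (fun τ _ => (hder τ).hasDerivWithinAt) hbound ‖y‖ (Set.right_mem_Icc.2 (norm_nonneg y))
  have hH : H ‖y‖ - H 0 = ∫ s, G.regWeight η δ x s *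
      (h (G.mul y (G.prodMap x s)) - h (G.prodMap x s)) := by
    simp only [H]
    rw [← integral_sub (hint _) (hint _), hyv]
    simp only [zero_smul, G.zero_mul, W]
    refine integral_congr_ae (Eventually.of_forall fun s => ?_)
    simp only
    ring
  rw [hH, Real.norm_eq_abs, sub_zero] at hmv
  refine hmv.trans_eq ?_
  ring

/-- The regularized oscillation estimate for continuous functions, by smooth approximation: the
bound does not involve the derivatives of `h`. -/
theorem exists_regWeight_osc_le (hη : IsCutoff η) (R : ℝ) : ∃ C : ℝ, 0 < C ∧
    ∀ (y : 𝔼 n) (x : Fin n → 𝔼 n) (δ : ℝ) (h : 𝔼 n → ℝ), ‖y‖ ≤ 1 → ‖x‖ ≤ R →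
      0 < δ → δ ≤ 1 → Continuous h → (∀ g, |h g| ≤ 1) →
      |∫ s, G.regWeight η δ x s * (h (G.mul y (G.prodMap x s)) - h (G.prodMap x s))| ≤
        C * ‖y‖ / δ ^ 2 := by
  obtain ⟨C, hC, hsm⟩ := G.exists_regWeight_osc_le_of_contDiff hη R
  refine ⟨C * 2, by positivity, fun y x δ h hy hx hδ hδ1 hh hB => ?_⟩
  have hΦ : Continuous (G.prodMap x) := (G.contDiff_prodMap_right x).continuous
  have hyΦ : Continuous fun s => G.mul y (G.prodMap x s) :=
    Continuous.group_mul G continuous_const hΦ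
  have hW0 := G.regWeight_nonneg hη δ x
  set A := ∫ s, G.regWeight η δ x s * 1 with hA
  have hA0 : 0 ≤ A := integral_nonneg fun s => by simpa using hW0 s
  have hint : ∀ {f : 𝔼 n → ℝ}, Continuous f → Integrable fun s => G.regWeight η δ x s *
      (f (G.mul y (G.prodMap x s)) - f (G.prodMap x s)) := fun hf =>
    G.integrable_regWeight_mul hη hδ x ((hf.comp hyΦ).sub (hf.comp hΦ))
  refine le_of_forall_pos_le_add fun ε hε => ?_
  set ε' := min 1 (ε / (2 * A + 1)) with hε'
  have hε'0 : 0 < ε' := by positivity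
  obtain ⟨f, hf, hfh, -⟩ := hh.exists_contDiff_approx ⊤ (continuous_const (y := ε'))
    (fun _ => hε'0)
  have hfB : ∀ g, |f g| ≤ 2 := fun g => by
    have h1 := (hfh g).le.trans (min_le_left _ _)
    rw [Real.dist_eq] at h1
    have h2 := abs_sub_abs_le_abs_sub (f g) (h g)
    linarith [hB g]
  have h1 := hsm y x δ 2 f hy hx hδ hδ1 hf hfB
  have h2 : |(∫ s, G.regWeight η δ x s * (h (G.mul y (G.prodMap x s)) - h (G.prodMap x s))) -
      ∫ s, G.regWeight η δ x s * (f (G.mul y (G.prodMap x s)) - f (G.prodMap x s))| ≤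
      A * (2 * ε') := by
    rw [← integral_sub (hint hh) (hint hf.continuous), ← integral_mul_const, ← Real.norm_eq_abs]
    refine norm_integral_le_of_norm_le
      ((G.integrable_regWeight_mul hη hδ x continuous_const).mul_const _)
      (Eventually.of_forall fun s => ?_)
    rw [← mul_sub, norm_mul, Real.norm_eq_abs, abs_of_nonneg (hW0 s), mul_one]
    refine mul_le_mul_of_nonneg_left ?_ (hW0 s)
    have h3 := (hfh (G.mul y (G.prodMap x s))).le
    have h4 := (hfh (G.prodMap x s)).le
    rw [Real.dist_eq, abs_le] at h3 h4
    rw [Real.norm_eq_abs, abs_le]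
    constructor <;> linarith [h3.1, h3.2, h4.1, h4.2]
  have h3 : A * (2 * ε') ≤ ε := by
    have h4 : ε' * (2 * A + 1) ≤ ε := by
      rw [← le_div_iff₀ (by positivity)]; exact min_le_right _ _
    nlinarith
  rw [abs_le] at h1 h2 ⊢
  constructor <;> linarith [h1.1, h1.2, h2.1, h2.2]

/-- The oscillation of `h` along the product map under a left translation by `y` is controlled by
the regularized estimate and the size of the set where the Jacobian is small. -/
theorem exists_cubeWeight_osc_le (hη : IsCutoff η) (R : ℝ) : ∃ C : ℝ, 0 < C ∧
    ∀ (y : 𝔼 n) (x : Fin n → 𝔼 n) (δ : ℝ) (h : 𝔼 n → ℝ), ‖y‖ ≤ 1 → ‖x‖ ≤ R →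
      0 < δ → δ ≤ 1 → Continuous h → (∀ g, |h g| ≤ 1) →
      |∫ s, cubeWeight η s * (h (G.mul y (G.prodMap x s)) - h (G.prodMap x s))| ≤
        C * ‖y‖ / δ ^ 2 +
          2 * ∫ s, cubeWeight η s * (δ ^ 2 / (G.jac x s ^ 2 + δ ^ 2)) := by
  obtain ⟨C, hC, hreg⟩ := G.exists_regWeight_osc_le hη R
  refine ⟨C, hC, fun y x δ h hy hx hδ hδ1 hh hB => ?_⟩
  have hΦ : Continuous (G.prodMap x) := (G.contDiff_prodMap_right x).continuous
  have hyΦ : Continuous fun s => G.mul y (G.prodMap x s) :=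
    Continuous.group_mul G continuous_const hΦ
  have hosc : Continuous fun s => h (G.mul y (G.prodMap x s)) - h (G.prodMap x s) :=
    (hh.comp hyΦ).sub (hh.comp hΦ)
  have hj : Continuous fun s => G.jac x s :=
    G.contDiff_jac.continuous.comp (continuous_const.prodMk continuous_id)
  have herr : Continuous fun s => δ ^ 2 / (G.jac x s ^ 2 + δ ^ 2) :=
    continuous_const.div ((hj.pow 2).add continuous_const) fun s => by positivity
  have hsplit : ∀ s, cubeWeight η s * (h (G.mul y (G.prodMap x s)) - h (G.prodMap x s)) =
      G.regWeight η δ x s * (h (G.mul y (G.prodMap x s)) - h (G.prodMap x s)) +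
      cubeWeight η s * (δ ^ 2 / (G.jac x s ^ 2 + δ ^ 2) *
        (h (G.mul y (G.prodMap x s)) - h (G.prodMap x s))) := by
    intro s
    have : (0 : ℝ) < G.jac x s ^ 2 + δ ^ 2 := by positivity
    rw [regWeight]
    field_simp
  simp_rw [hsplit]
  have herr' : Continuous fun s => δ ^ 2 / (G.jac x s ^ 2 + δ ^ 2) *
      (h (G.mul y (G.prodMap x s)) - h (G.prodMap x s)) := herr.mul hosc
  rw [integral_add (G.integrable_regWeight_mul hη hδ x hosc)
    (integrable_cubeWeight_mul hη herr')]
  refine (abs_add_le _ _).trans (add_le_add (hreg y x δ h hy hx hδ hδ1 hh hB) ?_)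
  rw [← integral_const_mul, ← Real.norm_eq_abs]
  refine norm_integral_le_of_norm_le ((integrable_cubeWeight_mul hη herr).const_mul 2)
    (Eventually.of_forall fun s => ?_)
  have h1 : |h (G.mul y (G.prodMap x s)) - h (G.prodMap x s)| ≤ 2 := by
    have h3 := abs_le.1 (hB (G.mul y (G.prodMap x s)))
    have h4 := abs_le.1 (hB (G.prodMap x s))
    rw [abs_le]
    constructor <;> linarith [h3.1, h3.2, h4.1, h4.2]
  rw [Real.norm_eq_abs, abs_mul, abs_mul, abs_of_nonneg (hη.cubeWeight_nonneg s),
    abs_of_nonneg (show 0 ≤ δ ^ 2 / (G.jac x s ^ 2 + δ ^ 2) by positivity)]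
  have h2 : 0 ≤ cubeWeight η s * (δ ^ 2 / (G.jac x s ^ 2 + δ ^ 2)) :=
    mul_nonneg (hη.cubeWeight_nonneg s) (by positivity)
  nlinarith

/-- Averaged over the points `x` of a ball as well, the oscillation decays like a power of the
size of the translation. -/
theorem exists_integral_osc_le (hη : IsCutoff η) (R : ℝ) : ∃ C ε : ℝ, 0 < C ∧ 0 < ε ∧
    ∀ (y : 𝔼 n) (h : 𝔼 n → ℝ), ‖y‖ ≤ 1 → Continuous h → (∀ g, |h g| ≤ 1) →
      ∫ x in Metric.closedBall (0 : Fin n → 𝔼 n) R,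
        |∫ s, cubeWeight η s * (h (G.mul y (G.prodMap x s)) - h (G.prodMap x s))| ≤
        C * ‖y‖ ^ ε := by
  obtain ⟨C, hC, hosc⟩ := G.exists_cubeWeight_osc_le hη R
  obtain ⟨C', ε, hC', hε, hε1, herr⟩ := G.exists_integral_jac_error_le R
  set V := volume.real (Metric.closedBall (0 : Fin n → 𝔼 n) R) with hV
  set V' := volume.real (Metric.closedBall (0 : Fin n → ℝ) 1) with hV'
  have hV0 : 0 ≤ V := measureReal_nonneg
  have hV'0 : 0 ≤ V' := measureReal_nonneg
  refine ⟨C * V + 2 * (C' * V'), ε / 4, by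
    have : 0 < V' := by
      rw [hV', Measure.real]
      exact ENNReal.toReal_pos (Metric.measure_closedBall_pos _ _ one_pos).ne'
        measure_closedBall_lt_top.ne
    positivity, by positivity, fun y h hy hh hB => ?_⟩
  by_cases hy0 : y = 0
  · subst hy0
    simp only [G.zero_mul, sub_self, MulZeroClass.mul_zero, integral_zero, abs_zero]
    have : (0 : ℝ) ≤ ‖(0 : 𝔼 n)‖ ^ (ε / 4) := by positivity
    positivity
  have hyp : 0 < ‖y‖ := norm_pos_iff.2 hy0
  -- this choice makes `‖y‖ / δ ^ 2 = δ ^ 2`, which is below the error term `δ ^ ε`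
  set δ := ‖y‖ ^ ((1 : ℝ) / 4) with hδ
  have hδ0 : 0 < δ := Real.rpow_pos_of_pos hyp _
  have hδ1 : δ ≤ 1 := Real.rpow_le_one hyp.le hy (by norm_num)
  have hδ4 : ‖y‖ = δ ^ 4 := by
    rw [hδ, ← Real.rpow_natCast, ← Real.rpow_mul hyp.le]; norm_num
  have hδε : δ ^ ε = ‖y‖ ^ (ε / 4) := by
    rw [hδ, ← Real.rpow_mul hyp.le]; ring_nf
  have hball : volume (Metric.closedBall (0 : Fin n → 𝔼 n) R) < ⊤ := measure_closedBall_lt_top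
  have hjc : Continuous fun p : (Fin n → 𝔼 n) × (Fin n → ℝ) => G.jac p.1 p.2 :=
    G.contDiff_jac.continuous
  have hE : Continuous fun p : (Fin n → 𝔼 n) × (Fin n → ℝ) =>
      cubeWeight η p.2 * (δ ^ 2 / (G.jac p.1 p.2 ^ 2 + δ ^ 2)) :=
    (hη.contDiff_cubeWeight.continuous.comp continuous_snd).mul
      (continuous_const.div ((hjc.pow 2).add continuous_const) fun p => by positivity)
  have hle1 : ∀ x s, δ ^ 2 / (G.jac x s ^ 2 + δ ^ 2) ≤ 1 := fun x s => by
    rw [div_le_one (by positivity)]; nlinarith [sq_nonneg (G.jac x s)]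
  -- the error term is integrable on the product, so that the integrals can be exchanged
  have hprod : Integrable (Function.uncurry fun (x : Fin n → 𝔼 n) (s : Fin n → ℝ) =>
      cubeWeight η s * (δ ^ 2 / (G.jac x s ^ 2 + δ ^ 2)))
      ((volume.restrict (Metric.closedBall (0 : Fin n → 𝔼 n) R)).prod volume) := by
    have : IsFiniteMeasure (volume.restrict (Metric.closedBall (0 : Fin n → 𝔼 n) R)) :=
      ⟨by simpa using hball⟩
    have hdom : Integrable (fun p : (Fin n → 𝔼 n) × (Fin n → ℝ) =>
        (1 : ℝ) * (cubeWeight η p.2 * 1))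
        ((volume.restrict (Metric.closedBall (0 : Fin n → 𝔼 n) R)).prod volume) :=
      (integrable_const (1 : ℝ)).mul_prod (integrable_cubeWeight_mul hη continuous_const)
    refine hdom.mono' hE.aestronglyMeasurable (Eventually.of_forall fun p => ?_)
    have h1 := hη.cubeWeight_nonneg p.2
    have h2 : 0 ≤ δ ^ 2 / (G.jac p.1 p.2 ^ 2 + δ ^ 2) := by positivity
    rw [Function.uncurry, Real.norm_eq_abs, abs_of_nonneg (mul_nonneg h1 h2), one_mul]
    exact mul_le_mul_of_nonneg_left (hle1 _ _) h1
  have hmeas : Integrable (fun x => ∫ s, cubeWeight η s * (δ ^ 2 / (G.jac x s ^ 2 + δ ^ 2)))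
      (volume.restrict (Metric.closedBall (0 : Fin n → 𝔼 n) R)) := hprod.integral_prod_left
  have hswap : ∫ x in Metric.closedBall (0 : Fin n → 𝔼 n) R,
      ∫ s, cubeWeight η s * (δ ^ 2 / (G.jac x s ^ 2 + δ ^ 2)) ≤ C' * V' * δ ^ ε := by
    rw [integral_integral_swap hprod]
    have h1 : ∀ s, ∫ x in Metric.closedBall (0 : Fin n → 𝔼 n) R,
        cubeWeight η s * (δ ^ 2 / (G.jac x s ^ 2 + δ ^ 2)) ≤
        (Metric.closedBall (0 : Fin n → ℝ) 1).indicator (fun _ => C' * δ ^ ε) s := by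
      intro s
      rw [integral_const_mul]
      by_cases hs : s ∈ Metric.closedBall (0 : Fin n → ℝ) 1
      · rw [Set.indicator_of_mem hs]
        have hs' : ∀ i, |s i| ≤ 1 := fun i =>
          (norm_le_pi_norm s i).trans (by simpa using hs)
        have h2 := herr s hs' δ hδ0 hδ1
        have h3 : 0 ≤ ∫ x in Metric.closedBall (0 : Fin n → 𝔼 n) R,
            δ ^ 2 / (G.jac x s ^ 2 + δ ^ 2) := integral_nonneg fun x => by positivity
        nlinarith [hη.cubeWeight_le_one s, hη.cubeWeight_nonneg s]
      · rw [Set.indicator_of_notMem hs, hη.cubeWeight_eq_zero (by simpa using hs),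
          MulZeroClass.zero_mul]
    have h2 : Integrable ((Metric.closedBall (0 : Fin n → ℝ) 1).indicator
        fun _ => C' * δ ^ ε) :=
      (integrable_indicator_iff Metric.isClosed_closedBall.measurableSet).2
        (integrableOn_const (measure_closedBall_lt_top (μ := volume)).ne)
    refine (integral_mono hprod.integral_prod_right h2 h1).trans_eq ?_
    rw [integral_indicator Metric.isClosed_closedBall.measurableSet, setIntegral_const,
      smul_eq_mul]
    ring
  calc ∫ x in Metric.closedBall (0 : Fin n → 𝔼 n) R,
        |∫ s, cubeWeight η s * (h (G.mul y (G.prodMap x s)) - h (G.prodMap x s))|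
      ≤ ∫ x in Metric.closedBall (0 : Fin n → 𝔼 n) R, (C * ‖y‖ / δ ^ 2 +
          2 * ∫ s, cubeWeight η s * (δ ^ 2 / (G.jac x s ^ 2 + δ ^ 2))) := by
        refine integral_mono_of_nonneg (Eventually.of_forall fun x => abs_nonneg _)
          ((integrableOn_const hball.ne).add (hmeas.const_mul 2)) ?_
        filter_upwards [ae_restrict_mem Metric.isClosed_closedBall.measurableSet] with x hx
        exact hosc y x δ h hy (by simpa using hx) hδ0 hδ1 hh hB
    _ = V * (C * ‖y‖ / δ ^ 2) + 2 * ∫ x in Metric.closedBall (0 : Fin n → 𝔼 n) R,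
          ∫ s, cubeWeight η s * (δ ^ 2 / (G.jac x s ^ 2 + δ ^ 2)) := by
        have hc : Integrable (fun _ : Fin n → 𝔼 n => C * ‖y‖ / δ ^ 2)
            (volume.restrict (Metric.closedBall (0 : Fin n → 𝔼 n) R)) :=
          integrableOn_const hball.ne
        rw [integral_add hc (hmeas.const_mul 2), setIntegral_const,
          integral_const_mul, smul_eq_mul]
    _ ≤ V * (C * δ ^ ε) + 2 * (C' * V' * δ ^ ε) := by
        have h1 : C * ‖y‖ / δ ^ 2 ≤ C * δ ^ ε := by
          have h2 : ‖y‖ / δ ^ 2 = δ ^ 2 := by rw [hδ4]; field_simp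
          rw [mul_div_assoc, h2]
          refine mul_le_mul_of_nonneg_left ?_ hC.le
          rw [← Real.rpow_natCast]
          exact Real.rpow_le_rpow_of_exponent_ge hδ0 hδ1 (by push_cast; linarith)
        gcongr
    _ = (C * V + 2 * (C' * V')) * ‖y‖ ^ (ε / 4) := by rw [← hδε]; ring

end HomogeneousGroup

/-! ### Averages of unitary representations -/

open scoped InnerProductSpace

theorem ContinuousLinearMap.opNorm_le_of_abs_inner_le {H : Type*} [NormedAddCommGroup H]
    [InnerProductSpace ℝ H] (A : H →L[ℝ] H) {M : ℝ} (hM : 0 ≤ M)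
    (h : ∀ v w : H, ‖v‖ ≤ 1 → ‖w‖ ≤ 1 → |⟪A v, w⟫_ℝ| ≤ M) : ‖A‖ ≤ M := by
  refine A.opNorm_le_bound hM fun v => ?_
  by_cases hv : v = 0
  · simp [hv]
  by_cases hA : A v = 0
  · rw [hA, norm_zero]; positivity
  have hv' := norm_pos_iff.2 hv
  have hA' := norm_pos_iff.2 hA
  have h1 := h (‖v‖⁻¹ • v) (‖A v‖⁻¹ • A v)
    (by rw [norm_smul, norm_inv, norm_norm, inv_mul_cancel₀ hv'.ne'])
    (by rw [norm_smul, norm_inv, norm_norm, inv_mul_cancel₀ hA'.ne'])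
  rw [map_smul, inner_smul_left, inner_smul_right, real_inner_self_eq_norm_sq] at h1
  have h2 : (starRingEnd ℝ) ‖v‖⁻¹ * (‖A v‖⁻¹ * ‖A v‖ ^ 2) = ‖A v‖ / ‖v‖ := by
    simp only [conj_trivial]
    field_simp
  rw [h2, abs_of_pos (div_pos hA' hv'), div_le_iff₀ hv'] at h1
  exact h1

/-- A strongly continuous unitary representation of a homogeneous group on a real Hilbert
space. -/
structure UnitaryRep {n : ℕ} (G : HomogeneousGroup n) (H : Type*) [NormedAddCommGroup H]
    [InnerProductSpace ℝ H] where
  toFun : 𝔼 n → H →L[ℝ] H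
  map_mul : ∀ x y, toFun (G.mul x y) = toFun x * toFun y
  map_zero : toFun 0 = 1
  norm_apply : ∀ x v, ‖toFun x v‖ = ‖v‖
  continuous_apply : ∀ v, Continuous fun x => toFun x v

namespace UnitaryRep

variable {n : ℕ} {G : HomogeneousGroup n} {H : Type*} [NormedAddCommGroup H]
  [InnerProductSpace ℝ H] (π : UnitaryRep G H)

instance : CoeFun (UnitaryRep G H) fun _ => 𝔼 n → H →L[ℝ] H := ⟨toFun⟩

theorem inner_apply_left (x : 𝔼 n) (v w : H) : ⟪π x v, w⟫_ℝ = ⟪v, π (G.inv x) w⟫_ℝ := by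
  have h1 : w = π x (π (G.inv x) w) := by
    rw [← mul_apply_eq_comp, ← π.map_mul, G.mul_inv, π.map_zero]; rfl
  have h2 : ∀ v w : H, ⟪π x v, π x w⟫_ℝ = ⟪v, w⟫_ℝ := fun v w => by
    rw [real_inner_eq_norm_add_mul_self_sub_norm_mul_self_sub_norm_mul_self_div_two, ← map_add,
      π.norm_apply, π.norm_apply, π.norm_apply,
      ← real_inner_eq_norm_add_mul_self_sub_norm_mul_self_sub_norm_mul_self_div_two]
  conv_lhs => rw [h1]
  exact h2 _ _

/-- The representation precomposed with a dilation. -/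
noncomputable def scale (t : ℝ) : UnitaryRep G H where
  toFun x := π (G.dil t x)
  map_mul x y := by rw [G.dil_mul, π.map_mul]
  map_zero := by rw [G.dil_zero, π.map_zero]
  norm_apply x v := π.norm_apply _ _
  continuous_apply v :=
    (π.continuous_apply v).comp (Continuous.group_dil G continuous_const continuous_id)

theorem scale_apply (t : ℝ) (x : 𝔼 n) : π.scale t x = π (G.dil t x) := rfl

variable {Z : Type*} [MeasurableSpace Z] {μ : Measure Z} {w : Z → ℝ} {g : Z → 𝔼 n}

theorem integrable_smul (hw : Integrable w μ) (hg : Measurable g) (v : H) :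
    Integrable (fun z => w z • π (g z) v) μ := by
  have h1 : AEStronglyMeasurable (fun z => π (g z) v) μ :=
    (π.continuous_apply v).comp_aestronglyMeasurable hg.aestronglyMeasurable
  refine (hw.norm.mul_const ‖v‖).mono' (hw.aestronglyMeasurable.smul h1)
    (Eventually.of_forall fun z => ?_)
  rw [norm_smul, π.norm_apply]

open scoped Classical in
/-- The average `∫ w z • π (g z) dμ z`, as a strong integral. By convention it is `0` unless `w`
is integrable and `g` is measurable. -/
noncomputable def avg (μ : Measure Z) (w : Z → ℝ) (g : Z → 𝔼 n) : H →L[ℝ] H :=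
  if h : Integrable w μ ∧ Measurable g then
    LinearMap.mkContinuous
      { toFun := fun v => ∫ z, w z • π (g z) v ∂μ
        map_add' := fun v u => by
          rw [← integral_add (π.integrable_smul h.1 h.2 v) (π.integrable_smul h.1 h.2 u)]
          simp only [map_add, smul_add]
        map_smul' := fun c v => by
          rw [RingHom.id_apply, ← integral_smul]
          simp only [map_smul]
          refine integral_congr_ae (Eventually.of_forall fun z => ?_)
          exact smul_comm _ _ _ } (∫ z, |w z| ∂μ) fun v => by
        rw [← integral_mul_const]
        refine norm_integral_le_of_norm_le (h.1.abs.mul_const ‖v‖)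
          (Eventually.of_forall fun z => ?_)
        rw [norm_smul, π.norm_apply, Real.norm_eq_abs]
  else 0

theorem avg_apply (hw : Integrable w μ) (hg : Measurable g) (v : H) :
    π.avg μ w g v = ∫ z, w z • π (g z) v ∂μ := by
  rw [avg, dif_pos ⟨hw, hg⟩]; rfl

theorem norm_avg_le (hw : Integrable w μ) (hg : Measurable g) :
    ‖π.avg μ w g‖ ≤ ∫ z, |w z| ∂μ := by
  refine ContinuousLinearMap.opNorm_le_bound _ (integral_nonneg fun z => abs_nonneg _) fun v => ?_
  rw [π.avg_apply hw hg, ← integral_mul_const]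
  refine norm_integral_le_of_norm_le (hw.abs.mul_const ‖v‖) (Eventually.of_forall fun z => ?_)
  rw [norm_smul, π.norm_apply, Real.norm_eq_abs]

theorem avg_add {w' : Z → ℝ} (hw : Integrable w μ) (hw' : Integrable w' μ) (hg : Measurable g) :
    π.avg μ (fun z => w z + w' z) g = π.avg μ w g + π.avg μ w' g := by
  ext v
  rw [add_apply, π.avg_apply hw hg, π.avg_apply hw' hg,
    π.avg_apply (w := fun z => w z + w' z) (hw.add hw') hg,
    ← integral_add (π.integrable_smul hw hg v) (π.integrable_smul hw' hg v)]
  refine integral_congr_ae (Eventually.of_forall fun z => ?_)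
  exact add_smul _ _ _

theorem avg_comp_equiv {Y : Type*} [MeasurableSpace Y] {ν : Measure Y} (e : Y ≃ᵐ Z)
    (he : MeasurePreserving e ν μ) (hw : Integrable w μ) (hg : Measurable g) :
    π.avg ν (fun y => w (e y)) (fun y => g (e y)) = π.avg μ w g := by
  ext v
  have hw' : Integrable (fun y => w (e y)) ν :=
    (he.integrable_comp_emb e.measurableEmbedding).2 hw
  rw [π.avg_apply hw hg, π.avg_apply (g := fun y => g (e y)) hw' (hg.comp e.measurable),
    ← he.integral_comp e.measurableEmbedding]

variable [CompleteSpace H]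

theorem inner_avg (hw : Integrable w μ) (hg : Measurable g) (v u : H) :
    ⟪π.avg μ w g v, u⟫_ℝ = ∫ z, w z * ⟪π (g z) v, u⟫_ℝ ∂μ := by
  rw [π.avg_apply hw hg, real_inner_comm, ← integral_inner (π.integrable_smul hw hg v)]
  refine integral_congr_ae (Eventually.of_forall fun z => ?_)
  simp only [inner_smul_right]
  rw [real_inner_comm]

theorem adjoint_avg (hw : Integrable w μ) (hg : Measurable g) :
    ContinuousLinearMap.adjoint (π.avg μ w g) = π.avg μ w fun z => G.inv (g z) := by
  have hg' : Measurable fun z => G.inv (g z) := G.contDiff_inv.continuous.measurable.comp hg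
  symm
  rw [ContinuousLinearMap.eq_adjoint_iff]
  intro v u
  rw [π.inner_avg hw hg', real_inner_comm, π.inner_avg hw hg]
  refine integral_congr_ae (Eventually.of_forall fun z => ?_)
  simp only
  rw [π.inner_apply_left, G.inv_inv, real_inner_comm]

theorem avg_mul_avg {Y : Type*} [MeasurableSpace Y] {ν : Measure Y} [SFinite μ] [SFinite ν]
    {w' : Y → ℝ} {g' : Y → 𝔼 n}
    (hw : Integrable w μ) (hg : Measurable g) (hw' : Integrable w' ν) (hg' : Measurable g') :
    π.avg μ w g * π.avg ν w' g' = π.avg (μ.prod ν) (fun p => w p.1 * w' p.2)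
      (fun p => G.mul (g p.1) (g' p.2)) := by
  have hG : Measurable fun p : Z × Y => G.mul (g p.1) (g' p.2) :=
    G.contDiff_mul.continuous.measurable.comp
      ((hg.comp measurable_fst).prodMk (hg'.comp measurable_snd))
  ext v
  rw [π.avg_apply (hw.mul_prod hw') hG, integral_prod _ (π.integrable_smul (hw.mul_prod hw') hG v),
    mul_apply_eq_comp, π.avg_apply hw hg, π.avg_apply hw' hg']
  refine integral_congr_ae (Eventually.of_forall fun z => ?_)
  simp only
  rw [← ContinuousLinearMap.integral_comp_comm _ (π.integrable_smul hw' hg' v), ← integral_smul]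
  refine integral_congr_ae (Eventually.of_forall fun y => ?_)
  simp only [map_smul, π.map_mul, mul_apply_eq_comp, smul_smul]

theorem prod_avg [SigmaFinite μ] (m : ℕ) (w : Fin m → Z → ℝ) (g : Fin m → Z → 𝔼 n)
    (hw : ∀ i, Integrable (w i) μ) (hg : ∀ i, Measurable (g i)) :
    (List.ofFn fun i => π.avg μ (w i) (g i)).prod =
      π.avg (Measure.pi fun _ : Fin m => μ) (fun z => ∏ i, w i (z i))
        (fun z => G.gprod m fun i => g i (z i)) := by
  induction m with
  | zero =>
    ext v
    rw [Measure.pi_of_empty, π.avg_apply (by simp) (by exact measurable_const)]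
    simp [HomogeneousGroup.gprod, π.map_zero]
  | succ m ih =>
    rw [List.ofFn_succ, List.prod_cons, ih (fun i => w i.succ) (fun i => g i.succ)
      (fun i => hw _) (fun i => hg _)]
    have hwm : Integrable (fun z : Fin m → Z => ∏ i, w i.succ (z i)) (Measure.pi fun _ => μ) :=
      Integrable.fintype_prod fun i => hw i.succ
    have hgm : Measurable fun z : Fin m → Z => G.gprod m fun i => g i.succ (z i) :=
      (G.contDiff_gprod m).continuous.measurable.comp
        (measurable_pi_lambda _ fun i => (hg i.succ).comp (measurable_pi_apply i))
    rw [π.avg_mul_avg (hw 0) (hg 0) hwm hgm]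
    have he := measurePreserving_piFinSuccAbove (fun _ : Fin (m + 1) => μ) 0
    have hG : Measurable fun p : Z × (Fin m → Z) =>
        G.mul (g 0 p.1) (G.gprod m fun i => g i.succ (p.2 i)) :=
      G.contDiff_mul.continuous.measurable.comp
        (((hg 0).comp measurable_fst).prodMk (hgm.comp measurable_snd))
    rw [← π.avg_comp_equiv _ he ((hw 0).mul_prod hwm) hG]
    congr 1
    ext1 z
    rw [Fin.prod_univ_succ]
    rfl

end UnitaryRep

/-! ### Smoothing by products of averages along dilations -/

theorem IsCutoff.eq_zero_of_notMem {η : ℝ → ℝ} (hη : IsCutoff η) {t : ℝ}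
    (ht : t ∉ Set.Icc (-1 : ℝ) 1) : η t = 0 :=
  hη.eq_zero t (by rw [Set.mem_Icc, ← abs_le] at ht; exact not_le.1 ht)

theorem IsCutoff.integrable {η : ℝ → ℝ} (hη : IsCutoff η) : Integrable η :=
  hη.contDiff.continuous.integrable_of_hasCompactSupport
    (HasCompactSupport.intro isCompact_Icc fun _ ht => hη.eq_zero_of_notMem ht)

theorem IsCutoff.integral_abs_le {η : ℝ → ℝ} (hη : IsCutoff η) : ∫ t, |η t| ≤ 2 := by
  have h0 : ∀ t, t ∉ Set.Icc (-1 : ℝ) 1 → |η t| = 0 := fun t ht => by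
    rw [hη.eq_zero_of_notMem ht, abs_zero]
  rw [← setIntegral_eq_integral_of_forall_compl_eq_zero h0]
  calc ∫ t in Set.Icc (-1 : ℝ) 1, |η t| ≤ ∫ _t in Set.Icc (-1 : ℝ) 1, (1 : ℝ) := by
        refine setIntegral_mono hη.integrable.abs.integrableOn (by simp) fun t => ?_
        simp only [abs_of_nonneg (hη.nonneg t), hη.le_one t]
    _ = 2 := by norm_num

/-- A measurable kernel bounded by `B` and supported in the Euclidean ball of radius `R`. -/
structure IsBddKernel {n : ℕ} (B R : ℝ) (κ : 𝔼 n → ℝ) : Prop where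
  aestronglyMeasurable : AEStronglyMeasurable κ volume
  abs_le : ∀ x, |κ x| ≤ B
  eq_zero : ∀ x, R < ‖x‖ → κ x = 0

namespace IsBddKernel

variable {n : ℕ} {B R : ℝ} {κ : 𝔼 n → ℝ}

theorem nonneg (hκ : IsBddKernel B R κ) : 0 ≤ B := (abs_nonneg _).trans (hκ.abs_le 0)

theorem abs_le_indicator (hκ : IsBddKernel B R κ) (x : 𝔼 n) :
    |κ x| ≤ (Metric.closedBall (0 : 𝔼 n) R).indicator (fun _ => B) x := by
  by_cases hx : x ∈ Metric.closedBall (0 : 𝔼 n) R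
  · rw [Set.indicator_of_mem hx]; exact hκ.abs_le x
  · rw [Set.indicator_of_notMem hx, hκ.eq_zero x (by simpa using hx), abs_zero]

theorem integrable_bound (B R : ℝ) :
    Integrable ((Metric.closedBall (0 : 𝔼 n) R).indicator fun _ => B) :=
  (integrable_indicator_iff Metric.isClosed_closedBall.measurableSet).2
    (integrableOn_const (measure_closedBall_lt_top (μ := volume)).ne)

theorem integrable (hκ : IsBddKernel B R κ) : Integrable κ :=
  (integrable_bound B R).mono' hκ.aestronglyMeasurable (Eventually.of_forall hκ.abs_le_indicator)

theorem integral_abs_le (hκ : IsBddKernel B R κ) :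
    ∫ x, |κ x| ≤ B * volume.real (Metric.closedBall (0 : 𝔼 n) R) := by
  refine (integral_mono hκ.integrable.abs (integrable_bound B R) hκ.abs_le_indicator).trans_eq ?_
  rw [integral_indicator Metric.isClosed_closedBall.measurableSet, setIntegral_const, smul_eq_mul,
    mul_comm]

end IsBddKernel

namespace UnitaryRep

variable {n : ℕ} {G : HomogeneousGroup n} {H : Type*} [NormedAddCommGroup H]
  [InnerProductSpace ℝ H] (π : UnitaryRep G H) {η : ℝ → ℝ} {κ : 𝔼 n → ℝ}

/-- The average of `π` over the points `e ^ (t + s) ∘ x` against `κ x η s dx ds`: the kernel `κ`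
moved to scale `e ^ t` and smoothed in the radial direction. -/
noncomputable def op (η : ℝ → ℝ) (κ : 𝔼 n → ℝ) (t : ℝ) : H →L[ℝ] H :=
  π.avg (volume : Measure (𝔼 n × ℝ)) (fun p => κ p.1 * η p.2) (fun p => G.dil (t + p.2) p.1)

variable (G) in
theorem measurable_dil_add (t : ℝ) : Measurable fun p : 𝔼 n × ℝ => G.dil (t + p.2) p.1 :=
  (Continuous.group_dil G (continuous_const.add continuous_snd) continuous_fst).measurable

theorem integrable_op_weight (hη : IsCutoff η) (hκ : Integrable κ) :
    Integrable (fun p : 𝔼 n × ℝ => κ p.1 * η p.2) := hκ.mul_prod hη.integrable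

theorem norm_op_le (hη : IsCutoff η) (hκ : Integrable κ) (t : ℝ) :
    ‖π.op η κ t‖ ≤ 2 * ∫ x, |κ x| := by
  refine (π.norm_avg_le (integrable_op_weight hη hκ) (measurable_dil_add G t)).trans ?_
  simp only [abs_mul]
  rw [Measure.volume_eq_prod, integral_prod_mul (fun x => |κ x|) (fun t => |η t|), mul_comm]
  exact mul_le_mul_of_nonneg_right hη.integral_abs_le (integral_nonneg fun x => abs_nonneg _)

theorem op_apply (hη : IsCutoff η) (hκ : Integrable κ) (t : ℝ) (v : H) :
    π.op η κ t v = ∫ p : 𝔼 n × ℝ, (κ p.1 * η p.2) • π (G.dil (t + p.2) p.1) v :=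
  π.avg_apply (integrable_op_weight hη hκ) (measurable_dil_add G t) v

theorem op_scale (hη : IsCutoff η) (hκ : Integrable κ) (t u : ℝ) :
    (π.scale u).op η κ t = π.op η κ (u + t) := by
  ext v
  rw [op_apply _ hη hκ, op_apply _ hη hκ]
  simp only [scale_apply, HomogeneousGroup.dil_dil, add_assoc]

theorem op_add (hη : IsCutoff η) {κ' : 𝔼 n → ℝ} (hκ : Integrable κ) (hκ' : Integrable κ')
    (t : ℝ) : π.op η (fun x => κ x + κ' x) t = π.op η κ t + π.op η κ' t := by
  rw [op, op, op, ← π.avg_add (integrable_op_weight hη hκ) (integrable_op_weight hη hκ')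
    (measurable_dil_add G t)]
  simp only [add_mul]

theorem op_sum (hη : IsCutoff η) {ι : Type*} (S : Finset ι) (k : ι → 𝔼 n → ℝ)
    (hk : ∀ i, Integrable (k i)) (t : ℝ) :
    π.op η (fun x => ∑ i ∈ S, k i x) t = ∑ i ∈ S, π.op η (k i) t := by
  classical
  induction S using Finset.induction with
  | empty =>
    ext v
    rw [op_apply _ hη (by simp)]
    simp
  | insert i S hi ih =>
    simp only [Finset.sum_insert hi]
    rw [π.op_add hη (hk i) (integrable_finsetSum S fun j _ => hk j), ih]

variable [CompleteSpace H]

theorem adjoint_op (hη : IsCutoff η) (hκ : Integrable κ) (t : ℝ) :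
    ContinuousLinearMap.adjoint (π.op η κ t) = π.op η (fun x => κ (G.inv x)) t := by
  have hm := G.measurePreserving_inv
  let e : 𝔼 n ≃ᵐ 𝔼 n :=
    { toFun := G.inv
      invFun := G.inv
      left_inv := G.inv_inv
      right_inv := G.inv_inv
      measurable_toFun := hm.measurable
      measurable_invFun := hm.measurable }
  let E : 𝔼 n × ℝ ≃ᵐ 𝔼 n × ℝ := MeasurableEquiv.prodCongr e (MeasurableEquiv.refl ℝ)
  have hE : MeasurePreserving E volume volume := hm.prod (MeasurePreserving.id volume)
  have hg : Measurable fun p : 𝔼 n × ℝ => G.inv (G.dil (t + p.2) p.1) :=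
    hm.measurable.comp (measurable_dil_add G t)
  rw [op, op, π.adjoint_avg (integrable_op_weight hη hκ) (measurable_dil_add G t),
    ← π.avg_comp_equiv E hE (integrable_op_weight hη hκ) hg]
  congr 1
  ext1 p
  change G.inv (G.dil (t + p.2) (G.inv p.1)) = G.dil (t + p.2) p.1
  rw [G.dil_inv, G.inv_inv]

/-- The smoothing estimate: a product of `n` averages along dilations is Hölder continuous under
left multiplication by the representation, in operator norm, uniformly over bounded kernels. -/
theorem exists_norm_sub_one_mul_prod_le (hη : IsCutoff η) (R : ℝ) : ∃ C ε : ℝ, 0 < C ∧ 0 < ε ∧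
    ∀ (π : UnitaryRep G H) (κ : Fin n → 𝔼 n → ℝ) (B : ℝ), 0 ≤ B → (∀ i, IsBddKernel B R (κ i)) →
      ∀ y : 𝔼 n, ‖y‖ ≤ 1 →
        ‖(π y - 1) * (List.ofFn fun i => π.op η (κ i) 0).prod‖ ≤ C * B ^ n * ‖y‖ ^ ε := by
  obtain ⟨C, ε, hC, hε, hosc⟩ := G.exists_integral_osc_le hη (max R 0)
  refine ⟨C, ε, hC, hε, fun π κ B hB hκ y hy => ?_⟩
  refine ContinuousLinearMap.opNorm_le_of_abs_inner_le _ (by positivity) fun v w hv hw => ?_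
  set h : 𝔼 n → ℝ := fun g => ⟪π g v, w⟫_ℝ with hh
  have hhc : Continuous h := (π.continuous_apply v).inner continuous_const
  have hhb : ∀ g, |h g| ≤ 1 := fun g =>
    (abs_real_inner_le_norm _ _).trans (by
      rw [π.norm_apply]; exact mul_le_one₀ hv (norm_nonneg _) hw)
  let W : (Fin n → 𝔼 n × ℝ) → ℝ := fun z => ∏ i, (κ i (z i).1 * η (z i).2)
  let Φ : (Fin n → 𝔼 n × ℝ) → 𝔼 n := fun z => G.prodMap (fun i => (z i).1) (fun i => (z i).2)
  have hΦ : Measurable Φ :=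
    (G.contDiff_prodMap.continuous.comp (f := fun z : Fin n → 𝔼 n × ℝ =>
      ((fun i => (z i).1), fun i => (z i).2)) (by fun_prop)).measurable
  have hW : Integrable W := Integrable.fintype_prod (μ := fun _ => volume)
    (f := fun i (p : 𝔼 n × ℝ) => κ i p.1 * η p.2)
    fun i => integrable_op_weight hη (hκ i).integrable
  have hprod : (List.ofFn fun i => π.op η (κ i) 0).prod = π.avg volume W Φ := by
    have := π.prod_avg (μ := (volume : Measure (𝔼 n × ℝ))) n (fun i p => κ i p.1 * η p.2)
      (fun i p => G.dil (0 + p.2) p.1) (fun i => integrable_op_weight hη (hκ i).integrable)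
      (fun i => measurable_dil_add G 0)
    refine this.trans ?_
    simp only [_root_.zero_add]
    rfl
  have hform : ⟪((π y - 1) * π.avg volume W Φ) v, w⟫_ℝ =
      ∫ z, W z * (h (G.mul y (Φ z)) - h (Φ z)) := by
    have hyv : ∀ z, π (G.mul y (Φ z)) v = π y (π (Φ z) v) := fun z => by rw [π.map_mul]; rfl
    rw [mul_apply_eq_comp, sub_apply, one_apply_eq_self, inner_sub_left, π.inner_apply_left,
      π.inner_avg hW hΦ, π.inner_avg hW hΦ]
    have hi : ∀ u : H, Integrable fun z => W z * ⟪π (Φ z) v, u⟫_ℝ := fun u => by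
      have := (π.integrable_smul hW hΦ v).inner_const (𝕜 := ℝ) u
      simpa only [inner_smul_left, conj_trivial] using this
    rw [← integral_sub (hi _) (hi _)]
    refine integral_congr_ae (Eventually.of_forall fun z => ?_)
    simp only [hh, hyv, π.inner_apply_left y]
    ring
  let e := MeasurableEquiv.arrowProdEquivProdArrow (𝔼 n) ℝ (Fin n)
  have he := volume_measurePreserving_arrowProdEquivProdArrow (𝔼 n) ℝ (Fin n)
  let Q : (Fin n → 𝔼 n) × (Fin n → ℝ) → ℝ := fun p => (∏ i, κ i (p.1 i)) *
    (cubeWeight η p.2 * (h (G.mul y (G.prodMap p.1 p.2)) - h (G.prodMap p.1 p.2)))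
  have hQ : ∀ z, W z * (h (G.mul y (Φ z)) - h (Φ z)) = Q (e z) := by
    intro z
    simp only [W, Q, Finset.prod_mul_distrib, cubeWeight]
    exact _root_.mul_assoc _ _ _
  have hoscc : Continuous fun p : (Fin n → 𝔼 n) × (Fin n → ℝ) =>
      cubeWeight η p.2 * (h (G.mul y (G.prodMap p.1 p.2)) - h (G.prodMap p.1 p.2)) :=
    (hη.contDiff_cubeWeight.continuous.comp continuous_snd).mul
      ((hhc.comp (Continuous.group_mul G continuous_const G.contDiff_prodMap.continuous)).sub
        (hhc.comp G.contDiff_prodMap.continuous))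
  have hosc2 : ∀ p : (Fin n → 𝔼 n) × (Fin n → ℝ),
      |cubeWeight η p.2 * (h (G.mul y (G.prodMap p.1 p.2)) - h (G.prodMap p.1 p.2))| ≤
        2 * (cubeWeight η p.2 * 1) := by
    intro p
    have h3 := abs_le.1 (hhb (G.mul y (G.prodMap p.1 p.2)))
    have h4 := abs_le.1 (hhb (G.prodMap p.1 p.2))
    have h5 : |h (G.mul y (G.prodMap p.1 p.2)) - h (G.prodMap p.1 p.2)| ≤ 2 := by
      rw [abs_le]
      constructor <;> linarith [h3.1, h3.2, h4.1, h4.2]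
    rw [abs_mul, abs_of_nonneg (hη.cubeWeight_nonneg _)]
    nlinarith [hη.cubeWeight_nonneg p.2]
  have hκi : Integrable (fun x : Fin n → 𝔼 n => ∏ i, κ i (x i)) :=
    Integrable.fintype_prod (μ := fun _ => volume) fun i => (hκ i).integrable
  have hcw : Integrable fun s : Fin n → ℝ => 2 * (cubeWeight η s * 1) :=
    (HomogeneousGroup.integrable_cubeWeight_mul hη continuous_const).const_mul 2
  have hQi : Integrable Q := by
    have hdom : Integrable (fun p : (Fin n → 𝔼 n) × (Fin n → ℝ) =>
        (∏ i, κ i (p.1 i)) * (2 * (cubeWeight η p.2 * 1))) := hκi.mul_prod hcw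
    refine hdom.norm.mono' (hκi.aestronglyMeasurable.comp_fst.mul hoscc.aestronglyMeasurable)
      (Eventually.of_forall fun p => ?_)
    simp only [Q]
    rw [norm_mul, norm_mul (∏ i, κ i (p.1 i))]
    refine mul_le_mul_of_nonneg_left ?_ (norm_nonneg _)
    exact (hosc2 p).trans (le_abs_self _)
  have hfub : ∫ z, W z * (h (G.mul y (Φ z)) - h (Φ z)) = ∫ x, (∏ i, κ i (x i)) *
      ∫ s, cubeWeight η s * (h (G.mul y (G.prodMap x s)) - h (G.prodMap x s)) := by
    simp_rw [hQ]
    rw [he.integral_comp e.measurableEmbedding, Measure.volume_eq_prod, integral_prod _ hQi]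
    refine integral_congr_ae (Eventually.of_forall fun x => ?_)
    exact integral_const_mul (∏ i, κ i (x i)) fun s =>
      cubeWeight η s * (h (G.mul y (G.prodMap x s)) - h (G.prodMap x s))
  rw [hprod, hform, hfub, ← Real.norm_eq_abs]
  set I : (Fin n → 𝔼 n) → ℝ := fun x =>
    ∫ s, cubeWeight η s * (h (G.mul y (G.prodMap x s)) - h (G.prodMap x s)) with hI
  have hball : volume (Metric.closedBall (0 : Fin n → 𝔼 n) (max R 0)) < ⊤ :=
    measure_closedBall_lt_top
  have hIi : Integrable I (volume.restrict (Metric.closedBall (0 : Fin n → 𝔼 n) (max R 0))) := by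
    have : IsFiniteMeasure (volume.restrict (Metric.closedBall (0 : Fin n → 𝔼 n) (max R 0))) :=
      ⟨by simpa using hball⟩
    have h1 : Integrable (fun p : (Fin n → 𝔼 n) × (Fin n → ℝ) =>
        cubeWeight η p.2 * (h (G.mul y (G.prodMap p.1 p.2)) - h (G.prodMap p.1 p.2)))
        ((volume.restrict (Metric.closedBall (0 : Fin n → 𝔼 n) (max R 0))).prod volume) := by
      have hdom : Integrable (fun p : (Fin n → 𝔼 n) × (Fin n → ℝ) =>
          (1 : ℝ) * (2 * (cubeWeight η p.2 * 1)))
          ((volume.restrict (Metric.closedBall (0 : Fin n → 𝔼 n) (max R 0))).prod volume) :=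
        (integrable_const (1 : ℝ)).mul_prod hcw
      refine hdom.mono' hoscc.aestronglyMeasurable (Eventually.of_forall fun p => ?_)
      rw [one_mul]
      exact hosc2 p
    exact h1.integral_prod_left
  have hmain := hosc y h hy hhc hhb
  calc ‖∫ x, (∏ i, κ i (x i)) * I x‖
      ≤ ∫ x, (Metric.closedBall (0 : Fin n → 𝔼 n) (max R 0)).indicator
          (fun x => B ^ n * |I x|) x := by
        refine norm_integral_le_of_norm_le ((integrable_indicator_iff
          Metric.isClosed_closedBall.measurableSet).2 (hIi.abs.const_mul _))
          (Eventually.of_forall fun x => ?_)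
        by_cases hx : x ∈ Metric.closedBall (0 : Fin n → 𝔼 n) (max R 0)
        · rw [Set.indicator_of_mem hx, norm_mul, Real.norm_eq_abs, Real.norm_eq_abs,
            Finset.abs_prod]
          refine mul_le_mul_of_nonneg_right ?_ (abs_nonneg _)
          calc ∏ i, |κ i (x i)| ≤ ∏ _i : Fin n, B :=
                Finset.prod_le_prod (fun i _ => abs_nonneg _) fun i _ => (hκ i).abs_le _
            _ = B ^ n := by simp
        · rw [Set.indicator_of_notMem hx]
          have : ∃ i, max R 0 < ‖x i‖ := by
            by_contra! hcon
            exact hx (by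
              rw [mem_closedBall_zero_iff]
              exact (pi_norm_le_iff_of_nonneg (le_max_right R 0)).2 hcon)
          obtain ⟨i, hi⟩ := this
          rw [Finset.prod_eq_zero (Finset.mem_univ i)
            ((hκ i).eq_zero _ ((le_max_left R 0).trans_lt hi)), MulZeroClass.zero_mul, norm_zero]
    _ = B ^ n * ∫ x in Metric.closedBall (0 : Fin n → 𝔼 n) (max R 0), |I x| := by
        rw [integral_indicator Metric.isClosed_closedBall.measurableSet, integral_const_mul]
    _ ≤ B ^ n * (C * ‖y‖ ^ ε) := by gcongr
    _ = C * B ^ n * ‖y‖ ^ ε := by ring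

end UnitaryRep

/-! ### Almost orthogonality in C⋆-rings -/

namespace AlmostOrthogonal

variable {ι M A : Type*}

/-- The sum of `f` over all lists of length `m`. -/
def listSum [Fintype ι] [AddCommMonoid M] : ℕ → (List ι → M) → M
  | 0, f => f []
  | m + 1, f => ∑ j, listSum m fun l => f (j :: l)

theorem norm_listSum_le [Fintype ι] [SeminormedAddCommGroup M] (m : ℕ) (f : List ι → M)
    {g : List ι → ℝ} (h : ∀ l, ‖f l‖ ≤ g l) : ‖listSum m f‖ ≤ listSum m g := by
  induction m generalizing f g with
  | zero => exact h []
  | succ m ih =>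
    exact (norm_sum_le _ _).trans (Finset.sum_le_sum fun j _ => ih _ fun l => h _)

theorem mul_listSum [Fintype ι] [NonUnitalNonAssocSemiring M] (m : ℕ) (a : M) (f : List ι → M) :
    listSum m (fun l => a * f l) = a * listSum m f := by
  induction m generalizing f with
  | zero => rfl
  | succ m ih => simp only [listSum, ih, Finset.mul_sum]

/-- The alternating product `X i₀ * Y i₁ * X i₂ * ⋯` along a nonempty list of indices. -/
def word [Mul A] : (ι → A) → (ι → A) → ι → List ι → A
  | X, _, i, [] => X i
  | X, Y, i, j :: l => X i * word Y X j l

/-- The alternating product `x * y * x * ⋯` with `m + 1` factors. -/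
def altPow [Mul A] : A → A → ℕ → A
  | x, _, 0 => x
  | x, y, m + 1 => x * altPow y x m

theorem sum_listSum_word [Fintype ι] [NonUnitalSemiring A] (X Y : ι → A) (m : ℕ) :
    ∑ i, listSum m (word X Y i) = altPow (∑ i, X i) (∑ i, Y i) m := by
  induction m generalizing X Y with
  | zero => rfl
  | succ m ih =>
    simp only [listSum, word, mul_listSum, altPow, ← ih, Finset.sum_mul_sum]

theorem altPow_odd [Monoid A] (x y : A) (m : ℕ) : altPow x y (2 * m + 1) = (x * y) ^ (m + 1) := by
  induction m with
  | zero => simp [altPow]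
  | succ m ih =>
    have : 2 * (m + 1) + 1 = (2 * m + 1) + 1 + 1 := by ring
    rw [this, altPow, altPow, ih, ← mul_assoc, ← pow_succ']

/-- The bound for `‖word i l‖` obtained by pairing the factors starting from the first one. -/
def pairBound (γ : ι → ι → ℝ) (b : ℝ) : ι → List ι → ℝ
  | _, [] => b
  | i, [j] => γ i j ^ 2
  | i, j :: k :: l => γ i j ^ 2 * pairBound γ b k l

/-- The bound for `‖word i l‖` obtained by pairing the factors starting from the second one. -/
def shiftBound (γ : ι → ι → ℝ) (b : ℝ) : ι → List ι → ℝ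
  | _, [] => b
  | _, j :: l => b * pairBound γ b j l

/-- The product of `γ` along the consecutive indices of a list. -/
def chain (γ : ι → ι → ℝ) : ι → List ι → ℝ
  | _, [] => 1
  | i, j :: l => γ i j * chain γ j l

theorem pairBound_mul_shiftBound (γ : ι → ι → ℝ) (b : ℝ) (i : ι) (l : List ι) :
    pairBound γ b i l * shiftBound γ b i l = (b * chain γ i l) ^ 2 := by
  induction l generalizing i with
  | nil => simp [pairBound, shiftBound, chain]; ring
  | cons j l ih =>
    have h : pairBound γ b i (j :: l) * b = γ i j ^ 2 * shiftBound γ b j l := by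
      cases l with
      | nil => rfl
      | cons k l => simp only [pairBound, shiftBound]; ring
    calc pairBound γ b i (j :: l) * shiftBound γ b i (j :: l)
        = pairBound γ b i (j :: l) * b * pairBound γ b j l := by simp only [shiftBound]; ring
      _ = γ i j ^ 2 * (pairBound γ b j l * shiftBound γ b j l) := by rw [h]; ring
      _ = _ := by rw [ih]; simp only [chain]; ring

theorem chain_nonneg {γ : ι → ι → ℝ} (hγ : ∀ i j, 0 ≤ γ i j) (i : ι) (l : List ι) :
    0 ≤ chain γ i l := by
  induction l generalizing i with
  | nil => exact zero_le_one
  | cons j l ih => exact mul_nonneg (hγ i j) (ih j)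

theorem listSum_chain_le [Fintype ι] {γ : ι → ι → ℝ} (hγ : ∀ i j, 0 ≤ γ i j) {Γ : ℝ}
    (hΓ : ∀ i, ∑ j, γ i j ≤ Γ) (hΓ0 : 0 ≤ Γ) (m : ℕ) (i : ι) :
    listSum m (chain γ i) ≤ Γ ^ m := by
  induction m generalizing i with
  | zero => simp [listSum, chain]
  | succ m ih =>
    simp only [listSum, chain, mul_listSum]
    calc ∑ j, γ i j * listSum m (chain γ j) ≤ ∑ j, γ i j * Γ ^ m :=
          Finset.sum_le_sum fun j _ => mul_le_mul_of_nonneg_left (ih j) (hγ i j)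
      _ = (∑ j, γ i j) * Γ ^ m := (Finset.sum_mul ..).symm
      _ ≤ Γ * Γ ^ m := mul_le_mul_of_nonneg_right (hΓ i) (by positivity)
      _ = Γ ^ (m + 1) := (pow_succ' Γ m).symm

theorem norm_word_le_pairBound [NonUnitalNormedRing A] {γ : ι → ι → ℝ} {b : ℝ} (hb : 0 ≤ b) :
    ∀ (l : List ι) (X Y : ι → A) (i : ι), (∀ i, ‖X i‖ ≤ b) → (∀ i, ‖Y i‖ ≤ b) →
      (∀ i j, ‖X i * Y j‖ ≤ γ i j ^ 2) → ‖word X Y i l‖ ≤ pairBound γ b i l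
  | [], _, _, i, hX, _, _ => hX i
  | [j], _, _, i, _, _, hXY => hXY i j
  | j :: k :: l, X, Y, i, hX, hY, hXY => by
    simp only [word, pairBound]
    rw [← mul_assoc]
    exact (norm_mul_le _ _).trans (mul_le_mul (hXY i j)
      (norm_word_le_pairBound hb l X Y k hX hY hXY) (norm_nonneg _) (sq_nonneg _))

/-- The geometric mean of the bounds obtained from the two ways of pairing neighbouring factors. -/
theorem norm_word_le [NonUnitalNormedRing A] {γ : ι → ι → ℝ} (hγ : ∀ i j, 0 ≤ γ i j) {b : ℝ}
    (hb : 0 ≤ b) (l : List ι) (X Y : ι → A) (i : ι) (hX : ∀ i, ‖X i‖ ≤ b) (hY : ∀ i, ‖Y i‖ ≤ b)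
    (hXY : ∀ i j, ‖X i * Y j‖ ≤ γ i j ^ 2) (hYX : ∀ i j, ‖Y i * X j‖ ≤ γ i j ^ 2) :
    ‖word X Y i l‖ ≤ b * chain γ i l := by
  have h1 := norm_word_le_pairBound hb l X Y i hX hY hXY
  have h2 : ‖word X Y i l‖ ≤ shiftBound γ b i l := by
    cases l with
    | nil => exact hX i
    | cons j l =>
      exact (norm_mul_le _ _).trans (mul_le_mul (hX i)
        (norm_word_le_pairBound hb l Y X j hY hX hYX) (norm_nonneg _) hb)
  refine abs_le_of_sq_le_sq' ?_ (mul_nonneg hb (chain_nonneg hγ i l)) |>.2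
  rw [← pairBound_mul_shiftBound, sq]
  exact mul_le_mul h1 h2 (norm_nonneg _) ((norm_nonneg _).trans h1)

/-- Taking roots of order `2 * 2 ^ k` and letting `k` grow removes the constant `c`. -/
theorem le_of_pow_le_mul_pow {x Γ c : ℝ} (hΓ : 0 ≤ Γ)
    (h : ∀ k : ℕ, x ^ (2 * 2 ^ k) ≤ c * Γ ^ (2 * 2 ^ k - 1)) : x ≤ Γ := by
  rcases hΓ.eq_or_lt with rfl | hΓ
  · have h0 := h 0
    simp only [pow_zero, mul_one] at h0
    norm_num at h0
    nlinarith
  · by_contra! hlt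
    have hr : 1 < x / Γ := (one_lt_div hΓ).2 hlt
    obtain ⟨N, hN⟩ := pow_unbounded_of_one_lt (c / Γ) hr
    have h1 := h N
    have hN2 : N ≤ 2 * 2 ^ N := by
      have := Nat.lt_two_pow_self (n := N); omega
    have h2 : (x / Γ) ^ N ≤ (x / Γ) ^ (2 * 2 ^ N) := pow_le_pow_right₀ hr.le hN2
    have h3 : (x / Γ) ^ (2 * 2 ^ N) ≤ c / Γ := by
      rw [div_pow, div_le_div_iff₀ (by positivity) hΓ]
      have h4 : Γ ^ (2 * 2 ^ N) = Γ ^ (2 * 2 ^ N - 1) * Γ := by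
        rw [← pow_succ, Nat.sub_add_cancel (Nat.succ_le_of_lt (by positivity))]
      rw [h4]
      nlinarith
    linarith

/-- **Cotlar–Stein lemma** for finite families: if the products `(T i)⋆ T j` and `T i (T j)⋆` are
bounded by `γ i j ^ 2`, and the row sums of `γ` by `Γ`, then the sum of the family has norm at
most `Γ`. -/
theorem norm_sum_le_of_almostOrthogonal [Fintype ι] [NormedRing A] [StarRing A] [CStarRing A]
    (T : ι → A) {γ : ι → ι → ℝ} (hγ : ∀ i j, 0 ≤ γ i j) {Γ : ℝ} (hΓ0 : 0 ≤ Γ)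
    (hΓ : ∀ i, ∑ j, γ i j ≤ Γ)
    (h1 : ∀ i j, ‖star (T i) * T j‖ ≤ γ i j ^ 2) (h2 : ∀ i j, ‖T i * star (T j)‖ ≤ γ i j ^ 2) :
    ‖∑ i, T i‖ ≤ Γ := by
  set b := ∑ i, ‖T i‖ with hb
  have hb0 : 0 ≤ b := Finset.sum_nonneg fun i _ => norm_nonneg _
  have hT : ∀ i, ‖T i‖ ≤ b := fun i =>
    Finset.single_le_sum (f := fun i => ‖T i‖) (fun i _ => norm_nonneg _) (Finset.mem_univ i)
  set S := ∑ i, T i with hS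
  refine le_of_pow_le_mul_pow (c := Fintype.card ι * b) hΓ0 fun k => ?_
  obtain ⟨m, hm⟩ : ∃ m, 2 ^ k = m + 1 := ⟨2 ^ k - 1, (Nat.sub_add_cancel Nat.one_le_two_pow).symm⟩
  have hpow : ‖S‖ ^ (2 * 2 ^ k) = ‖(star S * S) ^ (2 ^ k)‖ := by
    have h3 : IsSelfAdjoint (star S * S) := IsSelfAdjoint.star_mul_self S
    have h4 := congrArg NNReal.toReal (h3.nnnorm_pow_two_pow k)
    simp only [NNReal.coe_pow, coe_nnnorm] at h4
    rw [h4, CStarRing.norm_star_mul_self, pow_mul, sq]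
  rw [hpow, hm, ← altPow_odd, hS, star_sum, ← sum_listSum_word]
  have h5 : 2 * (m + 1) - 1 = 2 * m + 1 := by omega
  rw [h5]
  calc ‖∑ i, listSum (2 * m + 1) (word (fun i => star (T i)) T i)‖
      ≤ ∑ _i : ι, b * Γ ^ (2 * m + 1) := by
        refine (norm_sum_le _ _).trans (Finset.sum_le_sum fun i _ => ?_)
        refine (norm_listSum_le _ _ fun l => norm_word_le hγ hb0 l _ _ i
          (fun i => (norm_star (T i)).trans_le (hT i)) hT h1 h2).trans ?_
        rw [mul_listSum]
        exact mul_le_mul_of_nonneg_left (listSum_chain_le hγ hΓ hΓ0 _ i) hb0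
    _ = _ := by simp; ring

/-- The `TT⋆` iteration: smallness of `U (S S⋆) ^ (2 ^ k)` implies smallness of `U S`. -/
theorem norm_mul_pow_le [NormedRing A] [StarRing A] [CStarRing A] (U S : A) {b : ℝ} (hb : 0 < b)
    (hU : ‖U‖ ≤ b) (k : ℕ) :
    ‖U * S‖ ^ (2 * 2 ^ k) * b ≤ ‖U * (S * star S) ^ (2 ^ k)‖ * b ^ (2 * 2 ^ k) := by
  set Q := S * star S with hQ
  have hQs : star Q = Q := by rw [hQ, star_mul, star_star]
  have hUs : ‖star U‖ ≤ b := (norm_star U).trans_le hU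
  have hsq : ∀ j : ℕ, ‖U * Q ^ j‖ ^ 2 ≤ ‖U * Q ^ (2 * j)‖ * b := by
    intro j
    rw [sq, ← CStarRing.norm_self_mul_star, star_mul, star_pow, hQs]
    have : U * Q ^ j * (Q ^ j * star U) = U * Q ^ (2 * j) * star U := by
      rw [two_mul, pow_add]; simp only [mul_assoc]
    rw [this]
    exact (norm_mul_le _ _).trans (mul_le_mul_of_nonneg_left hUs (norm_nonneg _))
  have hfirst : ‖U * S‖ ^ 2 ≤ ‖U * Q‖ * b := by
    rw [sq, ← CStarRing.norm_self_mul_star, star_mul]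
    have : U * S * (star S * star U) = U * Q * star U := by rw [hQ]; simp only [mul_assoc]
    rw [this]
    exact (norm_mul_le _ _).trans (mul_le_mul_of_nonneg_left hUs (norm_nonneg _))
  induction k with
  | zero =>
    simp only [pow_zero, mul_one, pow_one]
    calc ‖U * S‖ ^ 2 * b ≤ (‖U * Q‖ * b) * b := mul_le_mul_of_nonneg_right hfirst hb.le
      _ = _ := by ring
  | succ k ih =>
    have h1 := hsq (2 ^ k)
    have h2 := pow_le_pow_left₀ (by positivity) ih 2
    have e1 : 2 * 2 ^ (k + 1) = 2 * 2 ^ k * 2 := by ring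
    have e2 : 2 ^ (k + 1) = 2 * 2 ^ k := by ring
    rw [e1, e2, pow_mul, pow_mul b]
    refine le_of_mul_le_mul_right ?_ hb
    calc (‖U * S‖ ^ (2 * 2 ^ k)) ^ 2 * b * b = (‖U * S‖ ^ (2 * 2 ^ k) * b) ^ 2 := by ring
      _ ≤ (‖U * Q ^ 2 ^ k‖ * b ^ (2 * 2 ^ k)) ^ 2 := h2
      _ = ‖U * Q ^ 2 ^ k‖ ^ 2 * (b ^ (2 * 2 ^ k)) ^ 2 := by ring
      _ ≤ ‖U * Q ^ (2 * 2 ^ k)‖ * b * (b ^ (2 * 2 ^ k)) ^ 2 := by gcongr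
      _ = _ := by ring

theorem norm_prod_ofFn_le [NormedRing A] (h1 : ‖(1 : A)‖ ≤ 1) {b : ℝ} {m : ℕ}
    (f : Fin m → A) (hf : ∀ i, ‖f i‖ ≤ b) : ‖(List.ofFn f).prod‖ ≤ b ^ m := by
  induction m with
  | zero => simpa using h1
  | succ m ih =>
    rw [List.ofFn_succ, List.prod_cons, pow_succ']
    exact (norm_mul_le _ _).trans (mul_le_mul (hf 0) (ih _ fun i => hf _) (norm_nonneg _)
      ((norm_nonneg _).trans (hf 0)))

/-- A power of `S T` begins with the alternating product of `m` factors `S T S ⋯`. -/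
theorem exists_mul_pow_eq_prod_mul [NormedRing A] (h1 : ‖(1 : A)‖ ≤ 1) {b : ℝ} (S T : A)
    (hS : ‖S‖ ≤ b) (hT : ‖T‖ ≤ b) (m r j : ℕ) (hj : m + r = 2 * j) :
    ∃ W : A, (S * T) ^ j = (List.ofFn fun i : Fin m => if Even i.val then S else T).prod * W ∧
      ‖W‖ ≤ b ^ r := by
  let f : ∀ k : ℕ, Fin k → A := fun k i => if Even i.val then S else T
  have hf : ∀ j : ℕ, (S * T) ^ j = (List.ofFn (f (2 * j))).prod := by
    intro j
    induction j with
    | zero => simp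
    | succ j ih =>
      rw [pow_succ', ih]
      have e : 2 * (j + 1) = (2 * j).succ.succ := by omega
      have key : ∀ k, (List.ofFn (f k.succ.succ)).prod = S * (T * (List.ofFn (f k)).prod) := by
        intro k
        rw [List.ofFn_succ, List.prod_cons, List.ofFn_succ, List.prod_cons]
        have : (fun i : Fin k => f k.succ.succ i.succ.succ) = f k := by
          ext1 i
          simp [f, Nat.even_add_one]
        rw [this]
        simp [f]
      rw [e, key, mul_assoc]
  let g : Fin r → A := fun i => if Even (m + i.val) then S else T
  refine ⟨(List.ofFn g).prod, ?_, norm_prod_ofFn_le h1 g fun i => ?_⟩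
  · rw [hf, ← hj, ← List.prod_append, ← List.ofFn_fin_append]
    congr 2
    ext1 i
    refine Fin.addCases (fun i => ?_) (fun i => ?_) i
    · simp [f]
    · simp [f, g]
  · simp only [g]
    split_ifs <;> assumption

end AlmostOrthogonal

/-! ### Almost orthogonality of the dyadic pieces -/

namespace UnitaryRep

variable {n : ℕ} {G : HomogeneousGroup n} {H : Type*} [NormedAddCommGroup H]
  [InnerProductSpace ℝ H] {η : ℝ → ℝ}

theorem norm_op_le_of_isBddKernel (π : UnitaryRep G H) (hη : IsCutoff η) {B R : ℝ}
    {κ : 𝔼 n → ℝ} (hκ : IsBddKernel B R κ) (t : ℝ) :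
    ‖π.op η κ t‖ ≤ 2 * (volume.real (Metric.closedBall (0 : 𝔼 n) R) + 1) * B := by
  have h1 := π.norm_op_le hη hκ.integrable t
  have h2 := hκ.integral_abs_le
  have h3 := hκ.nonneg
  nlinarith

theorem norm_sub_one_le (π : UnitaryRep G H) (y : 𝔼 n) : ‖π y - 1‖ ≤ 2 := by
  refine ContinuousLinearMap.opNorm_le_bound _ (by norm_num) fun v => ?_
  rw [sub_apply, one_apply_eq_self]
  refine (norm_sub_le _ _).trans ?_
  rw [π.norm_apply]; linarith

variable [CompleteSpace H]

/-- If `κ` has mean zero, then at a small scale `e ^ t` its average annihilates, up to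
`exp (c * t)`, every operator that is smoothed by a product of `n` averages at scale `1`. -/
theorem exists_norm_op_mul_prod_le (hη : IsCutoff η) (R : ℝ) : ∃ C c : ℝ, 0 ≤ C ∧ 0 < c ∧
    ∀ (π : UnitaryRep G H) (κ : 𝔼 n → ℝ) (κ' : Fin n → 𝔼 n → ℝ) (B : ℝ), IsBddKernel B R κ →
      (∀ i, IsBddKernel B R (κ' i)) → ∫ x, κ x = 0 → ∀ t ≤ 0,
        ‖π.op η κ t * (List.ofFn fun i => π.op η (κ' i) 0).prod‖ ≤
          C * B ^ (n + 1) * Real.exp (c * t) := by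
  obtain ⟨C, ε, hC, hε, hkey⟩ := exists_norm_sub_one_mul_prod_le (G := G) (H := H) hη R
  obtain ⟨a, ha, hdil⟩ := G.exists_norm_dil_le
  obtain ⟨R', hR', hdil'⟩ := G.exists_norm_dil_le_of_le 1 R
  obtain ⟨V, hV⟩ : ∃ V, V = volume.real (Metric.closedBall (0 : 𝔼 n) R) := ⟨_, rfl⟩
  have hV0 : 0 ≤ V := hV ▸ measureReal_nonneg
  obtain ⟨β, hβ⟩ : ∃ β, β = 2 * (V + 1) := ⟨_, rfl⟩
  have hβ0 : 0 < β := by rw [hβ]; positivity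
  have hop : ∀ (π : UnitaryRep G H) (κ : 𝔼 n → ℝ) (B : ℝ), IsBddKernel B R κ → ∀ t,
      ‖π.op η κ t‖ ≤ β * B := fun π κ B hκ t => by
    rw [hβ, hV]; exact π.norm_op_le_of_isBddKernel hη hκ t
  have hkey2 : ∀ (π : UnitaryRep G H) (κ : Fin n → 𝔼 n → ℝ) (B : ℝ), 0 ≤ B →
      (∀ i, IsBddKernel B R (κ i)) → ∀ y : 𝔼 n,
        ‖(π y - 1) * (List.ofFn fun i => π.op η (κ i) 0).prod‖ ≤
          (C + 2 * β ^ n) * B ^ n * ‖y‖ ^ ε := by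
    intro π κ B hB hκ y
    rcases le_total ‖y‖ 1 with hy | hy
    · refine (hkey π κ B hB hκ y hy).trans ?_
      gcongr
      linarith [pow_pos hβ0 n]
    · have h1 : (1 : ℝ) ≤ ‖y‖ ^ ε := Real.one_le_rpow hy hε.le
      have h2 : ‖(List.ofFn fun i => π.op η (κ i) 0).prod‖ ≤ (β * B) ^ n :=
        AlmostOrthogonal.norm_prod_ofFn_le ContinuousLinearMap.norm_id_le _ fun i =>
          hop π _ _ (hκ i) 0
      calc _ ≤ 2 * (β * B) ^ n := (norm_mul_le _ _).trans
            (mul_le_mul (π.norm_sub_one_le y) h2 (norm_nonneg _) (by norm_num))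
        _ = (0 + 2 * β ^ n) * B ^ n * 1 := by rw [mul_pow]; ring
        _ ≤ _ := by gcongr
  refine ⟨(C + 2 * β ^ n) * R' ^ ε * (2 * V), a * ε, by positivity, by positivity,
    fun π κ κ' B hκ hκ' hmean t ht => ?_⟩
  have hB := hκ.nonneg
  set P := (List.ofFn fun i => π.op η (κ' i) 0).prod with hP
  refine ContinuousLinearMap.opNorm_le_bound _ (by positivity) fun v => ?_
  have hw := integrable_op_weight hη hκ.integrable
  have hg := measurable_dil_add G t
  have hw0 : ∫ p : 𝔼 n × ℝ, κ p.1 * η p.2 = 0 := by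
    rw [Measure.volume_eq_prod, integral_prod_mul, hmean, zero_mul]
  have hsub : (π.op η κ t * P) v = ∫ p : 𝔼 n × ℝ, (κ p.1 * η p.2) •
      ((π (G.dil (t + p.2) p.1) - 1) * P) v := by
    have h1 : ∫ p : 𝔼 n × ℝ, (κ p.1 * η p.2) • P v = 0 := by
      rw [integral_smul_const, hw0, zero_smul]
    rw [mul_apply_eq_comp, π.op_apply hη hκ.integrable, ← sub_zero (∫ p : 𝔼 n × ℝ, _), ← h1,
      ← integral_sub (π.integrable_smul hw hg _) (hw.smul_const _)]
    refine integral_congr_ae (Eventually.of_forall fun p => ?_)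
    simp only [mul_apply_eq_comp, sub_apply, one_apply_eq_self, smul_sub]
  set D := (C + 2 * β ^ n) * B ^ n * (Real.exp (a * t) * R') ^ ε * ‖v‖ with hD
  have hD0 : 0 ≤ D := by positivity
  rw [hsub]
  have hint : ∫ p : 𝔼 n × ℝ, |κ p.1 * η p.2| ≤ B * V * 2 := by
    simp only [abs_mul]
    rw [Measure.volume_eq_prod, integral_prod_mul (fun x => |κ x|) (fun t => |η t|)]
    exact mul_le_mul (hκ.integral_abs_le.trans_eq (by rw [hV])) hη.integral_abs_le
      (integral_nonneg fun _ => abs_nonneg _) (by positivity)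
  calc _ ≤ ∫ p : 𝔼 n × ℝ, |κ p.1 * η p.2| * D := by
        refine norm_integral_le_of_norm_le (hw.abs.mul_const D) (Eventually.of_forall fun p => ?_)
        rw [norm_smul, Real.norm_eq_abs]
        by_cases hp : |p.2| ≤ 1 ∧ ‖p.1‖ ≤ R
        · refine mul_le_mul_of_nonneg_left ?_ (abs_nonneg _)
          have h1 : ‖G.dil (t + p.2) p.1‖ ≤ Real.exp (a * t) * R' := by
            rw [← G.dil_dil]
            exact (hdil t ht _).trans (mul_le_mul_of_nonneg_left
              (hdil' _ (abs_le.1 hp.1).2 _ hp.2) (Real.exp_pos _).le)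
          refine (ContinuousLinearMap.le_opNorm _ _).trans
            (mul_le_mul_of_nonneg_right ?_ (norm_nonneg v))
          refine (hkey2 π κ' B hB hκ' _).trans ?_
          gcongr
        · have : κ p.1 * η p.2 = 0 := by
            rw [not_and_or, not_le, not_le] at hp
            rcases hp with hp | hp
            · rw [hη.eq_zero _ hp, mul_zero]
            · rw [hκ.eq_zero _ hp, zero_mul]
          rw [this]; simp
    _ = (∫ p : 𝔼 n × ℝ, |κ p.1 * η p.2|) * D := integral_mul_const _ _
    _ ≤ (B * V * 2) * D := mul_le_mul_of_nonneg_right hint hD0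
    _ = _ := by
      rw [hD, Real.mul_rpow (Real.exp_pos _).le hR'.le, ← Real.exp_mul,
        show a * t * ε = a * ε * t by ring]
      ring

/-- Averages at different scales almost annihilate each other. The `T T⋆` iteration replaces the
second factor by the product of `n` averages needed for smoothing. -/
theorem exists_norm_op_mul_op_le (hη : IsCutoff η) (R : ℝ) : ∃ C c : ℝ, 0 < C ∧ 0 < c ∧
    ∀ (π : UnitaryRep G H) (κ κ' : 𝔼 n → ℝ) (B : ℝ), 0 < B → IsBddKernel B R κ →
      IsBddKernel B R κ' → IsBddKernel B R (fun x => κ' (G.inv x)) → ∫ x, κ x = 0 →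
        ∀ s t, s ≤ t → ‖π.op η κ s * π.op η κ' t‖ ≤ C * B ^ 2 * Real.exp (c * (s - t)) := by
  obtain ⟨C, c, hC, hc, hmul⟩ := exists_norm_op_mul_prod_le (G := G) (H := H) hη R
  obtain ⟨V, hV⟩ : ∃ V, V = volume.real (Metric.closedBall (0 : 𝔼 n) R) := ⟨_, rfl⟩
  have hV0 : 0 ≤ V := hV ▸ measureReal_nonneg
  obtain ⟨β, hβ⟩ : ∃ β, β = 2 * (V + 1) := ⟨_, rfl⟩
  have hβ0 : 0 < β := by rw [hβ]; positivity
  have hop : ∀ (π : UnitaryRep G H) (κ : 𝔼 n → ℝ) (B : ℝ), IsBddKernel B R κ → ∀ t,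
      ‖π.op η κ t‖ ≤ β * B := fun π κ B hκ t => by
    rw [hβ, hV]; exact π.norm_op_le_of_isBddKernel hη hκ t
  set p := 2 * 2 ^ n with hp
  have hnp : n ≤ p := by have := Nat.lt_two_pow_self (n := n); omega
  have hp0 : p ≠ 0 := by positivity
  set r := p - n with hr
  have hrp : n + r = p := by omega
  set D := C * β ^ r * β ^ p / β + 1 with hD
  have hD1 : 1 ≤ D := by rw [hD]; linarith [show 0 ≤ C * β ^ r * β ^ p / β by positivity]
  refine ⟨D, c / p, by positivity, by positivity,
    fun π κ κ' B hB hκ hκ' hκi hmean s t hst => ?_⟩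
  rw [show s = t + (s - t) by ring, ← π.op_scale hη hκ.integrable (s - t) t]
  have ht0 := π.op_scale hη hκ'.integrable 0 t
  rw [add_zero] at ht0
  rw [← ht0, show t + (s - t) - t = s - t by ring]
  set σ := π.scale t
  set U := σ.op η κ (s - t)
  set S := σ.op η κ' 0
  have hstar : star S = σ.op η (fun x => κ' (G.inv x)) 0 := by
    rw [ContinuousLinearMap.star_eq_adjoint]; exact σ.adjoint_op hη hκ'.integrable 0
  have hU : ‖U‖ ≤ β * B := hop σ _ _ hκ _
  have hS : ‖S‖ ≤ β * B := hop σ _ _ hκ' _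
  obtain ⟨W, hW, hWb⟩ := AlmostOrthogonal.exists_mul_pow_eq_prod_mul
    ContinuousLinearMap.norm_id_le S (star S) hS ((norm_star S).trans_le hS) n r (2 ^ n) hrp
  have hiter := AlmostOrthogonal.norm_mul_pow_le U S (by positivity) hU n
  rw [← hp, hW, ← mul_assoc U] at hiter
  have hlist : (fun i : Fin n => if Even i.val then S else star S) = fun i : Fin n =>
      σ.op η (if Even i.val then κ' else fun x => κ' (G.inv x)) 0 := by
    ext1 i
    split_ifs
    · rfl
    · exact hstar
  have hprod := hmul σ κ (fun i => if Even i.val then κ' else fun x => κ' (G.inv x)) B hκ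
    (fun i => by split_ifs <;> assumption) hmean (s - t) (by linarith)
  rw [hlist] at hiter
  have hexp : Real.exp (c * (s - t)) = Real.exp (c / p * (s - t)) ^ p := by
    rw [← Real.exp_nat_mul]
    congr 1
    field_simp
  have hmain : ‖U * S‖ ^ p * (β * B) ≤
      (C * B ^ (n + 1) * Real.exp (c * (s - t)) * (β * B) ^ r) * (β * B) ^ p := by
    refine hiter.trans (mul_le_mul_of_nonneg_right ?_ (by positivity))
    exact (norm_mul_le _ _).trans (mul_le_mul hprod hWb (norm_nonneg _) (by positivity))
  have hpow : ‖U * S‖ ^ p ≤ (D * B ^ 2 * Real.exp (c / p * (s - t))) ^ p := by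
    have h1 : ‖U * S‖ ^ p ≤
        (C * β ^ r * β ^ p / β) * (B ^ 2) ^ p * Real.exp (c * (s - t)) := by
      refine le_of_mul_le_mul_right (hmain.trans_eq ?_) (show 0 < β * B by positivity)
      have hBp : B ^ (n + 1) * B ^ r * B ^ p = (B ^ 2) ^ p * B := by
        rw [← pow_mul, ← pow_succ, ← pow_add, ← pow_add]
        congr 1
        omega
      calc _ = C * β ^ r * β ^ p * (B ^ (n + 1) * B ^ r * B ^ p) * Real.exp (c * (s - t)) := by
            rw [mul_pow, mul_pow]; ring
        _ = _ := by rw [hBp]; field_simp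
    refine h1.trans ?_
    rw [mul_pow _ (Real.exp _), mul_pow D, ← hexp]
    have h2 : C * β ^ r * β ^ p / β ≤ D ^ p :=
      (show C * β ^ r * β ^ p / β ≤ D by rw [hD]; linarith).trans (le_self_pow₀ hD1 hp0)
    gcongr
  exact le_of_pow_le_pow_left₀ hp0 (by positivity) hpow

end UnitaryRep

theorem summable_exp_neg_mul_abs {c : ℝ} (hc : 0 < c) :
    Summable fun k : ℤ => Real.exp (-(c * |(k : ℝ)|)) := by
  have h : Summable fun k : ℕ => Real.exp (-(c * (k : ℝ))) := by
    have := summable_geometric_of_lt_one (Real.exp_pos (-c)).le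
      (Real.exp_lt_one_iff.2 (by linarith))
    refine this.congr fun k => ?_
    rw [← Real.exp_nat_mul]
    congr 1; ring
  exact Summable.of_nat_of_neg (by simpa using h) (by simpa using h)

theorem sum_fin_sub_le_tsum {g : ℤ → ℝ} (hg : ∀ k, 0 ≤ g k) (hs : Summable g) (m : ℕ)
    (i : Fin m) : ∑ j : Fin m, g ((i : ℤ) - (j : ℤ)) ≤ ∑' k, g k := by
  have hinj : Function.Injective fun j : Fin m => (i : ℤ) - (j : ℤ) := fun j k h => by
    ext; simp only at h; omega
  have := hs.sum_le_tsum (Finset.univ.map ⟨_, hinj⟩) fun k _ => hg k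
  rwa [Finset.sum_map] at this

namespace UnitaryRep

variable {n : ℕ} {G : HomogeneousGroup n} {H : Type*} [NormedAddCommGroup H]
  [InnerProductSpace ℝ H] [CompleteSpace H] {η : ℝ → ℝ}

/-- The sum over the dyadic scales of the averages of a bounded mean zero kernel. The scales at
distance at most `L` are controlled by the `L¹` norm only; the dependence on the supremum `B` of
the kernel is exponentially small in `L`. -/
theorem exists_norm_sum_op_le (hη : IsCutoff η) (R : ℝ) : ∃ C c : ℝ, 0 < C ∧ 0 < c ∧
    ∀ (π : UnitaryRep G H) (κ : 𝔼 n → ℝ) (B : ℝ), 0 < B → IsBddKernel B R κ →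
      IsBddKernel B R (fun x => κ (G.inv x)) → ∫ x, κ x = 0 → ∀ (L m : ℕ) (t : ℝ),
        ‖∑ j ∈ Finset.range m, π.op η κ (t + j)‖ ≤
          C * ((L + 1) * (∫ x, |κ x|) + B * Real.exp (-(c * L))) := by
  obtain ⟨C, c, hC, hc, hop⟩ := exists_norm_op_mul_op_le (G := G) (H := H) hη R
  have hc4 : 0 < c / 4 := by positivity
  obtain ⟨D, hD⟩ : ∃ D, D = ∑' k : ℤ, Real.exp (-(c / 4 * |(k : ℝ)|)) := ⟨_, rfl⟩
  have hDs := summable_exp_neg_mul_abs hc4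
  have hD0 : 0 ≤ D := hD ▸ tsum_nonneg fun k => (Real.exp_pos _).le
  refine ⟨√C * D + 4, c / 4, by positivity, hc4, fun π κ B hB hκ hκi hmean L m t => ?_⟩
  obtain ⟨a, ha⟩ : ∃ a, a = ∫ x, |κ x| := ⟨_, rfl⟩
  have ha0 : 0 ≤ a := ha ▸ integral_nonneg fun x => abs_nonneg _
  have hmp := G.measurePreserving_inv
  have hinve : MeasurableEmbedding G.inv :=
    (Homeomorph.mk ⟨G.inv, G.inv, G.inv_inv, G.inv_inv⟩ G.contDiff_inv.continuous
      G.contDiff_inv.continuous).measurableEmbedding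
  have hmean' : ∫ x, κ (G.inv x) = 0 := by rw [hmp.integral_comp hinve, hmean]
  have ha' : ∫ x, |κ (G.inv x)| = a := by
    rw [ha, ← hmp.integral_comp hinve (fun x => |κ x|)]
  have hinvinv : (fun x => κ (G.inv (G.inv x))) = κ := by ext1 x; rw [G.inv_inv]
  have hnorm : ∀ s, ‖π.op η κ s‖ ≤ 2 * a := fun s => by
    rw [ha]; exact π.norm_op_le hη hκ.integrable s
  have hnorm' : ∀ s, ‖π.op η (fun x => κ (G.inv x)) s‖ ≤ 2 * a := fun s => by
    rw [← ha']; exact π.norm_op_le hη hκi.integrable s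
  have hstar : ∀ s, star (π.op η κ s) = π.op η (fun x => κ (G.inv x)) s := fun s => by
    rw [ContinuousLinearMap.star_eq_adjoint]; exact π.adjoint_op hη hκ.integrable s
  have hfar : ∀ s u, ‖star (π.op η κ s) * π.op η κ u‖ ≤ C * B ^ 2 * Real.exp (-(c * |s - u|)) ∧
      ‖π.op η κ s * star (π.op η κ u)‖ ≤ C * B ^ 2 * Real.exp (-(c * |s - u|)) := by
    have h1 : ∀ s u, s ≤ u → ‖star (π.op η κ s) * π.op η κ u‖ ≤
        C * B ^ 2 * Real.exp (-(c * |s - u|)) ∧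
        ‖π.op η κ s * star (π.op η κ u)‖ ≤ C * B ^ 2 * Real.exp (-(c * |s - u|)) := by
      intro s u hsu
      have e : -(c * |s - u|) = c * (s - u) := by
        rw [abs_of_nonpos (by linarith)]; ring
      rw [e, hstar, hstar]
      exact ⟨hop π _ κ B hB hκi hκ hκi hmean' s u hsu,
        hop π κ _ B hB hκ hκi (by rwa [hinvinv]) hmean s u hsu⟩
    intro s u
    rcases le_total s u with h | h
    · exact h1 s u h
    · have h2 := h1 u s h
      rw [← norm_star (star _ * _), ← norm_star (_ * star _), star_mul, star_mul, star_star,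
        star_star, abs_sub_comm]
      exact h2
  -- for near scales the trivial bound `2 a`, for far ones half of the exponential decay, the other
  -- half being split between the gain in `L` and summability
  let g : ℤ → ℝ := fun k => (Finset.Icc (-(L : ℤ)) L : Set ℤ).indicator (fun _ => 2 * a) k +
    √C * B * Real.exp (-(c / 4 * L)) * Real.exp (-(c / 4 * |(k : ℝ)|))
  have hg0 : ∀ k, 0 ≤ g k := fun k =>
    add_nonneg (Set.indicator_nonneg (fun _ _ => by positivity) _) (by positivity)
  have hg1 : ∀ k : ℤ, |k| ≤ L → 2 * a ≤ g k := fun k hk => by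
    have hk' : k ∈ (Finset.Icc (-(L : ℤ)) L : Set ℤ) := by
      simpa using abs_le.1 hk
    simp only [g, Set.indicator_of_mem hk']
    have : 0 ≤ √C * B * Real.exp (-(c / 4 * L)) * Real.exp (-(c / 4 * |(k : ℝ)|)) := by positivity
    linarith
  have hg2 : ∀ k : ℤ, (L : ℤ) ≤ |k| → √C * B * Real.exp (-(c / 2 * |(k : ℝ)|)) ≤ g k :=
      fun k hk => by
    have hk' : (L : ℝ) ≤ |(k : ℝ)| := by exact_mod_cast hk
    have h0 : 0 ≤ (Finset.Icc (-(L : ℤ)) L : Set ℤ).indicator (fun _ => 2 * a) k :=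
      Set.indicator_nonneg (fun _ _ => by positivity) _
    have h1 : Real.exp (-(c / 2 * |(k : ℝ)|)) ≤
        Real.exp (-(c / 4 * L)) * Real.exp (-(c / 4 * |(k : ℝ)|)) := by
      rw [← Real.exp_add]
      refine Real.exp_le_exp.2 ?_
      nlinarith
    have h2 : 0 ≤ √C * B := by positivity
    simp only [g]
    nlinarith [mul_le_mul_of_nonneg_left h1 h2]
  have hgs : HasSum g ((2 * L + 1) * (2 * a) + √C * B * Real.exp (-(c / 4 * L)) * D) := by
    refine HasSum.add ?_ (hD ▸ hDs.hasSum.mul_left _)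
    have h1 := hasSum_sum_of_ne_finset_zero (L := SummationFilter.unconditional ℤ)
      (s := Finset.Icc (-(L : ℤ)) L)
      (f := (Finset.Icc (-(L : ℤ)) L : Set ℤ).indicator (fun _ => 2 * a))
      fun k hk => Set.indicator_of_notMem (by simpa using hk) _
    convert h1 using 1
    rw [Finset.sum_congr rfl fun k hk => Set.indicator_of_mem (by simpa using hk) _]
    simp only [Finset.sum_const, Int.card_Icc, nsmul_eq_mul]
    have : ((L : ℤ) + 1 - -(L : ℤ)).toNat = 2 * L + 1 := by omega
    rw [this]; push_cast; ring
  have hgb : ∀ (i j : Fin m) (A : H →L[ℝ] H), ‖A‖ ≤ (2 * a) * (2 * a) →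
      ‖A‖ ≤ C * B ^ 2 * Real.exp (-(c * |t + (i : ℕ) - (t + (j : ℕ))|)) →
      ‖A‖ ≤ g ((i : ℤ) - (j : ℤ)) ^ 2 := by
    intro i j A hA1 hA2
    rcases le_total |(i : ℤ) - (j : ℤ)| L with h | h
    · refine hA1.trans ?_
      rw [← sq]
      exact pow_le_pow_left₀ (by positivity) (hg1 _ h) 2
    · refine hA2.trans (le_trans (le_of_eq ?_) (pow_le_pow_left₀ (by positivity) (hg2 _ h) 2))
      rw [mul_pow, mul_pow, Real.sq_sqrt hC.le, ← Real.exp_nat_mul]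
      congr 2
      push_cast
      rw [show t + (i : ℝ) - (t + (j : ℝ)) = (i : ℝ) - j by ring]
      ring
  have hcs := AlmostOrthogonal.norm_sum_le_of_almostOrthogonal
    (fun j : Fin m => π.op η κ (t + (j : ℕ))) (γ := fun i j => g ((i : ℤ) - (j : ℤ)))
    (fun i j => hg0 _) (tsum_nonneg hg0) (sum_fin_sub_le_tsum hg0 hgs.summable m)
    (fun i j => hgb i j _ ((norm_mul_le _ _).trans (mul_le_mul
      (by rw [norm_star]; exact hnorm _) (hnorm _) (norm_nonneg _) (by positivity))) (hfar _ _).1)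
    (fun i j => hgb i j _ ((norm_mul_le _ _).trans (mul_le_mul (hnorm _)
      (by rw [norm_star]; exact hnorm _) (norm_nonneg _) (by positivity))) (hfar _ _).2)
  rw [Finset.sum_range, ← ha]
  refine hcs.trans ?_
  rw [hgs.tsum_eq]
  have e1 : 0 ≤ B * Real.exp (-(c / 4 * L)) := by positivity
  have e2 : 0 ≤ (L + 1) * a := by positivity
  have e3 : 0 ≤ √C * D := by positivity
  nlinarith [mul_nonneg e3 e2]

end UnitaryRep

/-! ### The `L log L` decomposition -/

theorem MemLLogL.integrable {X : Type*} [MeasurableSpace X] {μ : Measure X} {f : X → ℝ}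
    (hf : MemLLogL f μ) : Integrable f μ := by
  have hl2 : 0 < Real.log 2 := Real.log_pos one_lt_two
  refine (hf.2.const_mul (Real.log 2)⁻¹).mono' hf.1 (Eventually.of_forall fun x => ?_)
  rw [Real.norm_eq_abs, inv_mul_eq_div, le_div_iff₀ hl2]
  exact mul_le_mul_of_nonneg_left
    (Real.log_le_log two_pos (by linarith [abs_nonneg (f x)])) (abs_nonneg _)

/-- The dyadic level of a real number: `k` if `2 ^ k ≤ |u| < 2 ^ (k + 1)`, and `0` if `|u| < 2`. -/
noncomputable def dyadicLevel (u : ℝ) : ℕ := Nat.log 2 ⌊|u|⌋₊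

/-- The part of `u` at dyadic level `k`: it is `u` or `0`. -/
noncomputable def levelPart (k : ℕ) (u : ℝ) : ℝ := if dyadicLevel u = k then u else 0

/-- The part of `u` at dyadic levels at least `N`: it is `u` or `0`. -/
noncomputable def levelTail (N : ℕ) (u : ℝ) : ℝ := if N ≤ dyadicLevel u then u else 0

theorem measurable_dyadicLevel : Measurable dyadicLevel :=
  (measurable_from_top (f := Nat.log 2)).comp (Nat.measurable_floor.comp measurable_norm)

theorem measurable_levelPart (k : ℕ) : Measurable (levelPart k) :=
  Measurable.ite (measurable_dyadicLevel (measurableSet_singleton k)) measurable_id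
    measurable_const

theorem measurable_levelTail (N : ℕ) : Measurable (levelTail N) :=
  Measurable.ite (measurable_dyadicLevel measurableSet_Ici) measurable_id measurable_const

theorem levelPart_zero (k : ℕ) : levelPart k 0 = 0 := ite_self 0

theorem levelTail_zero (N : ℕ) : levelTail N 0 = 0 := ite_self 0

theorem abs_levelPart_le (k : ℕ) (u : ℝ) : |levelPart k u| ≤ |u| := by
  rw [levelPart]; split_ifs <;> simp

theorem abs_levelTail_le (N : ℕ) (u : ℝ) : |levelTail N u| ≤ |u| := by
  rw [levelTail]; split_ifs <;> simp

theorem abs_levelPart_le_two_pow (k : ℕ) (u : ℝ) : |levelPart k u| ≤ 2 ^ (k + 1) := by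
  rw [levelPart]
  split_ifs with h
  · have h1 : ⌊|u|⌋₊ < 2 ^ (k + 1) := by
      rw [← h]; exact Nat.lt_pow_succ_log_self one_lt_two _
    have h2 := (Nat.floor_lt (abs_nonneg u)).1 h1
    push_cast at h2
    exact h2.le
  · simp

theorem sum_levelPart_add_levelTail (N : ℕ) (u : ℝ) :
    ∑ k ∈ Finset.range N, levelPart k u + levelTail N u = u := by
  simp only [levelPart, levelTail, Finset.sum_ite_eq, Finset.mem_range]
  split_ifs <;> first | omega | simp

theorem levelTail_eq_zero {N : ℕ} {u : ℝ} (h : dyadicLevel u < N) : levelTail N u = 0 :=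
  if_neg (not_le.2 h)

theorem succ_dyadicLevel_mul_log_two_le (u : ℝ) :
    (dyadicLevel u + 1) * Real.log 2 ≤ 2 * Real.log (2 + |u|) := by
  have h2 : Real.log 2 ≤ Real.log (2 + |u|) :=
    Real.log_le_log two_pos (by linarith [abs_nonneg u])
  have h1 : dyadicLevel u * Real.log 2 ≤ Real.log (2 + |u|) := by
    rw [← Real.log_pow]
    refine Real.log_le_log (by positivity) ?_
    rcases eq_or_ne ⌊|u|⌋₊ 0 with h0 | h0
    · rw [dyadicLevel, h0]; simp; linarith [abs_nonneg u]
    · have h3 := (Nat.cast_le (α := ℝ)).2 (Nat.pow_log_le_self 2 h0)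
      push_cast at h3
      exact h3.trans ((Nat.floor_le (abs_nonneg u)).trans (by linarith))
  linarith

/-- The weights `k + 1` on the dyadic levels are dominated by the logarithm. -/
theorem sum_succ_mul_abs_levelPart_le (N : ℕ) (u : ℝ) :
    ∑ k ∈ Finset.range N, ((k : ℝ) + 1) * |levelPart k u| ≤
      2 / Real.log 2 * (|u| * Real.log (2 + |u|)) := by
  have hl : 0 < Real.log 2 := Real.log_pos one_lt_two
  have h0 : (0 : ℝ) ≤ (dyadicLevel u + 1) * |u| := by positivity
  calc _ = ∑ k ∈ Finset.range N, if dyadicLevel u = k then ((dyadicLevel u : ℝ) + 1) * |u| else 0 :=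
        Finset.sum_congr rfl fun k _ => by
          rw [levelPart]; split_ifs with h
          · rw [h]
          · simp
    _ ≤ (dyadicLevel u + 1) * |u| := by
        rw [Finset.sum_ite_eq]; split_ifs
        · exact le_rfl
        · exact h0
    _ ≤ _ := by
        have := succ_dyadicLevel_mul_log_two_le u
        rw [div_mul_eq_mul_div, le_div_iff₀ hl]
        nlinarith [abs_nonneg u]

/-- The function `φ` minus a multiple of the indicator of `A`, so that a function `φ` vanishing
off `A` acquires mean zero. If `A` has measure zero, then the quotient is `0`, and such a function
has mean zero already. -/
noncomputable def center {X : Type*} [MeasureSpace X] (A : Set X) (φ : X → ℝ) (x : X) : ℝ :=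
  φ x - (∫ y, φ y) / volume.real A * A.indicator 1 x

section center

variable {X : Type*} [MeasureSpace X] {A : Set X} {φ : X → ℝ}

theorem integral_div_measureReal_mul (hA : volume A ≠ ⊤) (hφ : ∀ x, x ∉ A → φ x = 0) :
    (∫ y, φ y) / volume.real A * volume.real A = ∫ y, φ y := by
  rcases eq_or_ne (volume.real A) 0 with h | h
  · rw [← setIntegral_eq_integral_of_forall_compl_eq_zero hφ,
      setIntegral_measure_zero _ ((measureReal_eq_zero_iff hA).1 h), zero_div, zero_mul]
  · rw [div_mul_cancel₀ _ h]

theorem center_eq_zero (hφ : ∀ x, x ∉ A → φ x = 0) {x : X} (hx : x ∉ A) : center A φ x = 0 := by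
  rw [center, hφ x hx, Set.indicator_of_notMem hx]; simp

theorem center_of_integral_eq_zero (h : ∫ x, φ x = 0) : center A φ = φ := by
  ext x; simp [center, h]

theorem abs_center_le (hA : volume A ≠ ⊤) (hφ : ∀ x, x ∉ A → φ x = 0) {M : ℝ}
    (hM : ∀ x, |φ x| ≤ M) (x : X) : |center A φ x| ≤ 2 * M := by
  have hM0 : 0 ≤ M := (abs_nonneg _).trans (hM x)
  have h1 : |∫ y, φ y| ≤ M * volume.real A := by
    rw [← setIntegral_eq_integral_of_forall_compl_eq_zero hφ]
    exact norm_setIntegral_le_of_norm_le_const (f := φ) (lt_top_iff_ne_top.2 hA) fun x _ => hM x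
  have h2 : |(∫ y, φ y) / volume.real A| ≤ M := by
    rw [abs_div, abs_of_nonneg (measureReal_nonneg (μ := volume) (s := A))]
    exact div_le_of_le_mul₀ measureReal_nonneg hM0 h1
  have h3 : |A.indicator (1 : X → ℝ) x| ≤ 1 := by
    by_cases hx : x ∈ A <;> simp [hx]
  have h4 : |(∫ y, φ y) / volume.real A * A.indicator (1 : X → ℝ) x| ≤ M * 1 := by
    rw [abs_mul]; exact mul_le_mul h2 h3 (abs_nonneg _) hM0
  calc _ ≤ |φ x| + |(∫ y, φ y) / volume.real A * A.indicator (1 : X → ℝ) x| := abs_sub _ _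
    _ ≤ _ := by linarith [hM x]

theorem integrable_const_mul_indicator (hAm : MeasurableSet A) (hA : volume A ≠ ⊤) (c : ℝ) :
    Integrable fun x => c * A.indicator (1 : X → ℝ) x :=
  ((integrable_indicator_iff hAm).2 (integrableOn_const hA)).const_mul c

theorem integrable_center (hAm : MeasurableSet A) (hA : volume A ≠ ⊤) (hi : Integrable φ) :
    Integrable (center A φ) :=
  hi.sub (integrable_const_mul_indicator hAm hA _)

theorem integral_center (hAm : MeasurableSet A) (hA : volume A ≠ ⊤) (hi : Integrable φ)
    (hφ : ∀ x, x ∉ A → φ x = 0) : ∫ x, center A φ x = 0 := by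
  simp only [center]
  rw [integral_sub hi (integrable_const_mul_indicator hAm hA _), integral_const_mul,
    integral_indicator_one hAm, integral_div_measureReal_mul hA hφ, sub_self]

theorem integral_abs_center_le (hAm : MeasurableSet A) (hA : volume A ≠ ⊤) (hi : Integrable φ)
    (hφ : ∀ x, x ∉ A → φ x = 0) : ∫ x, |center A φ x| ≤ 2 * ∫ x, |φ x| := by
  have hle : |∫ y, φ y| ≤ ∫ y, |φ y| := abs_integral_le_integral_abs
  calc ∫ x, |center A φ x| ≤ ∫ x, (|φ x| + |∫ y, φ y| / volume.real A * A.indicator 1 x) := by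
        refine integral_mono (integrable_center hAm hA hi).abs
          (hi.abs.add (integrable_const_mul_indicator hAm hA _)) fun x => ?_
        refine (abs_sub _ _).trans (add_le_add le_rfl (le_of_eq ?_))
        rw [abs_mul, abs_div, abs_of_nonneg (measureReal_nonneg (μ := volume) (s := A)),
          abs_of_nonneg (Set.indicator_nonneg (f := (1 : X → ℝ)) (fun _ _ => zero_le_one' ℝ) x)]
    _ = (∫ x, |φ x|) + |∫ y, φ y| := by
        rw [integral_add hi.abs (integrable_const_mul_indicator hAm hA _), integral_const_mul,
          integral_indicator_one hAm, ← abs_of_nonneg (measureReal_nonneg (μ := volume) (s := A)),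
          ← abs_div, ← abs_mul, integral_div_measureReal_mul hA hφ]
    _ ≤ _ := by linarith

theorem center_add {ψ : X → ℝ} (hφ : Integrable φ) (hψ : Integrable ψ) :
    center A (fun x => φ x + ψ x) = fun x => center A φ x + center A ψ x := by
  ext x
  simp only [center]
  rw [integral_add hφ hψ]; ring

theorem center_sum {ι : Type*} (S : Finset ι) (f : ι → X → ℝ) (hf : ∀ i, Integrable (f i)) :
    center A (fun x => ∑ i ∈ S, f i x) = fun x => ∑ i ∈ S, center A (f i) x := by
  ext x
  simp only [center]
  rw [integral_finsetSum S fun i _ => hf i, Finset.sum_sub_distrib, ← Finset.sum_mul,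
    Finset.sum_div]

end center

namespace UnitaryRep

variable {n : ℕ} {G : HomogeneousGroup n} {H : Type*} [NormedAddCommGroup H]
  [InnerProductSpace ℝ H] [CompleteSpace H] {η : ℝ → ℝ}

/-- The `L²` bound for a mean zero kernel in `L log L`. The part of the kernel at dyadic level `k`
is treated with `L` proportional to `k + 1` scales, which costs `k + 1` times its `L¹` norm, and
these costs sum up to the `L log L` norm. -/
theorem exists_norm_sum_op_le_of_memLLogL (hη : IsCutoff η) {R : ℝ} {A : Set (𝔼 n)}
    (hAm : MeasurableSet A) (hAR : ∀ x ∈ A, ‖x‖ ≤ R) (hAR' : ∀ x, G.inv x ∈ A → ‖x‖ ≤ R)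
    {K : 𝔼 n → ℝ} (hKA : ∀ x, x ∉ A → K x = 0) (hlog : MemLLogL K volume) (hK0 : ∫ x, K x = 0) :
    ∃ M : ℝ, 0 ≤ M ∧ ∀ (π : UnitaryRep G H) (m : ℕ) (t : ℝ),
      ‖∑ j ∈ Finset.range m, π.op η K (t + j)‖ ≤ M := by
  obtain ⟨C, c, hC, hc, hop⟩ := exists_norm_sum_op_le (G := G) (H := H) hη R
  have hA : volume A ≠ ⊤ := ne_top_of_le_ne_top
    (measure_closedBall_lt_top (μ := volume) (x := (0 : 𝔼 n)) (r := R)).ne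
    (measure_mono fun x hx => by simpa using hAR x hx)
  have hKi := hlog.integrable
  let φ : ℕ → 𝔼 n → ℝ := fun k x => levelPart k (K x)
  let τ : ℕ → 𝔼 n → ℝ := fun N x => levelTail N (K x)
  have hφi : ∀ k, Integrable (φ k) := fun k => hKi.norm.mono'
    ((measurable_levelPart k).comp_aemeasurable hKi.aemeasurable).aestronglyMeasurable
    (Eventually.of_forall fun x => abs_levelPart_le k (K x))
  have hτi : ∀ N, Integrable (τ N) := fun N => hKi.norm.mono'
    ((measurable_levelTail N).comp_aemeasurable hKi.aemeasurable).aestronglyMeasurable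
    (Eventually.of_forall fun x => abs_levelTail_le N (K x))
  have hφA : ∀ k x, x ∉ A → φ k x = 0 := fun k x hx => by
    simp only [φ, hKA x hx, levelPart_zero]
  have hτA : ∀ N x, x ∉ A → τ N x = 0 := fun N x hx => by
    simp only [τ, hKA x hx, levelTail_zero]
  have hci : ∀ k, Integrable (center A (φ k)) := fun k => integrable_center hAm hA (hφi k)
  have hti : ∀ N, Integrable (center A (τ N)) := fun N => integrable_center hAm hA (hτi N)
  have hB : ∀ k, ∀ x, |center A (φ k) x| ≤ 2 * 2 ^ (k + 1) := fun k =>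
    abs_center_le hA (hφA k) fun x => abs_levelPart_le_two_pow k (K x)
  have hker : ∀ k, IsBddKernel (2 * 2 ^ (k + 1)) R (center A (φ k)) := fun k =>
    ⟨(hci k).aestronglyMeasurable, hB k, fun x hx =>
      center_eq_zero (hφA k) fun hxA => (hAR x hxA).not_gt hx⟩
  have hker' : ∀ k, IsBddKernel (2 * 2 ^ (k + 1)) R (fun x => center A (φ k) (G.inv x)) :=
    fun k => ⟨(hci k).aestronglyMeasurable.comp_measurePreserving G.measurePreserving_inv,
      fun x => hB k _, fun x hx =>
      center_eq_zero (hφA k) fun hxA => (hAR' x hxA).not_gt hx⟩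
  -- with `L = l (k + 1)` the factor `exp (-c L)` beats the bound `2 ^ (k + 2)` of the `k`-th part
  obtain ⟨l, hl⟩ : ∃ l : ℕ, Real.exp (-(c * l)) ≤ 1 / 4 := by
    obtain ⟨l, hl⟩ := exists_nat_ge (Real.log 4 / c)
    refine ⟨l, ?_⟩
    rw [div_le_iff₀ hc] at hl
    rw [one_div, Real.exp_neg]
    refine inv_anti₀ (by norm_num) ?_
    rw [← Real.log_le_iff_le_exp (by norm_num)]
    linarith
  set a : ℕ → ℝ := fun k => ∫ x, |φ k x| with ha
  have ha0 : ∀ k, 0 ≤ a k := fun k => integral_nonneg fun x => abs_nonneg _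
  set Λ := 2 / Real.log 2 * ∫ x, |K x| * Real.log (2 + |K x|) with hΛ
  have hsum : ∀ N, ∑ k ∈ Finset.range N, ((k : ℝ) + 1) * a k ≤ Λ := by
    intro N
    simp only [ha, hΛ]
    rw [← integral_const_mul, Finset.sum_congr rfl fun k _ => (integral_const_mul _ _).symm,
      ← integral_finsetSum _ fun k _ => ((hφi k).abs.const_mul _)]
    exact integral_mono (integrable_finsetSum _ fun k _ => ((hφi k).abs.const_mul _))
      (hlog.2.const_mul _) fun x => sum_succ_mul_abs_levelPart_le N (K x)
  have hΛ0 : 0 ≤ Λ := by simpa using hsum 0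
  have hpiece : ∀ (π : UnitaryRep G H) (m : ℕ) (t : ℝ) (k : ℕ),
      ‖∑ j ∈ Finset.range m, π.op η (center A (φ k)) (t + j)‖ ≤
        C * (2 * (l + 1) * ((k + 1) * a k) + (1 / 2) ^ k) := by
    intro π m t k
    refine (hop π _ _ (by positivity) (hker k) (hker' k) (integral_center hAm hA (hφi k) (hφA k))
      (l * (k + 1)) m t).trans (mul_le_mul_of_nonneg_left (add_le_add ?_ ?_) hC.le)
    · have h1 := integral_abs_center_le hAm hA (hφi k) (hφA k)
      have h2 : ((l * (k + 1) : ℕ) : ℝ) + 1 ≤ (l + 1) * (k + 1) := by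
        push_cast
        have : (0 : ℝ) ≤ k := Nat.cast_nonneg k
        nlinarith
      calc _ ≤ ((l : ℝ) + 1) * (k + 1) * (2 * a k) := mul_le_mul h2 h1
            (integral_nonneg fun _ => abs_nonneg _) (by positivity)
        _ = _ := by ring
    · have h3 : Real.exp (-(c * (l * (k + 1) : ℕ))) ≤ (1 / 4) ^ (k + 1) := by
        have : Real.exp (-(c * (l * (k + 1) : ℕ))) = Real.exp (-(c * l)) ^ (k + 1) := by
          rw [← Real.exp_nat_mul]
          congr 1
          push_cast; ring
        rw [this]
        exact pow_le_pow_left₀ (Real.exp_pos _).le hl _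
      calc _ ≤ 2 * 2 ^ (k + 1) * (1 / 4 : ℝ) ^ (k + 1) := by gcongr
        _ = 2 * (2 * (1 / 4) : ℝ) ^ (k + 1) := by rw [mul_pow]; ring
        _ = _ := by rw [pow_succ]; norm_num; ring
  have hdecomp : ∀ N, K = fun x => (∑ k ∈ Finset.range N, center A (φ k) x) + center A (τ N) x := by
    intro N
    have h1 : K = fun x => (∑ k ∈ Finset.range N, φ k x) + τ N x := by
      ext1 x; exact (sum_levelPart_add_levelTail N (K x)).symm
    conv_lhs => rw [← center_of_integral_eq_zero (A := A) hK0, h1]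
    rw [center_add (integrable_finsetSum _ fun k _ => hφi k) (hτi N),
      center_sum _ _ hφi]
  have htail : Tendsto (fun N => ∫ x, |τ N x|) atTop (𝓝 0) := by
    have : Tendsto (fun N => ∫ x, |τ N x|) atTop (𝓝 (∫ _x : 𝔼 n, (0 : ℝ))) := by
      refine tendsto_integral_of_dominated_convergence (fun x => |K x|)
        (fun N => (hτi N).abs.aestronglyMeasurable) hKi.abs
        (fun N => Eventually.of_forall fun x => ?_) (Eventually.of_forall fun x => ?_)
      · rw [Real.norm_eq_abs, abs_abs]; exact abs_levelTail_le N (K x)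
      · refine tendsto_const_nhds.congr' ?_
        filter_upwards [eventually_gt_atTop (dyadicLevel (K x))] with N hN
        simp only [τ, levelTail_eq_zero hN, abs_zero]
    simpa using this
  -- the tail only has to be negligible for a fixed number `m` of scales
  refine ⟨C * (2 * (l + 1) * Λ + 2), by positivity, fun π m t => ?_⟩
  have hN : ∀ N, ‖∑ j ∈ Finset.range m, π.op η K (t + j)‖ ≤
      C * (2 * (l + 1) * Λ + 2) + m * (2 * (2 * ∫ x, |τ N x|)) := by
    intro N
    have h1 : ∀ s, π.op η K s = ∑ k ∈ Finset.range N, π.op η (center A (φ k)) s +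
        π.op η (center A (τ N)) s := fun s => by
      conv_lhs => rw [hdecomp N]
      rw [π.op_add hη (integrable_finsetSum _ fun k _ => hci k) (hti N), π.op_sum hη _ _ hci]
    simp only [h1]
    rw [Finset.sum_add_distrib, Finset.sum_comm]
    refine (norm_add_le _ _).trans (add_le_add ?_ ?_)
    · calc _ ≤ ∑ k ∈ Finset.range N, C * (2 * (l + 1) * ((k + 1) * a k) + (1 / 2) ^ k) :=
            (norm_sum_le _ _).trans (Finset.sum_le_sum fun k _ => hpiece π m t k)
        _ = C * (2 * (l + 1) * ∑ k ∈ Finset.range N, ((k : ℝ) + 1) * a k +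
            ∑ k ∈ Finset.range N, (1 / 2 : ℝ) ^ k) := by
            rw [← Finset.mul_sum, Finset.sum_add_distrib, Finset.mul_sum]
        _ ≤ _ := by
            have := hsum N
            have h2 := sum_geometric_two_le N
            gcongr
    · calc _ ≤ ∑ _j ∈ Finset.range m, 2 * (2 * ∫ x, |τ N x|) :=
            (norm_sum_le _ _).trans (Finset.sum_le_sum fun j _ =>
              (π.norm_op_le hη (hti N) _).trans (mul_le_mul_of_nonneg_left
                (integral_abs_center_le hAm hA (hτi N) (hτA N)) zero_le_two))
        _ = _ := by simp
  refine ge_of_tendsto' (x := atTop) ?_ hN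
  simpa using ((htail.const_mul 2).const_mul 2 |>.const_mul (m : ℝ)).const_add
    (C * (2 * (l + 1) * Λ + 2))

end UnitaryRep

/-! ### Integrals against a homogeneous kernel in logarithmic polar coordinates -/

/-- The indicator of `1 ≤ e⁻ˢ r ≤ 2`. -/
noncomputable def radialWindow (s r : ℝ) : ℝ :=
  {p : ℝ × ℝ | 1 ≤ Real.exp (-p.1) * p.2 ∧ Real.exp (-p.1) * p.2 ≤ 2}.indicator 1 (s, r)

theorem radialWindow_eq_one {s r : ℝ} (h : 1 ≤ Real.exp (-s) * r ∧ Real.exp (-s) * r ≤ 2) :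
    radialWindow s r = 1 := Set.indicator_of_mem (s := {_p : ℝ × ℝ | _}) h _

theorem radialWindow_eq_zero {s r : ℝ} (h : ¬ (1 ≤ Real.exp (-s) * r ∧ Real.exp (-s) * r ≤ 2)) :
    radialWindow s r = 0 := Set.indicator_of_notMem (s := {_p : ℝ × ℝ | _}) h _

theorem measurable_radialWindow : Measurable fun p : ℝ × ℝ => radialWindow p.1 p.2 := by
  have h : Measurable fun p : ℝ × ℝ => Real.exp (-p.1) * p.2 := by fun_prop
  exact measurable_one.indicator
    ((measurableSet_le measurable_const h).inter (measurableSet_le h measurable_const))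

theorem radialWindow_eq_indicator {r : ℝ} (hr : 0 < r) (s : ℝ) : radialWindow s r =
    (Set.Icc (Real.log r - Real.log 2) (Real.log r)).indicator 1 s := by
  have h1 : (1 ≤ Real.exp (-s) * r ∧ Real.exp (-s) * r ≤ 2) ↔
      s ∈ Set.Icc (Real.log r - Real.log 2) (Real.log r) := by
    have e : Real.exp (-s) * r = Real.exp (Real.log r - s) := by
      rw [Real.exp_sub, Real.exp_log hr, Real.exp_neg]; ring
    rw [e, ← Real.log_le_iff_le_exp one_pos, Real.log_one, ← Real.le_log_iff_exp_le two_pos,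
      Set.mem_Icc]
    constructor <;> rintro ⟨h1, h2⟩ <;> constructor <;> linarith
  by_cases h : s ∈ Set.Icc (Real.log r - Real.log 2) (Real.log r)
  · rw [Set.indicator_of_mem h, radialWindow_eq_one (h1.2 h)]; rfl
  · rw [Set.indicator_of_notMem h, radialWindow_eq_zero fun h2 => h (h1.1 h2)]

/-- The integral of `m` over the set of those `s` for which `e⁻ˢ r` lies in `[1, 2]`. -/
noncomputable def windowIntegral (m : ℝ → ℝ) (r : ℝ) : ℝ := ∫ s, m s * radialWindow s r

theorem measurable_windowIntegral {m : ℝ → ℝ} (hm : Measurable m) :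
    Measurable (windowIntegral m) := by
  have h : Measurable fun p : ℝ × ℝ => m p.2 * radialWindow p.2 p.1 :=
    (hm.comp measurable_snd).mul (measurable_radialWindow.comp measurable_swap)
  exact (h.stronglyMeasurable.integral_prod_right').measurable

theorem windowIntegral_eq {r : ℝ} (hr : 0 < r) (m : ℝ → ℝ) : windowIntegral m r =
    ∫ s in Set.Icc (Real.log r - Real.log 2) (Real.log r), m s := by
  rw [← integral_indicator measurableSet_Icc, windowIntegral]
  congr 1
  ext1 s
  rw [radialWindow_eq_indicator hr]
  by_cases h : s ∈ Set.Icc (Real.log r - Real.log 2) (Real.log r) <;> simp [h]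

theorem abs_windowIntegral_le {m : ℝ → ℝ} (hm : ∀ s, |m s| ≤ 1) (r : ℝ) :
    |windowIntegral m r| ≤ Real.log 2 := by
  have hl := Real.log_nonneg one_le_two
  rcases le_or_gt r 0 with hr | hr
  · have : ∀ s, radialWindow s r = 0 := fun s => radialWindow_eq_zero fun h => by
      nlinarith [h.1, Real.exp_pos (-s)]
    simp [windowIntegral, this, hl]
  · rw [windowIntegral_eq hr]
    refine (norm_setIntegral_le_of_norm_le_const (f := m) measure_Icc_lt_top
      fun s _ => hm s).trans_eq ?_
    rw [Real.volume_real_Icc_of_le (by linarith)]; ring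

/-- If `m = 1` on the whole window of `r`, the integral is the length `log 2` of the window. -/
theorem windowIntegral_eq_log_two {m : ℝ → ℝ} {b r : ℝ} (hm : ∀ s, |s| ≤ b → m s = 1) (hr : 0 < r)
    (h1 : -b ≤ Real.log r - Real.log 2) (h2 : Real.log r ≤ b) :
    windowIntegral m r = Real.log 2 := by
  have hl := Real.log_nonneg one_le_two
  rw [windowIntegral_eq hr, setIntegral_congr_fun (g := fun _ => (1 : ℝ)) measurableSet_Icc
    fun s hs => hm s (abs_le.2 ⟨h1.trans hs.1, hs.2.trans h2⟩)]
  rw [setIntegral_const, Real.volume_real_Icc_of_le (by linarith)]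
  simp

theorem windowIntegral_eq_zero {m : ℝ → ℝ} {b r : ℝ} (hm : ∀ s, b < |s| → m s = 0)
    (h : r < Real.exp (-b)) : windowIntegral m r = 0 := by
  refine integral_eq_zero_of_ae (Eventually.of_forall fun s => ?_)
  simp only [Pi.zero_apply, mul_eq_zero]
  by_contra! hcon
  have hs : |s| ≤ b := by by_contra! h1; exact hcon.1 (hm s h1)
  refine hcon.2 (radialWindow_eq_zero fun h1 => ?_)
  have h2 : Real.exp (-s) * r < Real.exp (-s) * Real.exp (-b) :=
    mul_lt_mul_of_pos_left h (Real.exp_pos _)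
  rw [← Real.exp_add] at h2
  have h3 : Real.exp (-s + -b) ≤ 1 := Real.exp_le_one_iff.2 (by linarith [(abs_le.1 hs).1])
  linarith [h1.1]

/-- Every `r > 0` lies in the windows `e ^ s ∘ [1, 2]` for a set of `s` of length `log 2`. -/
theorem lintegral_radialWindow {r : ℝ} (hr : 0 < r) :
    ∫⁻ s, ENNReal.ofReal (radialWindow s r) = ENNReal.ofReal (Real.log 2) := by
  have h1 : ∀ s, ENNReal.ofReal (radialWindow s r) =
      (Set.Icc (Real.log r - Real.log 2) (Real.log r)).indicator 1 s := fun s => by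
    rw [radialWindow_eq_indicator hr]
    by_cases h : s ∈ Set.Icc (Real.log r - Real.log 2) (Real.log r) <;> simp [h]
  simp_rw [h1]
  rw [lintegral_indicator_one measurableSet_Icc, Real.volume_Icc]
  congr 1; ring

namespace HomogeneousGroup

variable {n : ℕ} {G : HomogeneousGroup n} {K : 𝔼 n → ℝ}

theorem IsHomogeneousKernel.apply_dil (hK : G.IsHomogeneousKernel K) (s : ℝ) {x : 𝔼 n}
    (hx : x ≠ 0) : K (G.dil s x) = Real.exp (-(s * G.homDim)) * K x := by
  rw [dil, hK _ (Real.exp_pos s) x hx, ← Real.exp_mul]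
  congr 2; ring

theorem ne_zero_of_mem_unitAnnulus {x : 𝔼 n} (hx : x ∈ G.unitAnnulus) : x ≠ 0 := by
  rintro rfl
  have := hx.1
  rw [G.rho_zero] at this
  linarith

variable (G) in
theorem radialWindow_rho (s : ℝ) (x : 𝔼 n) :
    radialWindow s (G.rho x) = G.unitAnnulus.indicator 1 (G.dil (-s) x) := by
  by_cases h : G.dil (-s) x ∈ G.unitAnnulus
  · rw [Set.indicator_of_mem h]
    refine radialWindow_eq_one ?_
    rw [← G.rho_dil]; exact h
  · rw [Set.indicator_of_notMem h]
    refine radialWindow_eq_zero fun h1 => h ?_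
    rw [← G.rho_dil] at h1; exact h1

/-- Measurability propagates from the unit annulus to the dyadic annuli, which cover all but `0`. -/
theorem IsHomogeneousKernel.aestronglyMeasurable (hK : G.IsHomogeneousKernel K)
    (hm : AEStronglyMeasurable K (volume.restrict G.unitAnnulus)) : AEStronglyMeasurable K := by
  let S : ℤ → Set (𝔼 n) := fun k => G.dil (-(k * Real.log 2)) ⁻¹' G.unitAnnulus
  have hS : ∀ k, MeasurableSet (S k) := fun k =>
    G.measurable_dil _ G.measurableSet_unitAnnulus
  have hqmp : ∀ s, Measure.QuasiMeasurePreserving (G.dil s) volume volume := fun s =>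
    ⟨G.measurable_dil s, by rw [G.map_dil]; exact Measure.smul_absolutelyContinuous⟩
  have hSm : ∀ k, AEStronglyMeasurable K (volume.restrict (S k)) := by
    intro k
    have h1 : AEStronglyMeasurable (G.unitAnnulus.indicator K) volume :=
      (aestronglyMeasurable_indicator_iff G.measurableSet_unitAnnulus).2 hm
    have h2 := (h1.comp_quasiMeasurePreserving (hqmp (-(k * Real.log 2)))).const_mul
      (Real.exp (-(k * Real.log 2 * G.homDim)))
    refine (h2.restrict (s := S k)).congr ?_
    filter_upwards [ae_restrict_mem (hS k)] with x hx
    have hx' : G.dil (-(k * Real.log 2)) x ∈ G.unitAnnulus := hx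
    change Real.exp (-(k * Real.log 2 * G.homDim)) *
      G.unitAnnulus.indicator K (G.dil (-(k * Real.log 2)) x) = K x
    rw [Set.indicator_of_mem hx', ← hK.apply_dil _ (ne_zero_of_mem_unitAnnulus hx'),
      G.dil_dil, add_neg_cancel, G.dil_zero_left]
  have h0 : AEStronglyMeasurable K (volume.restrict {0}) := by
    refine (aestronglyMeasurable_const (b := K 0)).congr ?_
    filter_upwards [ae_restrict_mem (measurableSet_singleton 0)] with x hx
    rw [Set.mem_singleton_iff.1 hx]
  have hcover : ({0} : Set (𝔼 n)) ∪ ⋃ k, S k = Set.univ := by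
    refine Set.eq_univ_of_forall fun x => ?_
    by_cases hx : x = 0
    · exact Or.inl hx
    · refine Or.inr (Set.mem_iUnion.2 ⟨⌊Real.log (G.rho x) / Real.log 2⌋, ?_⟩)
      have hl := Real.log_pos one_lt_two
      have hρ := G.rho_pos hx
      set k := ⌊Real.log (G.rho x) / Real.log 2⌋
      have h1 : (k : ℝ) * Real.log 2 ≤ Real.log (G.rho x) := (le_div_iff₀ hl).1 (Int.floor_le _)
      have h2 : Real.log (G.rho x) ≤ (k + 1) * Real.log 2 :=
        ((div_lt_iff₀ hl).1 (Int.lt_floor_add_one _)).le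
      have e : G.rho (G.dil (-(k * Real.log 2)) x) =
          Real.exp (Real.log (G.rho x) - k * Real.log 2) := by
        rw [G.rho_dil, Real.exp_sub, Real.exp_log hρ, Real.exp_neg]; ring
      refine ⟨?_, ?_⟩
      · rw [e]; exact Real.one_le_exp (by linarith)
      · rw [e, ← Real.le_log_iff_exp_le two_pos]; linarith
  rw [← Measure.restrict_univ (μ := (volume : Measure (𝔼 n))), ← hcover,
    aestronglyMeasurable_union_iff, aestronglyMeasurable_iUnion_iff]
  exact ⟨h0, hSm⟩

/-- A kernel that is integrable on the unit annulus is integrable against every function whose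
supremum over the annulus of radius `e ^ s` is integrable in `s`. -/
theorem IsHomogeneousKernel.integrable_mul (hK : G.IsHomogeneousKernel K)
    (hKm : AEStronglyMeasurable K) (hKA : IntegrableOn K G.unitAnnulus) {ψ : 𝔼 n → ℝ}
    (hψ : Measurable ψ) (hψ0 : ψ 0 = 0) {k : ℝ → ℝ} (hk : Integrable k)
    (hle : ∀ s, ∀ x ∈ G.unitAnnulus, |ψ (G.dil s x)| ≤ k s) :
    Integrable fun w => K w * ψ w := by
  have hm : AEStronglyMeasurable (fun w => K w * ψ w) := hKm.mul hψ.aestronglyMeasurable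
  refine ⟨hm, ?_⟩
  have hl : ENNReal.ofReal (Real.log 2) ≠ 0 := by
    simpa using Real.log_pos one_lt_two
  set Q : 𝔼 n → ENNReal := fun w => ‖K w * ψ w‖ₑ with hQ
  have hQm : AEMeasurable Q := hm.enorm
  have hWm : Measurable fun p : 𝔼 n × ℝ => ENNReal.ofReal (radialWindow p.2 (G.rho p.1)) :=
    (measurable_radialWindow.comp
      (measurable_snd.prodMk (G.measurable_rho.comp measurable_fst))).ennreal_ofReal
  have h1 : ∫⁻ w, Q w * ENNReal.ofReal (Real.log 2) =
      ∫⁻ w, ∫⁻ s, Q w * ENNReal.ofReal (radialWindow s (G.rho w)) := by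
    refine lintegral_congr fun w => ?_
    rw [lintegral_const_mul (μ := (volume : Measure ℝ)) (Q w)
      (f := fun s => ENNReal.ofReal (radialWindow s (G.rho w))) (hWm.comp measurable_prodMk_left)]
    by_cases hw : w = 0
    · simp [hQ, hw, hψ0]
    · rw [lintegral_radialWindow (G.rho_pos hw)]
  have h2 : ∫⁻ w, ∫⁻ s, Q w * ENNReal.ofReal (radialWindow s (G.rho w)) =
      ∫⁻ s, ∫⁻ w, Q w * ENNReal.ofReal (radialWindow s (G.rho w)) :=
    lintegral_lintegral_swap (hQm.comp_fst.mul hWm.aemeasurable)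
  have h3 : ∀ s, ∫⁻ w, Q w * ENNReal.ofReal (radialWindow s (G.rho w)) ≤
      ENNReal.ofReal (k s) * ∫⁻ x in G.unitAnnulus, ‖K x‖ₑ := by
    intro s
    set e := ENNReal.ofReal (Real.exp (-(s * G.homDim))) with he
    have he0 : e ≠ 0 := by simpa [he] using Real.exp_pos _
    have h4 := G.lintegral_comp_dil s
      (f := fun w => Q w * ENNReal.ofReal (radialWindow s (G.rho w)))
      (hQm.mul (hWm.comp measurable_prodMk_right).aemeasurable)
    refine (ENNReal.mul_le_mul_iff_right he0 ENNReal.ofReal_ne_top).1 ?_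
    rw [← h4, ← _root_.mul_assoc, ← lintegral_indicator G.measurableSet_unitAnnulus,
      ← lintegral_const_mul' _ _ (ENNReal.mul_ne_top ENNReal.ofReal_ne_top ENNReal.ofReal_ne_top)]
    refine lintegral_mono fun x => ?_
    simp only [G.radialWindow_rho, G.dil_dil, neg_add_cancel, G.dil_zero_left]
    by_cases hx : x ∈ G.unitAnnulus
    · simp only [Set.indicator_of_mem hx, hQ, hK.apply_dil s (ne_zero_of_mem_unitAnnulus hx)]
      rw [enorm_mul, enorm_mul, Real.enorm_eq_ofReal (Real.exp_pos _).le, ← he, Pi.one_apply,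
        ENNReal.ofReal_one, _root_.mul_one, _root_.mul_assoc, _root_.mul_assoc,
        mul_comm ‖K x‖ₑ]
      gcongr
      rw [Real.enorm_eq_ofReal_abs]
      exact ENNReal.ofReal_le_ofReal (hle s x hx)
    · simp [Set.indicator_of_notMem hx]
  have h5 : ∫⁻ w, Q w * ENNReal.ofReal (Real.log 2) < ⊤ := by
    rw [h1, h2]
    refine (lintegral_mono h3).trans_lt ?_
    rw [lintegral_mul_const' _ _ hKA.2.ne]
    refine ENNReal.mul_lt_top (lt_of_le_of_lt (lintegral_mono fun s => ?_) hk.2) hKA.2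
    rw [Real.enorm_eq_ofReal_abs]
    exact ENNReal.ofReal_le_ofReal (le_abs_self _)
  rw [lintegral_mul_const' _ _ ENNReal.ofReal_ne_top] at h5
  exact ENNReal.lt_top_of_mul_ne_top_left h5.ne hl

variable (G) in
theorem measurable_indicator_rho (δ M : ℝ) :
    Measurable ({w | δ ≤ G.rho w ∧ G.rho w ≤ M}.indicator (1 : 𝔼 n → ℝ)) :=
  measurable_one.indicator ((measurableSet_le measurable_const G.measurable_rho).inter
    (measurableSet_le G.measurable_rho measurable_const))

theorem IsHomogeneousKernel.integrable_mul_indicator (hK : G.IsHomogeneousKernel K)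
    (hKm : AEStronglyMeasurable K) (hKA : IntegrableOn K G.unitAnnulus) {δ M : ℝ} (hδ : 0 < δ) :
    Integrable fun w => K w * {w | δ ≤ G.rho w ∧ G.rho w ≤ M}.indicator 1 w := by
  have hk : Integrable ((Set.Icc (Real.log δ - Real.log 2) (Real.log M)).indicator
      (1 : ℝ → ℝ)) := (integrable_indicator_iff measurableSet_Icc).2
    (integrableOn_const measure_Icc_lt_top.ne)
  refine hK.integrable_mul hKm hKA (G.measurable_indicator_rho δ M) ?_ hk fun s x hx => ?_
  · exact Set.indicator_of_notMem (fun h => by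
      have := h.1; rw [G.rho_zero] at this; linarith) _
  · by_cases h : G.dil s x ∈ {w | δ ≤ G.rho w ∧ G.rho w ≤ M}
    · rw [Set.indicator_of_mem h, Set.indicator_of_mem]
      · simp
      · obtain ⟨h1, h2⟩ := h
        rw [G.rho_dil] at h1 h2
        have he := Real.exp_pos s
        have h3 : δ / 2 ≤ Real.exp s := by nlinarith [hx.2]
        have h4 : Real.exp s ≤ M := by nlinarith [hx.1]
        rw [← Real.log_div hδ.ne' two_ne_zero]
        exact ⟨(Real.log_le_iff_le_exp (by positivity)).2 h3,
          (Real.le_log_iff_exp_le (he.trans_le h4)).2 h4⟩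
    · rw [Set.indicator_of_notMem h, abs_zero]
      exact Set.indicator_nonneg (fun _ _ => zero_le_one' ℝ) _

/-- Integration over a bounded range of scales of the integrals over the dilated annuli gives a
single integral against the kernel, with a radial weight. -/
theorem IsHomogeneousKernel.integral_prod_dil (hK : G.IsHomogeneousKernel K)
    (hKm : AEStronglyMeasurable K) (hKA : IntegrableOn K G.unitAnnulus) {m : ℝ → ℝ}
    (hm : Integrable m) {b : ℝ} (hmb : ∀ s, b < |s| → m s = 0) {φ : 𝔼 n → ℝ} (hφ : Measurable φ)
    {c : ℝ} (hφc : ∀ w, |φ w| ≤ c) :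
    Integrable (fun p : 𝔼 n × ℝ => G.unitAnnulus.indicator K p.1 * m p.2 * φ (G.dil p.2 p.1)) ∧
    ∫ p : 𝔼 n × ℝ, G.unitAnnulus.indicator K p.1 * m p.2 * φ (G.dil p.2 p.1) =
      ∫ w, K w * (φ w * windowIntegral m (G.rho w)) := by
  have hc : 0 ≤ c := (abs_nonneg _).trans (hφc 0)
  have hdilm : Measurable fun p : 𝔼 n × ℝ => G.dil p.2 p.1 :=
    (Continuous.group_dil G continuous_snd continuous_fst).measurable
  have hKA' : Integrable (G.unitAnnulus.indicator K) :=
    (integrable_indicator_iff G.measurableSet_unitAnnulus).2 hKA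
  have hi : Integrable (fun p : 𝔼 n × ℝ =>
      G.unitAnnulus.indicator K p.1 * m p.2 * φ (G.dil p.2 p.1)) :=
    (hKA'.mul_prod hm).mul_bdd (c := c) (hφ.comp hdilm).aestronglyMeasurable
      (Eventually.of_forall fun p => hφc _)
  refine ⟨hi, ?_⟩
  rw [Measure.volume_eq_prod] at hi ⊢
  rw [integral_prod_symm _ hi]
  have hinner : ∀ s, ∫ x, G.unitAnnulus.indicator K x * m s * φ (G.dil s x) =
      ∫ w, K w * (φ w * (m s * radialWindow s (G.rho w))) := by
    intro s
    have h1 := G.integral_comp_dil s fun w => K w * (φ w * (m s * radialWindow s (G.rho w)))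
    have h2 : ∀ x, K (G.dil s x) * (φ (G.dil s x) * (m s * radialWindow s (G.rho (G.dil s x)))) =
        Real.exp (-(s * G.homDim)) * (G.unitAnnulus.indicator K x * m s * φ (G.dil s x)) := by
      intro x
      rw [G.radialWindow_rho, G.dil_dil, neg_add_cancel, G.dil_zero_left]
      by_cases hx : x ∈ G.unitAnnulus
      · rw [Set.indicator_of_mem hx, Set.indicator_of_mem hx,
          hK.apply_dil s (ne_zero_of_mem_unitAnnulus hx), Pi.one_apply]
        ring
      · rw [Set.indicator_of_notMem hx, Set.indicator_of_notMem hx]; ring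
    simp_rw [h2] at h1
    rw [integral_const_mul] at h1
    exact mul_left_cancel₀ (Real.exp_pos _).ne' h1
  simp_rw [hinner]
  have hshell := hK.integrable_mul_indicator hKm hKA (M := 2 * Real.exp b) (Real.exp_pos (-b))
  have hjoint : Integrable (Function.uncurry fun (s : ℝ) (w : 𝔼 n) =>
      K w * (φ w * (m s * radialWindow s (G.rho w)))) (volume.prod volume) := by
    refine ((hm.abs.mul_prod hshell.abs).mul_const c).mono' ?_ (Eventually.of_forall ?_)
    · refine hKm.comp_snd.mul ((hφ.comp measurable_snd).aestronglyMeasurable.mul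
        (hm.aestronglyMeasurable.comp_fst.mul ?_))
      exact (measurable_radialWindow.comp (measurable_fst.prodMk
        (G.measurable_rho.comp measurable_snd))).aestronglyMeasurable
    · rintro ⟨s, w⟩
      simp only [Function.uncurry, Real.norm_eq_abs, abs_mul]
      by_cases hw : 1 ≤ Real.exp (-s) * G.rho w ∧ Real.exp (-s) * G.rho w ≤ 2
      · by_cases hs : b < |s|
        · simp [hmb s hs]
        have hs := abs_le.1 (not_lt.1 hs)
        have hee : Real.exp s * Real.exp (-s) = 1 := by rw [← Real.exp_add]; simp
        have hmem : w ∈ {w | Real.exp (-b) ≤ G.rho w ∧ G.rho w ≤ 2 * Real.exp b} := by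
          have h1 : Real.exp (-b) ≤ Real.exp s := Real.exp_le_exp.2 hs.1
          have h2 : Real.exp s ≤ Real.exp b := Real.exp_le_exp.2 hs.2
          have h3 := mul_le_mul_of_nonneg_left hw.1 (Real.exp_pos s).le
          have h4 := mul_le_mul_of_nonneg_left hw.2 (Real.exp_pos s).le
          rw [← _root_.mul_assoc, hee, one_mul] at h3 h4
          constructor <;> linarith
        rw [Set.indicator_of_mem hmem, radialWindow_eq_one hw, Pi.one_apply, abs_one]
        have := mul_le_mul_of_nonneg_left (hφc w) (mul_nonneg (abs_nonneg (m s))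
          (abs_nonneg (K w)))
        linarith
      · rw [radialWindow_eq_zero hw]
        simp only [abs_zero, MulZeroClass.mul_zero]
        positivity
  rw [integral_integral_swap hjoint]
  refine integral_congr_ae (Eventually.of_forall fun w => ?_)
  simp only [windowIntegral]
  rw [integral_const_mul, integral_const_mul]

/-- A homogeneous kernel with mean zero on the unit annulus integrates to zero against every
radial function supported in an annulus. -/
theorem IsHomogeneousKernel.integral_mul_radial_eq_zero (hK : G.IsHomogeneousKernel K)
    (hKm : AEStronglyMeasurable K) (hKA : IntegrableOn K G.unitAnnulus)
    (hmean : ∫ x in G.unitAnnulus, K x = 0) {g : ℝ → ℝ} (hg : Measurable g) {c : ℝ}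
    (hgc : ∀ r, |g r| ≤ c) {δ M : ℝ} (hδ : 0 < δ) (hδM : δ ≤ M)
    (hg0 : ∀ r, g r ≠ 0 → δ ≤ r ∧ r ≤ M) :
    ∫ w, K w * g (G.rho w) = 0 := by
  have hl := Real.log_pos one_lt_two
  have hM : 0 < M := hδ.trans_le hδM
  obtain ⟨b, hb1, hb2⟩ : ∃ b, Real.log M ≤ b ∧ -b ≤ Real.log δ - Real.log 2 :=
    ⟨max (Real.log M) (-(Real.log δ - Real.log 2)), le_max_left _ _, by
      rw [neg_le]; exact le_max_right _ _⟩
  set m : ℝ → ℝ := (Set.Icc (-b) b).indicator 1 with hm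
  have hm1 : ∀ s, |s| ≤ b → m s = 1 := fun s hs =>
    Set.indicator_of_mem (Set.mem_Icc.2 (abs_le.1 hs)) _
  have hm0 : ∀ s, b < |s| → m s = 0 := fun s hs =>
    Set.indicator_of_notMem (fun h => (not_le.2 hs) (abs_le.2 (Set.mem_Icc.1 h))) _
  have hmi : Integrable m := (integrable_indicator_iff measurableSet_Icc).2
    (integrableOn_const measure_Icc_lt_top.ne)
  obtain ⟨hi, hint⟩ := hK.integral_prod_dil hKm hKA hmi hm0 (hg.comp G.measurable_rho)
    (fun w => hgc (G.rho w))
  have h1 : ∫ w, K w * (g (G.rho w) * windowIntegral m (G.rho w)) =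
      (∫ w, K w * g (G.rho w)) * Real.log 2 := by
    rw [← integral_mul_const]
    refine integral_congr_ae (Eventually.of_forall fun w => ?_)
    simp only
    by_cases h : g (G.rho w) = 0
    · simp [h]
    · obtain ⟨h2, h3⟩ := hg0 _ h
      have hρ := hδ.trans_le h2
      rw [windowIntegral_eq_log_two hm1 hρ (hb2.trans (sub_le_sub_right
        (Real.log_le_log hδ h2) _)) ((Real.log_le_log hρ h3).trans hb1)]
      ring
  have h2 : ∫ p : 𝔼 n × ℝ, G.unitAnnulus.indicator K p.1 * m p.2 * g (G.rho (G.dil p.2 p.1)) =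
      0 := by
    rw [Measure.volume_eq_prod] at hi ⊢
    refine (integral_prod _ hi).trans ?_
    have h3 : ∀ x, ∫ s, G.unitAnnulus.indicator K x * m s * g (G.rho (G.dil s x)) =
        G.unitAnnulus.indicator K x * ∫ s, g (Real.exp s) := by
      intro x
      by_cases hx : x ∈ G.unitAnnulus
      · rw [← integral_add_right_eq_self (fun s => g (Real.exp s)) (Real.log (G.rho x)),
          ← integral_const_mul]
        have hρ : 0 < G.rho x := one_pos.trans_le hx.1
        refine integral_congr_ae (Eventually.of_forall fun s => ?_)
        simp only
        rw [G.rho_dil, Real.exp_add, Real.exp_log hρ]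
        by_cases h : g (Real.exp s * G.rho x) = 0
        · simp [h]
        · obtain ⟨h4, h5⟩ := hg0 _ h
          have he := Real.exp_pos s
          have h6 : δ / 2 ≤ Real.exp s := by nlinarith [hx.2]
          have h7 : Real.exp s ≤ M := by nlinarith [hx.1]
          rw [hm1 s, _root_.mul_one]
          rw [abs_le]
          refine ⟨?_, ((Real.le_log_iff_exp_le hM).2 h7).trans hb1⟩
          rw [← Real.log_div hδ.ne' two_ne_zero] at hb2
          exact hb2.trans ((Real.log_le_iff_le_exp (by positivity)).2 h6)
      · simp [Set.indicator_of_notMem hx]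
    simp only [Function.comp_apply, h3]
    rw [integral_mul_const, integral_indicator G.measurableSet_unitAnnulus, hmean,
      MulZeroClass.zero_mul]
  have h4 := hint.symm.trans h2
  simp only [Function.comp_apply] at h4
  rw [h1] at h4
  exact (mul_eq_zero.1 h4).resolve_right hl.ne'

/-- The principal value of `∫ K φ`, for a kernel with mean zero and a function `φ` that vanishes for
`ρ > M`: the integral of `K (φ - φ 0)` over the quasi-ball `ρ ≤ M`. -/
noncomputable def pvIntegral (G : HomogeneousGroup n) (K φ : 𝔼 n → ℝ) (M : ℝ) : ℝ :=
  ∫ w, K w * ({w | G.rho w ≤ M}.indicator (fun w => φ w - φ 0) w)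

/-- Near the origin, the increment of a Lipschitz function compensates the singularity of the
kernel. -/
theorem IsHomogeneousKernel.integrable_pvIntegral (hK : G.IsHomogeneousKernel K)
    (hKm : AEStronglyMeasurable K) (hKA : IntegrableOn K G.unitAnnulus) {φ : 𝔼 n → ℝ}
    (hφ : Measurable φ) {C : ℝ} (hC : ∀ w, |φ w - φ 0| ≤ C * ‖w‖) (M : ℝ) :
    Integrable fun w => K w * ({w | G.rho w ≤ M}.indicator (fun w => φ w - φ 0) w) := by
  have hC0 : 0 ≤ |C| := abs_nonneg C
  obtain ⟨a, ha, hdil⟩ := G.exists_norm_dil_le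
  obtain ⟨R, hR, hRA⟩ := G.exists_norm_le_of_rho_le 2
  obtain ⟨R', hR', hdil'⟩ := G.exists_norm_dil_le_of_le (Real.log M) R
  refine hK.integrable_mul hKm hKA (k := fun s => (Set.Iic (Real.log M)).indicator
    (fun s => |C| * (Real.exp (-(a * Real.log M)) * R') * Real.exp (a * s)) s)
    ((hφ.sub_const _).indicator (measurableSet_le G.measurable_rho measurable_const)) ?_ ?_
    fun s x hx => ?_
  · by_cases h : (0 : 𝔼 n) ∈ {w | G.rho w ≤ M}
    · rw [Set.indicator_of_mem h, sub_self]
    · rw [Set.indicator_of_notMem h]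
  · exact (integrable_indicator_iff measurableSet_Iic).2
      ((integrableOn_exp_mul_Iic ha _).const_mul _)
  · by_cases h : G.dil s x ∈ {w | G.rho w ≤ M}
    · have hs : s ≤ Real.log M := by
        have h1 : G.rho (G.dil s x) ≤ M := h
        rw [G.rho_dil] at h1
        have h2 : Real.exp s ≤ M := by nlinarith [hx.1, Real.exp_pos s]
        exact (Real.le_log_iff_exp_le ((Real.exp_pos s).trans_le h2)).2 h2
      rw [Set.indicator_of_mem h, Set.indicator_of_mem (Set.mem_Iic.2 hs)]
      refine (hC _).trans ?_
      have h3 : G.dil s x = G.dil (s - Real.log M) (G.dil (Real.log M) x) := by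
        rw [G.dil_dil]; ring_nf
      have h4 : ‖G.dil s x‖ ≤ Real.exp (a * (s - Real.log M)) * R' := by
        rw [h3]
        exact (hdil _ (by linarith) _).trans (mul_le_mul_of_nonneg_left
          (hdil' _ le_rfl _ (hRA x hx.2)) (Real.exp_pos _).le)
      calc C * ‖G.dil s x‖ ≤ |C| * ‖G.dil s x‖ :=
            mul_le_mul_of_nonneg_right (le_abs_self C) (norm_nonneg _)
        _ ≤ |C| * (Real.exp (a * (s - Real.log M)) * R') := mul_le_mul_of_nonneg_left h4 hC0
        _ = _ := by
            rw [show a * (s - Real.log M) = -(a * Real.log M) + a * s by ring, Real.exp_add]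
            ring
    · rw [Set.indicator_of_notMem h, abs_zero]
      exact Set.indicator_nonneg (fun _ _ => by positivity) _

theorem IsHomogeneousKernel.integrable_mul_radial (hK : G.IsHomogeneousKernel K)
    (hKm : AEStronglyMeasurable K) (hKA : IntegrableOn K G.unitAnnulus) {φ : 𝔼 n → ℝ}
    (hφ : Measurable φ) {B : ℝ} (hB : ∀ w, |φ w| ≤ B) {M : ℝ} (hM : ∀ w, M < G.rho w → φ w = 0)
    {u : ℝ → ℝ} (hu : Measurable u) {c : ℝ} (huc : ∀ r, |u r| ≤ c) {δ : ℝ} (hδ : 0 < δ)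
    (huδ : ∀ r < δ, u r = 0) : Integrable fun w => K w * (φ w * u (G.rho w)) := by
  have h := (hK.integrable_mul_indicator hKm hKA (M := M) hδ).mul_bdd (c := B * c)
    (hφ.mul (hu.comp G.measurable_rho)).aestronglyMeasurable (Eventually.of_forall fun w => by
      rw [Pi.mul_apply, norm_mul]
      exact mul_le_mul (hB w) (huc _) (abs_nonneg _) ((abs_nonneg _).trans (hB w)))
  refine h.congr (Eventually.of_forall fun w => ?_)
  simp only [Pi.mul_apply, Function.comp_apply]
  by_cases h1 : G.rho w < δ
  · rw [huδ _ h1]; ring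
  by_cases h2 : M < G.rho w
  · rw [hM _ h2]; ring
  · rw [Set.indicator_of_mem (show w ∈ {w | δ ≤ G.rho w ∧ G.rho w ≤ M} from
      ⟨not_lt.1 h1, not_lt.1 h2⟩), Pi.one_apply]
    ring

/-- Every regularization of the principal value by radial cutoffs that vanish near the origin
gives the same limit. -/
theorem IsHomogeneousKernel.tendsto_integral_mul_radial (hK : G.IsHomogeneousKernel K)
    (hKm : AEStronglyMeasurable K) (hKA : IntegrableOn K G.unitAnnulus)
    (hmean : ∫ x in G.unitAnnulus, K x = 0) {φ : 𝔼 n → ℝ}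
    (hφ : Measurable φ) {C : ℝ} (hC : ∀ w, |φ w - φ 0| ≤ C * ‖w‖)
    {M : ℝ} (hM : ∀ w, M < G.rho w → φ w = 0)
    {ι : Type*} {l : Filter ι} [l.IsCountablyGenerated] {u : ι → ℝ → ℝ} {c u₀ : ℝ} {δ : ι → ℝ}
    (hu : ∀ i, Measurable (u i)) (huc : ∀ i r, |u i r| ≤ c) (hδ : ∀ᶠ i in l, 0 < δ i)
    (huδ : ∀ i, ∀ r < δ i, u i r = 0) (hlim : ∀ r, 0 < r → Tendsto (fun i => u i r) l (𝓝 u₀)) :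
    Tendsto (fun i => ∫ w, K w * (φ w * u i (G.rho w))) l (𝓝 (u₀ * G.pvIntegral K φ M)) := by
  have hpv := hK.integrable_pvIntegral hKm hKA hφ hC M
  set ψ : 𝔼 n → ℝ := {w | G.rho w ≤ M}.indicator (fun w => φ w - φ 0) with hψ
  have hmain : Tendsto (fun i => ∫ w, K w * ψ w * u i (G.rho w)) l
      (𝓝 (∫ w, K w * ψ w * u₀)) := by
    refine tendsto_integral_filter_of_dominated_convergence (fun w => |K w * ψ w| * c)
      (Eventually.of_forall fun i => hpv.aestronglyMeasurable.mul
        ((hu i).comp G.measurable_rho).aestronglyMeasurable)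
      (Eventually.of_forall fun i => Eventually.of_forall fun w => ?_) (hpv.abs.mul_const c)
      (Eventually.of_forall fun w => ?_)
    · rw [norm_mul, Real.norm_eq_abs, Real.norm_eq_abs]
      exact mul_le_mul_of_nonneg_left (huc i _) (abs_nonneg _)
    · by_cases hw : w = 0
      · have : ψ w = 0 := by
          rw [hw, hψ]
          by_cases h : (0 : 𝔼 n) ∈ {w | G.rho w ≤ M}
          · rw [Set.indicator_of_mem h, sub_self]
          · rw [Set.indicator_of_notMem h]
        simp [this, tendsto_const_nhds]
      · exact (hlim _ (G.rho_pos hw)).const_mul _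
  rw [integral_mul_const, mul_comm] at hmain
  refine Tendsto.congr' ?_ hmain
  filter_upwards [hδ] with i hi
  -- `K φ u = K (φ - φ 0) u + φ 0 K u` on the quasi-ball, and the last term has integral zero
  have hrad : ∫ w, K w * ({r | r ≤ M}.indicator (u i) (G.rho w)) = 0 := by
    refine hK.integral_mul_radial_eq_zero hKm hKA hmean (δ := δ i) (M := max (δ i) M)
      ((hu i).indicator measurableSet_Iic) (c := c) (fun r => ?_) hi (le_max_left _ _)
      fun r hr => ?_
    · by_cases h : r ∈ {r | r ≤ M}
      · rw [Set.indicator_of_mem h]; exact huc i r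
      · rw [Set.indicator_of_notMem h, abs_zero]; exact (abs_nonneg _).trans (huc i 0)
    · have h1 : r ∈ {r | r ≤ M} := Set.mem_of_indicator_ne_zero hr
      rw [Set.indicator_of_mem h1] at hr
      exact ⟨not_lt.1 fun h => hr (huδ i r h), le_max_of_le_right h1⟩
  have hradi : Integrable fun w => K w * ({r | r ≤ M}.indicator (u i) (G.rho w)) := by
    have h := hK.integrable_mul_radial hKm hKA (φ := {w | G.rho w ≤ M}.indicator 1) (B := 1)
      (measurable_one.indicator (measurableSet_le G.measurable_rho measurable_const))
      (fun w => by by_cases h : w ∈ {w | G.rho w ≤ M} <;> simp [h])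
      (M := M) (fun w hw => Set.indicator_of_notMem
        (show w ∉ {w | G.rho w ≤ M} from not_le.2 hw) _) (hu i) (huc i) hi (huδ i)
    refine h.congr (Eventually.of_forall fun w => ?_)
    by_cases h : G.rho w ≤ M
    · simp [h]
    · simp [h]
  have hsplit : ∀ w, K w * (φ w * u i (G.rho w)) = K w * ψ w * u i (G.rho w) +
      φ 0 * (K w * ({r | r ≤ M}.indicator (u i) (G.rho w))) := by
    intro w
    by_cases h : G.rho w ≤ M
    · rw [hψ, Set.indicator_of_mem (show w ∈ {w | G.rho w ≤ M} from h),
        Set.indicator_of_mem (show G.rho w ∈ {r | r ≤ M} from h)]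
      ring
    · rw [hψ, Set.indicator_of_notMem (show w ∉ {w | G.rho w ≤ M} from h),
        Set.indicator_of_notMem (show G.rho w ∉ {r | r ≤ M} from h), hM w (not_le.1 h)]
      ring
  have hψi : Integrable fun w => K w * ψ w * u i (G.rho w) :=
    hpv.mul_bdd (c := c) ((hu i).comp G.measurable_rho).aestronglyMeasurable
      (Eventually.of_forall fun w => huc i _)
  rw [integral_congr_ae (Eventually.of_forall hsplit), integral_add hψi (hradi.const_mul _),
    integral_const_mul, hrad, MulZeroClass.mul_zero, _root_.add_zero]

end HomogeneousGroup

/-! ### The regular representation and the principal value -/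

/-- A smooth bump on `[-1, 1]` whose integer translates sum to `1`, the sums being telescoping. -/
noncomputable def dyadicCutoff (s : ℝ) : ℝ :=
  Real.smoothTransition (s + 1) - Real.smoothTransition s

theorem isCutoff_dyadicCutoff : IsCutoff dyadicCutoff where
  contDiff := (Real.smoothTransition.contDiff.comp (contDiff_id.add contDiff_const)).sub
    Real.smoothTransition.contDiff
  nonneg s := sub_nonneg.2 (Real.smoothTransition.monotone (by linarith))
  le_one s := by
    have h1 := Real.smoothTransition.le_one (s + 1)
    have h2 := Real.smoothTransition.nonneg s
    rw [dyadicCutoff]; linarith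
  eq_zero s hs := by
    rcases lt_abs.1 hs with h | h
    · rw [dyadicCutoff, Real.smoothTransition.one_of_one_le h.le,
        Real.smoothTransition.one_of_one_le (by linarith), sub_self]
    · rw [dyadicCutoff, Real.smoothTransition.zero_of_nonpos (by linarith),
        Real.smoothTransition.zero_of_nonpos (by linarith), sub_self]

/-- The sum of the translates of `dyadicCutoff` by the integers from `-J` to `J`. -/
noncomputable def dyadicPlateau (J : ℕ) (s : ℝ) : ℝ :=
  Real.smoothTransition (s + J + 1) - Real.smoothTransition (s - J)

theorem sum_dyadicCutoff (J : ℕ) (s : ℝ) :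
    ∑ j ∈ Finset.range (2 * J + 1), dyadicCutoff (s - (-(J : ℝ) + j)) = dyadicPlateau J s := by
  have h := Finset.sum_range_sub' (fun j : ℕ => Real.smoothTransition (s + J - j + 1)) (2 * J + 1)
  have e1 : s + J - ((0 : ℕ) : ℝ) + 1 = s + J + 1 := by push_cast; ring
  have e2 : s + J - ((2 * J + 1 : ℕ) : ℝ) + 1 = s - J := by push_cast; ring
  rw [e1, e2] at h
  rw [dyadicPlateau, ← h]
  refine Finset.sum_congr rfl fun j _ => ?_
  rw [dyadicCutoff]
  congr 2 <;> push_cast <;> ring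

theorem abs_dyadicPlateau_le (J : ℕ) (s : ℝ) : |dyadicPlateau J s| ≤ 1 := by
  rw [dyadicPlateau, abs_le]
  constructor <;>
    linarith [Real.smoothTransition.le_one (s + J + 1), Real.smoothTransition.nonneg (s + J + 1),
      Real.smoothTransition.le_one (s - J), Real.smoothTransition.nonneg (s - J)]

theorem dyadicPlateau_eq_one {J : ℕ} {s : ℝ} (h : |s| ≤ J) : dyadicPlateau J s = 1 := by
  have := abs_le.1 h
  rw [dyadicPlateau, Real.smoothTransition.one_of_one_le (by linarith [this.1]),
    Real.smoothTransition.zero_of_nonpos (by linarith [this.2]), sub_zero]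

theorem dyadicPlateau_eq_zero {J : ℕ} {s : ℝ} (h : (J : ℝ) + 1 < |s|) : dyadicPlateau J s = 0 := by
  have hJ : (0 : ℝ) ≤ J := Nat.cast_nonneg J
  rcases lt_abs.1 h with h | h
  · rw [dyadicPlateau, Real.smoothTransition.one_of_one_le (by linarith),
      Real.smoothTransition.one_of_one_le (by linarith), sub_self]
  · rw [dyadicPlateau, Real.smoothTransition.zero_of_nonpos (by linarith),
      Real.smoothTransition.zero_of_nonpos (by linarith), sub_self]

theorem continuous_dyadicPlateau (J : ℕ) : Continuous (dyadicPlateau J) :=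
  (Real.smoothTransition.continuous.comp (by fun_prop)).sub
    (Real.smoothTransition.continuous.comp (by fun_prop))

theorem tendsto_windowIntegral_dyadicPlateau {r : ℝ} (hr : 0 < r) :
    Tendsto (fun J : ℕ => windowIntegral (dyadicPlateau J) r) atTop (𝓝 (Real.log 2)) := by
  refine tendsto_const_nhds.congr' ?_
  obtain ⟨N, hN⟩ := exists_nat_ge (|Real.log r| + Real.log 2)
  filter_upwards [eventually_ge_atTop N] with J hJ
  have hJ' : (N : ℝ) ≤ J := Nat.cast_le.2 hJ
  have hl := Real.log_nonneg one_le_two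
  refine (windowIntegral_eq_log_two (b := J) (fun s hs => dyadicPlateau_eq_one hs) hr ?_ ?_).symm
  · linarith [neg_abs_le (Real.log r)]
  · linarith [le_abs_self (Real.log r)]

namespace HomogeneousGroup

variable {n : ℕ}

/-- The right regular representation `(π z f) x = f (x z)` on `L²`. -/
noncomputable def regularRep (G : HomogeneousGroup n) :
    UnitaryRep G (Lp ℝ 2 (volume : Measure (𝔼 n))) where
  toFun z := (Lp.compMeasurePreservingₗᵢ ℝ (fun x => G.mul x z)
    (G.measurePreserving_mul_right z)).toContinuousLinearMap
  map_mul x y := by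
    ext1 f
    have h := Lp.compMeasurePreserving_comp_apply f (G.measurePreserving_mul_right y)
      (G.measurePreserving_mul_right x)
    have e : (fun w => G.mul w y) ∘ (fun w => G.mul w x) = fun w => G.mul w (G.mul x y) := by
      ext1 w; exact G.mul_assoc w x y
    simp only [e] at h
    exact h
  map_zero := by
    ext1 f
    have h := Lp.compMeasurePreserving_id_apply f
    have e : (id : 𝔼 n → 𝔼 n) = fun w => G.mul w 0 := by
      ext1 w; exact (G.mul_zero w).symm
    simp only [e] at h
    exact h
  norm_apply z f := Lp.norm_compMeasurePreserving f (G.measurePreserving_mul_right z)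
  continuous_apply f := by
    let F : C(𝔼 n × 𝔼 n, 𝔼 n) := ⟨fun p => G.mul p.2 p.1,
      Continuous.group_mul G continuous_snd continuous_fst⟩
    exact Continuous.compMeasurePreservingLp (g := fun z => F.curry z) continuous_const
      F.curry.continuous (fun z => G.measurePreserving_mul_right z) (by norm_num)

theorem coeFn_regularRep (G : HomogeneousGroup n) (z : 𝔼 n) {f : 𝔼 n → ℝ} (hf : MemLp f 2) :
    G.regularRep z (hf.toLp f) =ᵐ[volume] fun x => f (G.mul x z) := by
  have h := Lp.coeFn_compMeasurePreserving (hf.toLp f) (G.measurePreserving_mul_right z)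
  have h2 := (G.measurePreserving_mul_right z).quasiMeasurePreserving.ae_eq_comp hf.coeFn_toLp
  exact h.trans h2

/-- The `L²`-valued average is given by the pointwise integral; both are tested against indicators
of sets of finite measure. -/
theorem coeFn_avg_regularRep (G : HomogeneousGroup n) {Z : Type*} [MeasurableSpace Z]
    {μ : Measure Z} [SFinite μ] {w : Z → ℝ} {g : Z → 𝔼 n} (hw : Integrable w μ)
    (hg : Measurable g) {f : 𝔼 n → ℝ} (hf : MemLp f 2) (hfc : Continuous f) {c : ℝ}
    (hfb : ∀ x, |f x| ≤ c) :
    G.regularRep.avg μ w g (hf.toLp f) =ᵐ[volume] fun x => ∫ p, w p * f (G.mul x (g p)) ∂μ := by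
  have hmeas : AEStronglyMeasurable (fun q : 𝔼 n × Z => w q.2 * f (G.mul q.1 (g q.2)))
      (volume.prod μ) :=
    hw.aestronglyMeasurable.comp_snd.mul
      ((hfc.measurable.comp (G.contDiff_mul.continuous.measurable.comp
        (measurable_fst.prodMk (hg.comp measurable_snd)))).aestronglyMeasurable)
  have hint : ∀ s : Set (𝔼 n), volume s < ⊤ →
      Integrable (fun q : 𝔼 n × Z => w q.2 * f (G.mul q.1 (g q.2)))
        ((volume.restrict s).prod μ) := by
    intro s hs
    have : IsFiniteMeasure (volume.restrict s) := ⟨by simpa using hs⟩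
    have h1 : Integrable (fun q : 𝔼 n × Z => (fun _ => c) q.1 * w q.2)
        ((volume.restrict s).prod μ) := (integrable_const c).mul_prod hw
    refine h1.norm.mono' (hmeas.mono_ac
      (Measure.AbsolutelyContinuous.prod Measure.restrict_le_self.absolutelyContinuous
        Measure.AbsolutelyContinuous.rfl)) (Eventually.of_forall fun q => ?_)
    rw [norm_mul, norm_mul, mul_comm]
    exact mul_le_mul_of_nonneg_right ((hfb _).trans (le_abs_self c)) (norm_nonneg _)
  refine ae_eq_of_forall_setIntegral_eq_of_sigmaFinite (fun s hs hμs => ?_) (fun s hs hμs => ?_)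
    fun s hs hμs => ?_
  · exact integrableOn_Lp_of_measure_ne_top _ (by norm_num) hμs.ne
  · exact (hint s hμs).integral_prod_left
  · have h1 := L2.inner_indicatorConstLp_one (𝕜 := ℝ) hs hμs.ne
      (G.regularRep.avg μ w g (hf.toLp f))
    rw [← h1, real_inner_comm, G.regularRep.inner_avg hw hg,
      integral_integral_swap (f := fun x p => w p * f (G.mul x (g p))) (hint s hμs)]
    refine integral_congr_ae (Eventually.of_forall fun p => ?_)
    simp only
    rw [real_inner_comm, L2.inner_indicatorConstLp_one (𝕜 := ℝ) hs hμs.ne, integral_const_mul]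
    congr 1
    exact setIntegral_congr_ae hs ((G.coeFn_regularRep (g p) hf).mono fun x hx _ => hx)

variable {G : HomogeneousGroup n} {f g K : 𝔼 n → ℝ} {x : 𝔼 n} {v v' : ℝ}

theorem HasConvolutionAt.unique (h : G.HasConvolutionAt f K x v)
    (h' : G.HasConvolutionAt f K x v') : v = v' :=
  tendsto_nhds_unique h.2 h'.2

theorem HasConvolutionAt.add (hf : G.HasConvolutionAt f K x v)
    (hg : G.HasConvolutionAt g K x v') : G.HasConvolutionAt (f + g) K x (v + v') := by
  have e : ∀ y, (f + g) y * K (G.mul (G.inv y) x) =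
      f y * K (G.mul (G.inv y) x) + g y * K (G.mul (G.inv y) x) := fun y => add_mul _ _ _
  refine ⟨fun ε hε => ?_, ?_⟩
  · simp only [e]; exact (hf.1 ε hε).add (hg.1 ε hε)
  · refine (hf.2.add hg.2).congr' ?_
    filter_upwards [self_mem_nhdsWithin] with ε hε
    simp only [e]
    exact (integral_add (hf.1 ε hε) (hg.1 ε hε)).symm

theorem HasConvolutionAt.const_smul (c : ℝ) (hf : G.HasConvolutionAt f K x v) :
    G.HasConvolutionAt (c • f) K x (c * v) := by
  have e : ∀ y, (c • f) y * K (G.mul (G.inv y) x) = c * (f y * K (G.mul (G.inv y) x)) := fun y => by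
    rw [Pi.smul_apply, smul_eq_mul, _root_.mul_assoc]
  refine ⟨fun ε hε => ?_, ?_⟩
  · simp only [e]; exact (hf.1 ε hε).const_mul c
  · simp only [e, integral_const_mul]
    exact hf.2.const_mul c

/-- The principal value convolution exists everywhere, and it is the limit of the smoothed dyadic
truncations. -/
theorem IsHomogeneousKernel.exists_hasConvolutionAt (hK : G.IsHomogeneousKernel K)
    (hKm : AEStronglyMeasurable K) (hKA : IntegrableOn K G.unitAnnulus)
    (hmean : ∫ x in G.unitAnnulus, K x = 0) (hf : ContDiff ℝ ∞ f) (hc : HasCompactSupport f)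
    (x : 𝔼 n) : ∃ v, G.HasConvolutionAt f K x v ∧
      Tendsto (fun J : ℕ => ∫ w, K w *
        (f (G.mul x (G.inv w)) * windowIntegral (dyadicPlateau J) (G.rho w))) atTop
        (𝓝 (Real.log 2 * v)) := by
  let e : 𝔼 n ≃ₜ 𝔼 n :=
    { toFun := fun y => G.mul (G.inv y) x
      invFun := fun w => G.mul x (G.inv w)
      left_inv := fun y => by
        simp only [G.mul_inv_rev, G.inv_inv, G.mul_inv_cancel_left]
      right_inv := fun w => by
        simp only [G.mul_inv_rev, G.inv_inv, G.mul_assoc, G.inv_mul, G.mul_zero]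
      continuous_toFun := Continuous.group_mul G G.contDiff_inv.continuous continuous_const
      continuous_invFun := Continuous.group_mul G continuous_const G.contDiff_inv.continuous }
  have he : MeasurePreserving e volume volume := G.measurePreserving_inv_mul x
  have hee := e.measurableEmbedding
  set φ : 𝔼 n → ℝ := fun w => f (G.mul x (G.inv w)) with hφ
  have hφe : ∀ y, φ (e y) = f y := fun y => congrArg f (e.symm_apply_apply y)
  have hφd : ContDiff ℝ ∞ φ :=
    hf.comp (ContDiff.group_mul G contDiff_const G.contDiff_inv)
  have hφc : HasCompactSupport φ := hc.comp_homeomorph e.symm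
  have hφm : Measurable φ := hφd.continuous.measurable
  obtain ⟨B, hB⟩ := hφd.continuous.bounded_above_of_compact_support hφc
  obtain ⟨C, hC⟩ := ContDiff.lipschitzWith_of_hasCompactSupport hφc hφd (by simp)
  have hC' : ∀ w, |φ w - φ 0| ≤ C * ‖w‖ := fun w => by
    simpa [dist_eq_norm] using hC.dist_le_mul w 0
  obtain ⟨M, hM⟩ : ∃ M, ∀ w, M < G.rho w → φ w = 0 := by
    obtain ⟨R, hR⟩ := hφc.isCompact.isBounded.subset_closedBall 0
    obtain ⟨M, -, hM⟩ := G.exists_rho_le_of_norm_le R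
    refine ⟨M, fun w hw => ?_⟩
    by_contra hne
    exact hw.not_ge (hM w (mem_closedBall_zero_iff.1 (hR (subset_tsupport _ hne))))
  have hset : ∀ ε, MeasurableSet (e ⁻¹' {w | ε < G.rho w}) := fun ε =>
    hee.measurable (measurableSet_lt measurable_const G.measurable_rho)
  have hind : ∀ ε y, K (e y) * (φ (e y) * (Set.Ioi ε).indicator 1 (G.rho (e y))) =
      (e ⁻¹' {w | ε < G.rho w}).indicator (fun y => f y * K (G.mul (G.inv y) x)) y := by
    intro ε y
    rw [hφe]
    by_cases hy : ε < G.rho (e y)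
    · rw [Set.indicator_of_mem (show y ∈ e ⁻¹' {w | ε < G.rho w} from hy),
        Set.indicator_of_mem (show G.rho (e y) ∈ Set.Ioi ε from hy), Pi.one_apply,
        _root_.mul_one, mul_comm]
      rfl
    · rw [Set.indicator_of_notMem (show y ∉ e ⁻¹' {w | ε < G.rho w} from hy),
        Set.indicator_of_notMem (show G.rho (e y) ∉ Set.Ioi ε from hy)]
      simp
  refine ⟨G.pvIntegral K φ M, ⟨?_, ?_⟩, ?_⟩
  · intro ε hε
    have h := hK.integrable_mul_radial hKm hKA hφm hB hM (u := (Set.Ioi ε).indicator 1) (c := 1)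
      (measurable_one.indicator measurableSet_Ioi)
      (fun r => by by_cases hr : r ∈ Set.Ioi ε <;> simp [hr]) hε
      (fun r hr => Set.indicator_of_notMem (fun h => (not_lt.2 hr.le) h) _)
    rw [← he.integrable_comp_emb hee] at h
    change IntegrableOn _ (e ⁻¹' {w | ε < G.rho w})
    rw [← integrable_indicator_iff (hset ε)]
    exact h.congr (Eventually.of_forall (hind ε))
  · have h := hK.tendsto_integral_mul_radial hKm hKA hmean hφm hC' hM (l := 𝓝[>] (0 : ℝ))
      (u := fun ε => (Set.Ioi ε).indicator 1) (c := 1) (u₀ := 1) (δ := fun ε => ε)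
      (fun ε => measurable_one.indicator measurableSet_Ioi)
      (fun ε r => by by_cases hr : r ∈ Set.Ioi ε <;> simp [hr]) self_mem_nhdsWithin
      (fun ε r hr => Set.indicator_of_notMem (fun h => (not_lt.2 hr.le) h) _)
      (fun r hr => by
        refine tendsto_const_nhds.congr' ?_
        filter_upwards [Ioo_mem_nhdsGT hr] with ε hε
        rw [Set.indicator_of_mem (show r ∈ Set.Ioi ε from hε.2)]; rfl)
    rw [one_mul] at h
    refine h.congr fun ε => ?_
    change _ = ∫ y in e ⁻¹' {w | ε < G.rho w}, f y * K (G.mul (G.inv y) x)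
    rw [← he.integral_comp hee, ← integral_indicator (hset ε)]
    exact integral_congr_ae (Eventually.of_forall (hind ε))
  · exact hK.tendsto_integral_mul_radial hKm hKA hmean hφm hC' hM
      (u := fun J : ℕ => windowIntegral (dyadicPlateau J))
      (δ := fun J => Real.exp (-((J : ℝ) + 1)))
      (fun J => measurable_windowIntegral (continuous_dyadicPlateau J).measurable)
      (fun J => abs_windowIntegral_le (abs_dyadicPlateau_le J))
      (Eventually.of_forall fun J => Real.exp_pos _)
      (fun J r hr => windowIntegral_eq_zero (fun s hs => dyadicPlateau_eq_zero hs) hr)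
      fun r hr => tendsto_windowIntegral_dyadicPlateau hr

end HomogeneousGroup

/-! ### The `L²` bound for the principal value convolution -/

namespace HomogeneousGroup

variable {n : ℕ} {G : HomogeneousGroup n} {f K : 𝔼 n → ℝ}

theorem coeFn_adjoint_op_regularRep (G : HomogeneousGroup n) {κ : 𝔼 n → ℝ} (hκ : Integrable κ)
    {η : ℝ → ℝ} (hη : IsCutoff η) (hf : MemLp f 2) (hfc : Continuous f) {c : ℝ}
    (hfb : ∀ x, |f x| ≤ c) (t : ℝ) :
    ContinuousLinearMap.adjoint (G.regularRep.op η κ t) (hf.toLp f) =ᵐ[volume]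
      fun x => ∫ p : 𝔼 n × ℝ, κ p.1 * η p.2 * f (G.mul x (G.inv (G.dil (t + p.2) p.1))) := by
  have hw := UnitaryRep.integrable_op_weight hη hκ
  have hg := UnitaryRep.measurable_dil_add G t
  have hinvm : Measurable G.inv := G.contDiff_inv.continuous.measurable
  rw [UnitaryRep.op, G.regularRep.adjoint_avg hw hg]
  exact G.coeFn_avg_regularRep hw (hinvm.comp hg) hf hfc hfb

/-- The integrals of `φ` over the dyadic scales from `-J` to `J`, smoothed in the radial direction,
add up to an integral against the kernel with a radial weight. -/
theorem IsHomogeneousKernel.sum_integral_prod_dil (hK : G.IsHomogeneousKernel K)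
    (hKm : AEStronglyMeasurable K) (hKA : IntegrableOn K G.unitAnnulus) {φ : 𝔼 n → ℝ}
    (hφm : Measurable φ) {c : ℝ} (hφb : ∀ w, |φ w| ≤ c) (J : ℕ) :
    ∑ j ∈ Finset.range (2 * J + 1), ∫ p : 𝔼 n × ℝ, G.unitAnnulus.indicator K p.1 *
      dyadicCutoff p.2 * φ (G.dil (-(J : ℝ) + j + p.2) p.1) =
      ∫ w, K w * (φ w * windowIntegral (dyadicPlateau J) (G.rho w)) := by
  have hη := isCutoff_dyadicCutoff
  have hshift : ∀ t : ℝ, ∫ p : 𝔼 n × ℝ, G.unitAnnulus.indicator K p.1 * dyadicCutoff p.2 *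
      φ (G.dil (t + p.2) p.1) = ∫ p : 𝔼 n × ℝ, G.unitAnnulus.indicator K p.1 *
        dyadicCutoff (p.2 - t) * φ (G.dil p.2 p.1) := by
    intro t
    have hmp : MeasurePreserving (MeasurableEquiv.prodCongr (MeasurableEquiv.refl (𝔼 n))
        (MeasurableEquiv.addLeft t)) volume volume :=
      (MeasurePreserving.id volume).prod (measurePreserving_add_left volume t)
    rw [← hmp.integral_comp (MeasurableEquiv.measurableEmbedding _) fun p : 𝔼 n × ℝ =>
      G.unitAnnulus.indicator K p.1 * dyadicCutoff (p.2 - t) * φ (G.dil p.2 p.1)]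
    refine integral_congr_ae (Eventually.of_forall fun p => ?_)
    change _ = G.unitAnnulus.indicator K p.1 * dyadicCutoff (t + p.2 - t) *
      φ (G.dil (t + p.2) p.1)
    rw [add_sub_cancel_left]
  have hcs : ∀ t s : ℝ, |t| + 1 < |s| → dyadicCutoff (s - t) = 0 := fun t s hs =>
    hη.eq_zero _ (by linarith [abs_sub_abs_le_abs_sub s t])
  have hci : ∀ t : ℝ, Integrable fun s => dyadicCutoff (s - t) := fun t =>
    hη.integrable.comp_sub_right t
  have hpi : Integrable (dyadicPlateau J) := by
    refine (integrable_finsetSum (Finset.range (2 * J + 1)) fun j _ =>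
      hci (-(J : ℝ) + j)).congr (Eventually.of_forall fun s => ?_)
    exact sum_dyadicCutoff J s
  rw [Finset.sum_congr rfl fun j _ => hshift _, ← integral_finsetSum _ fun j _ =>
    (hK.integral_prod_dil hKm hKA (hci _) (hcs _) hφm hφb).1,
    ← (hK.integral_prod_dil hKm hKA hpi (fun s hs => dyadicPlateau_eq_zero hs) hφm hφb).2]
  refine integral_congr_ae (Eventually.of_forall fun p => ?_)
  simp only
  rw [← Finset.sum_mul, ← Finset.mul_sum, sum_dyadicCutoff]

/-- The smoothed dyadic truncations of the convolution are adjoints of sums of averages of the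
regular representation along dilations. -/
theorem IsHomogeneousKernel.coeFn_adjoint_sum_op (hK : G.IsHomogeneousKernel K)
    (hKm : AEStronglyMeasurable K) (hKA : IntegrableOn K G.unitAnnulus) (hf : MemLp f 2)
    (hfc : Continuous f) {c : ℝ} (hfb : ∀ x, |f x| ≤ c) (J : ℕ) :
    ContinuousLinearMap.adjoint (∑ j ∈ Finset.range (2 * J + 1),
      G.regularRep.op dyadicCutoff (G.unitAnnulus.indicator K) (-(J : ℝ) + j)) (hf.toLp f)
      =ᵐ[volume] fun x => ∫ w, K w *
        (f (G.mul x (G.inv w)) * windowIntegral (dyadicPlateau J) (G.rho w)) := by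
  have hKi : Integrable (G.unitAnnulus.indicator K) :=
    (integrable_indicator_iff G.measurableSet_unitAnnulus).2 hKA
  rw [map_sum, sum_apply]
  have hall := ae_all_iff.2 fun j : ℕ => G.coeFn_adjoint_op_regularRep hKi isCutoff_dyadicCutoff
    hf hfc hfb (-(J : ℝ) + j)
  generalize hA : (fun j : ℕ => ContinuousLinearMap.adjoint (G.regularRep.op dyadicCutoff
    (G.unitAnnulus.indicator K) (-(J : ℝ) + j)) (hf.toLp f)) = A
  have hA' : ∀ j : ℕ, ContinuousLinearMap.adjoint (G.regularRep.op dyadicCutoff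
    (G.unitAnnulus.indicator K) (-(J : ℝ) + j)) (hf.toLp f) = A j := fun j => congrFun hA j
  simp only [hA'] at hall ⊢
  filter_upwards [Lp.coeFn_finsetSum (Finset.range (2 * J + 1)) A, hall] with x hx hx2
  rw [hx, Finset.sum_apply, Finset.sum_congr rfl fun j _ => hx2 j]
  exact hK.sum_integral_prod_dil hKm hKA (φ := fun w => f (G.mul x (G.inv w)))
    (hfc.measurable.comp
      (Continuous.group_mul G continuous_const G.contDiff_inv.continuous).measurable)
    (fun w => hfb _) J

/-- The annulus is bounded and so is its inverse, so that the `L log L` bound applies to the part of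
the kernel in the unit annulus and to the regular representation. -/
theorem exists_norm_sum_regularRep_op_le (G : HomogeneousGroup n)
    (hlog : MemLLogL K (volume.restrict G.unitAnnulus))
    (hmean : ∫ x in G.unitAnnulus, K x = 0) : ∃ M : ℝ, 0 ≤ M ∧ ∀ (m : ℕ) (t : ℝ),
      ‖∑ j ∈ Finset.range m, G.regularRep.op dyadicCutoff (G.unitAnnulus.indicator K) (t + j)‖ ≤
        M := by
  have hA := G.measurableSet_unitAnnulus
  obtain ⟨R, hR, hRA⟩ := G.exists_norm_le_of_rho_le 2
  obtain ⟨R', hR'⟩ := (isCompact_closedBall (0 : 𝔼 n) R).exists_bound_of_continuousOn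
    G.contDiff_inv.continuous.continuousOn
  have hlog' : MemLLogL (G.unitAnnulus.indicator K) volume := by
    refine ⟨(aestronglyMeasurable_indicator_iff hA).2 hlog.1,
      ((integrable_indicator_iff hA).2 hlog.2).congr (Eventually.of_forall fun x => ?_)⟩
    by_cases hx : x ∈ G.unitAnnulus <;> simp [hx]
  obtain ⟨M, hM, h⟩ := UnitaryRep.exists_norm_sum_op_le_of_memLLogL (G := G)
    (H := Lp ℝ 2 (volume : Measure (𝔼 n))) isCutoff_dyadicCutoff (R := max R R') hA
    (fun x hx => (hRA x hx.2).trans (le_max_left _ _)) (fun x hx => by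
      rw [← G.inv_inv x]
      exact (hR' _ (mem_closedBall_zero_iff.2 (hRA _ hx.2))).trans (le_max_right _ _))
    (fun x hx => Set.indicator_of_notMem hx _) hlog' (by rw [integral_indicator hA, hmean])
  exact ⟨M, hM, fun m t => h _ m t⟩

theorem eLpNorm_adjoint_apply_toLp_le
    (S : Lp ℝ 2 (volume : Measure (𝔼 n)) →L[ℝ] Lp ℝ 2 (volume : Measure (𝔼 n))) {M : ℝ}
    (hM : 0 ≤ M) (hS : ‖S‖ ≤ M) (hf : MemLp f 2) :
    eLpNorm (ContinuousLinearMap.adjoint S (hf.toLp f)) 2 ≤ ENNReal.ofReal M * eLpNorm f 2 := by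
  have h1 : ‖ContinuousLinearMap.adjoint S (hf.toLp f)‖ ≤ M * ‖hf.toLp f‖ :=
    (ContinuousLinearMap.le_opNorm _ _).trans (mul_le_mul_of_nonneg_right
      ((LinearIsometryEquiv.norm_map ContinuousLinearMap.adjoint S).trans_le hS) (norm_nonneg _))
  have h2 := ENNReal.ofReal_le_ofReal h1
  rw [ENNReal.ofReal_mul hM, ofReal_norm, ofReal_norm, Lp.enorm_toLp, Lp.enorm_def] at h2
  exact h2

/-- Fatou's lemma for a pointwise limit of functions bounded in `L²`. -/
theorem eLpNorm_le_of_tendsto_mul {F : ℕ → 𝔼 n → ℝ} {v : 𝔼 n → ℝ} {a : ℝ} (ha : 0 < a)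
    {B : ENNReal} (hFm : ∀ J, AEStronglyMeasurable (F J)) (hFB : ∀ J, eLpNorm (F J) 2 ≤ B)
    (hlim : ∀ x, Tendsto (fun J => F J x) atTop (𝓝 (a * v x))) :
    AEStronglyMeasurable v ∧ eLpNorm v 2 ≤ ENNReal.ofReal a⁻¹ * B := by
  have hvm : AEStronglyMeasurable fun x => a * v x :=
    aestronglyMeasurable_of_tendsto_ae atTop hFm (Eventually.of_forall hlim)
  have hvn : eLpNorm (fun x => a * v x) 2 ≤ B :=
    (Lp.eLpNorm_lim_le_liminf_eLpNorm hFm _ (Eventually.of_forall hlim)).trans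
      (liminf_le_of_le (by isBoundedDefault) fun b hb => by
        obtain ⟨J, hJ⟩ := hb.exists
        exact hJ.trans (hFB J))
  have hveq : v = a⁻¹ • fun x => a * v x := by
    ext x
    rw [Pi.smul_apply, smul_eq_mul, inv_mul_cancel_left₀ ha.ne']
  refine ⟨?_, ?_⟩
  · rw [hveq]; exact hvm.const_smul _
  · rw [hveq, eLpNorm_const_smul, Real.enorm_eq_ofReal (inv_nonneg.2 ha.le)]
    gcongr

/-- The `L²` estimate on test functions. -/
theorem IsHomogeneousKernel.exists_eLpNorm_le (hK : G.IsHomogeneousKernel K)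
    (hlog : MemLLogL K (volume.restrict G.unitAnnulus))
    (hmean : ∫ x in G.unitAnnulus, K x = 0) : ∃ C : ℝ, 0 ≤ C ∧ ∀ f : 𝔼 n → ℝ,
      ContDiff ℝ ∞ f → HasCompactSupport f → ∃ v : 𝔼 n → ℝ,
        (∀ x, G.HasConvolutionAt f K x (v x)) ∧ AEStronglyMeasurable v ∧
          eLpNorm v 2 ≤ ENNReal.ofReal C * eLpNorm f 2 := by
  have hKm := hK.aestronglyMeasurable hlog.1
  have hKA : IntegrableOn K G.unitAnnulus := hlog.integrable
  have hl := Real.log_pos one_lt_two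
  obtain ⟨M, hM, hnorm⟩ := G.exists_norm_sum_regularRep_op_le hlog hmean
  refine ⟨(Real.log 2)⁻¹ * M, by positivity, fun f hf hc => ?_⟩
  rw [ENNReal.ofReal_mul (inv_nonneg.2 hl.le), _root_.mul_assoc]
  choose v hv hlim using fun x => hK.exists_hasConvolutionAt hKm hKA hmean hf hc x
  obtain ⟨c, hfb⟩ := hf.continuous.bounded_above_of_compact_support hc
  have hfL : MemLp f 2 := hf.continuous.memLp_of_hasCompactSupport hc
  have hF := hK.coeFn_adjoint_sum_op hKm hKA hfL hf.continuous hfb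
  exact ⟨v, hv, eLpNorm_le_of_tendsto_mul hl
    (fun J => (Lp.aestronglyMeasurable _).congr (hF J))
    (fun J => (eLpNorm_congr_ae (hF J)).symm.trans_le
      (eLpNorm_adjoint_apply_toLp_le _ hM (hnorm _ _) hfL)) hlim⟩

theorem norm_toLp_le_of_eLpNorm_le {f v : 𝔼 n → ℝ} (hf : MemLp f 2) (hv : MemLp v 2) {C : ℝ}
    (hC : 0 ≤ C) (h : eLpNorm v 2 ≤ ENNReal.ofReal C * eLpNorm f 2) :
    ‖hv.toLp v‖ ≤ C * ‖hf.toLp f‖ := by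
  have hfin : ENNReal.ofReal C * eLpNorm f 2 ≠ ⊤ :=
    ENNReal.mul_ne_top ENNReal.ofReal_ne_top hf.eLpNorm_ne_top
  rw [Lp.norm_toLp, Lp.norm_toLp]
  refine (ENNReal.toReal_mono hfin h).trans_eq ?_
  rw [ENNReal.toReal_mul, ENNReal.toReal_ofReal hC]

/-- The smooth compactly supported functions. -/
def testFunctions (n : ℕ) : Submodule ℝ (𝔼 n → ℝ) where
  carrier := {f | ContDiff ℝ ∞ f ∧ HasCompactSupport f}
  add_mem' hf hg := ⟨hf.1.add hg.1, hf.2.add hg.2⟩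
  zero_mem' := ⟨contDiff_const, HasCompactSupport.zero⟩
  smul_mem' c _ hf := ⟨contDiff_const.smul hf.1, hf.2.smul_left (f := fun _ => c)⟩

theorem memLp_testFunctions (f : testFunctions n) : MemLp (f : 𝔼 n → ℝ) 2 :=
  f.2.1.continuous.memLp_of_hasCompactSupport f.2.2

/-- The inclusion of the smooth compactly supported functions into `L²`. -/
noncomputable def testFunctionsToLp (n : ℕ) :
    testFunctions n →ₗ[ℝ] Lp ℝ 2 (volume : Measure (𝔼 n)) where
  toFun f := (memLp_testFunctions f).toLp f
  map_add' f g := MemLp.toLp_add (memLp_testFunctions f) (memLp_testFunctions g)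
  map_smul' c f := MemLp.toLp_const_smul c (memLp_testFunctions f)

theorem denseRange_testFunctionsToLp (n : ℕ) : DenseRange (testFunctionsToLp n) := by
  refine (Lp.dense_hasCompactSupport_contDiff (E := 𝔼 n) (F := ℝ) (μ := volume) (p := 2)
    (by norm_num)).mono ?_
  rintro f ⟨g, hfg, hgc, hg⟩
  refine ⟨⟨g, hg, hgc⟩, ?_⟩
  refine Lp.ext ?_
  exact (MemLp.coeFn_toLp (memLp_testFunctions ⟨g, hg, hgc⟩)).trans hfg.symm

end HomogeneousGroup

theorem theorem1 {n : ℕ} (G : HomogeneousGroup n) (K : EuclideanSpace ℝ (Fin n) → ℝ)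
    (hK : G.IsHomogeneousKernel K)
    (hLLogL : MemLLogL K (volume.restrict G.unitAnnulus))
    (hmean : ∫ x in G.unitAnnulus, K x = 0) :
    G.ConvolutionBoundedOnL2 K := by
  obtain ⟨C, hC, h⟩ := hK.exists_eLpNorm_le hLLogL hmean
  choose v hv hvm hvn using fun f : HomogeneousGroup.testFunctions n => h f f.2.1 f.2.2
  have hvL : ∀ f, MemLp (v f) 2 := fun f => ⟨hvm f, (hvn f).trans_lt
    (ENNReal.mul_lt_top ENNReal.ofReal_lt_top (HomogeneousGroup.memLp_testFunctions f).2)⟩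
  let T : HomogeneousGroup.testFunctions n →ₗ[ℝ]
      Lp ℝ 2 (volume : Measure (EuclideanSpace ℝ (Fin n))) :=
    { toFun := fun f => (hvL f).toLp (v f)
      map_add' := fun f g => by
        rw [← MemLp.toLp_add]
        refine MemLp.toLp_congr _ _ (Eventually.of_forall fun x => ?_)
        exact (hv (f + g) x).unique ((hv f x).add (hv g x))
      map_smul' := fun c f => by
        rw [RingHom.id_apply, ← MemLp.toLp_const_smul]
        refine MemLp.toLp_congr _ _ (Eventually.of_forall fun x => ?_)
        exact (hv (c • f) x).unique ((hv f x).const_smul c) }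
  have hbound : ∃ C, ∀ f, ‖T f‖ ≤ C * ‖HomogeneousGroup.testFunctionsToLp n f‖ :=
    ⟨C, fun f => HomogeneousGroup.norm_toLp_le_of_eLpNorm_le
      (HomogeneousGroup.memLp_testFunctions f) (hvL f) hC (hvn f)⟩
  refine ⟨T.extendOfNorm (HomogeneousGroup.testFunctionsToLp n), fun f hf hc => ?_⟩
  have hT := LinearMap.extendOfNorm_eq (HomogeneousGroup.denseRange_testFunctionsToLp n) hbound
    ⟨f, hf, hc⟩
  have he : HomogeneousGroup.testFunctionsToLp n ⟨f, hf, hc⟩ =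
      (hf.continuous.memLp_of_hasCompactSupport hc).toLp f := rfl
  rw [he] at hT
  rw [hT]
  filter_upwards [(hvL ⟨f, hf, hc⟩).coeFn_toLp] with x hx
  change G.HasConvolutionAt f K x ((hvL ⟨f, hf, hc⟩).toLp _ x)
  rw [hx]
  exact hv ⟨f, hf, hc⟩ x
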